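/- Let $n\ge 1$ and let $f:\mathbb{R}^n\to\mathbb{R}$ be a metric function, i.e. a $C^2$ function such that $|\nabla f|$ is constant on each connected component of each level set of $f$. Assume that every connected component of the critical set $\{\nabla f=0\}$ is either a single point or a regular ($C^1$ embedded) surface of some dimension $r$ with $1\le r\le n-1$, and that every such component is isolated from the others (it is relatively open in the critical set). Call the connected components of the level sets of $f$ the level surfaces of $f$, and call a level surface critical if $\nabla f=0$ on it. Then the level surfaces of $f$ form a $C^\infty$ foliation with singularities of $\mathbb{R}^n$: they are connected embedded $C^\infty$ submanifolds partitioning $\mathbb{R}^n$, and around each point $x$, lying on a level surface of dimension $d$, there is a $C^\infty$ chart $\psi:U\to V_1\times V_2\subseteq\mathbb{R}^d\times\mathbb{R}^{n-d}$ with $\psi(x)=(0,0)$ such that every level surface $L$ meeting $U$ satisfies $L\cap U=\psi^{-1}(V_1\times l)$, where $l=\{v\in V_2:\psi^{-1}(0,v)\in L\}$. Moreover, this foliation is of one of the following types: 1. it consists of all hyperplanes parallel to a given hyperplane; 2. it consists of all hyperspheres with a given centre, together with this centre; 3. for some $k$ with $1\le k\le n-2$, it consists of all cylinders $\{p+v+w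 : v\in W^\perp,\ |v|=\rho,\ w\in W\}\cong S^{n-k-1}\times\mathbb{R}^k$ with $\rho>0$, together with the singular leaf $p+W\cong\mathbb{R}^k$, where $p\in\mathbb{R}^n$ and $W\subseteq\mathbb{R}^n$ is a $k$-dimensional linear subspace; here $k$ is the minimum of the dimensions of the critical level surfaces of $f$. -/

import Mathlib

open scoped ContDiff

/-- A `k`-dimensional regular surface (embedded submanifold) of class `C^m` in `ℝⁿ`: around each
of its points a local `C^m` diffeomorphism of `ℝⁿ` flattens it onto a `k`-dimensional linear
subspace. For `k = 0` this means a set of isolated points, for `k = n` an open set. -/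
def IsRegularSurface {n : ℕ} (m : WithTop ℕ∞) (k : ℕ) (S : Set (EuclideanSpace ℝ (Fin n))) :
    Prop :=
  ∀ p ∈ S, ∃ (Φ : OpenPartialHomeomorph (EuclideanSpace ℝ (Fin n)) (EuclideanSpace ℝ (Fin n)))
    (W : Submodule ℝ (EuclideanSpace ℝ (Fin n))),
    p ∈ Φ.source ∧ ContDiffOn ℝ m Φ Φ.source ∧ ContDiffOn ℝ m Φ.symm Φ.target ∧
      Module.finrank ℝ W = k ∧ ∀ x ∈ Φ.source, x ∈ S ↔ Φ x ∈ W

/-- The level surface of `f` through `x`: the connected component of `x` in its level set. -/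
def levelSurface {n : ℕ} (f : EuclideanSpace ℝ (Fin n) → ℝ) (x : EuclideanSpace ℝ (Fin n)) :
    Set (EuclideanSpace ℝ (Fin n)) :=
  connectedComponentIn (f ⁻¹' {f x}) x

/-- The family of all level surfaces of `f`. -/
def levelSurfaces {n : ℕ} (f : EuclideanSpace ℝ (Fin n) → ℝ) :
    Set (Set (EuclideanSpace ℝ (Fin n))) :=
  Set.range (levelSurface f)

/-- A metric function: of class `C²`, with gradient of constant length on each connected component
of each level set. -/
def IsMetricFunction {n : ℕ} (f : EuclideanSpace ℝ (Fin n) → ℝ) : Prop :=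
  ContDiff ℝ 2 f ∧ ∀ x, ∀ y ∈ levelSurface f x, ‖gradient f y‖ = ‖gradient f x‖

/-- The set of critical points of `f`. -/
def criticalSet {n : ℕ} (f : EuclideanSpace ℝ (Fin n) → ℝ) : Set (EuclideanSpace ℝ (Fin n)) :=
  {x | gradient f x = 0}

/-- Every connected component of the critical set is either a point or a regular surface (of
dimension between `1` and `n - 1`), and is isolated from the other components. -/
def HasRegularCriticalSet {n : ℕ} (f : EuclideanSpace ℝ (Fin n) → ℝ) : Prop :=
  ∀ p ∈ criticalSet f,
    (connectedComponentIn (criticalSet f) p = {p} ∨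
      ∃ r : ℕ, 1 ≤ r ∧ r < n ∧ IsRegularSurface 1 r (connectedComponentIn (criticalSet f) p)) ∧
    ∃ O : Set (EuclideanSpace ℝ (Fin n)), IsOpen O ∧
      O ∩ criticalSet f = connectedComponentIn (criticalSet f) p

/-- A foliation with singularities of class `C^m` of `ℝⁿ`, all of whose leaves are embedded: a
partition into connected submanifolds such that around each point `x`, lying on a leaf of
dimension `k` say, there is a `C^m` chart onto a product `V₁ × V₂ ⊆ ℝᵏ × ℝⁿ⁻ᵏ`, centred at `x`,
in which every leaf is of the form `V₁ × l`. -/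
structure IsSingularFoliation {n : ℕ} (m : WithTop ℕ∞)
    (F : Set (Set (EuclideanSpace ℝ (Fin n)))) : Prop where
  isPartition : Setoid.IsPartition F
  isConnected : ∀ L ∈ F, IsConnected L
  exists_chart : ∀ L₀ ∈ F, ∃ k : ℕ, k ≤ n ∧ IsRegularSurface m k L₀ ∧ ∀ x ∈ L₀,
    ∃ (ψ : OpenPartialHomeomorph (EuclideanSpace ℝ (Fin n))
        (EuclideanSpace ℝ (Fin k) × EuclideanSpace ℝ (Fin (n - k))))
      (V₁ : Set (EuclideanSpace ℝ (Fin k))) (V₂ : Set (EuclideanSpace ℝ (Fin (n - k)))),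
      x ∈ ψ.source ∧ ContDiffOn ℝ m ψ ψ.source ∧ ContDiffOn ℝ m ψ.symm ψ.target ∧
        ψ.target = V₁ ×ˢ V₂ ∧ ψ x = (0, 0) ∧
        ∀ L ∈ F, (L ∩ ψ.source).Nonempty →
          L ∩ ψ.source = ψ.symm '' (V₁ ×ˢ {v | v ∈ V₂ ∧ ψ.symm (0, v) ∈ L})

/-- The cylinder `S × W` of radius `r` around the affine plane `p + W`, where `S` is the sphere of
radius `r` about the origin in the orthogonal complement of `W`. -/
def roundCylinder {n : ℕ} (p : EuclideanSpace ℝ (Fin n))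
    (W : Submodule ℝ (EuclideanSpace ℝ (Fin n))) (r : ℝ) : Set (EuclideanSpace ℝ (Fin n)) :=
  {x | ∃ v ∈ Wᗮ, ∃ w ∈ W, ‖v‖ = r ∧ x = p + v + w}

/-- The affine plane through `p` with direction `W`. -/
def planeThrough {n : ℕ} (p : EuclideanSpace ℝ (Fin n))
    (W : Submodule ℝ (EuclideanSpace ℝ (Fin n))) : Set (EuclideanSpace ℝ (Fin n)) :=
  {x | ∃ w ∈ W, x = p + w}

/-- All hyperplanes parallel to a given one. -/
def IsParallelHyperplanes {n : ℕ} (F : Set (Set (EuclideanSpace ℝ (Fin n)))) : Prop :=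
  ∃ a : EuclideanSpace ℝ (Fin n), a ≠ 0 ∧ F = {L | ∃ c : ℝ, L = {x | inner ℝ a x = c}}

/-- All hyperspheres about a point, and that point. -/
def IsConcentricSpheres {n : ℕ} (F : Set (Set (EuclideanSpace ℝ (Fin n)))) : Prop :=
  ∃ p : EuclideanSpace ℝ (Fin n), F = {L | ∃ r : ℝ, 0 < r ∧ L = Metric.sphere p r} ∪ {{p}}

/-- All round cylinders `Sⁿ⁻ᵏ⁻¹ × ℝᵏ` about a `k`-dimensional plane, and that plane. -/
def IsConcentricCylinders {n : ℕ} (k : ℕ) (F : Set (Set (EuclideanSpace ℝ (Fin n)))) : Prop :=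
  ∃ (p : EuclideanSpace ℝ (Fin n)) (W : Submodule ℝ (EuclideanSpace ℝ (Fin n))),
    Module.finrank ℝ W = k ∧
      F = {L | ∃ r : ℝ, 0 < r ∧ L = roundCylinder p W r} ∪ {planeThrough p W}

/-- The dimensions of the critical level surfaces of `f`. -/
def criticalDimensions {n : ℕ} (f : EuclideanSpace ℝ (Fin n) → ℝ) : Set ℕ :=
  {r | ∃ L ∈ levelSurfaces f, L ⊆ criticalSet f ∧ IsRegularSurface 1 r L}

open Set Filter Topology Metric Asymptotics

/-! Write ν = ∇f/|∇f|. Since |∇f| is constant along level surfaces, ν is an eigenvector of the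
Hessian of f. So Dν is symmetric and kills ν: the integral curves of ν are straight, and on balls
without critical points ν is the gradient of a 1-Lipschitz function u. There |∇f| depends on u only,
which puts a nearest critical point z of x on the normal line through x
(`IsMetricFunction.nearest_critical`).

This carries the normal lines through the critical set. Lines normal to a critical component C are
limits of lines from critical points to points having them as nearest critical point, so ∇f is
tangent to them (`IsMetricFunction.normal_segment`); conversely a normal line reaching C is normal
to C there. Since components are isolated, ∇f is tangent to a normal line all the way
(`IsMetricFunction.isAligned_global`). Hence f(y + tν(y)) is constant as y runs over a noncritical
level surface, and the surface, pushed along its normals to a critical point, stays in one critical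
component. The notion used throughout is `IsAligned` rather than equality with ±ν, because it is
closed and makes sense at critical points.

If every critical component is a hypersurface, there are no focal points. Away from the critical set
ν is carried to ±ν by the parallel map; at a critical hypersurface, tangent balls on its two sides
bound the variation of the normal by the displacement. So the symmetric operator Dν has no nonzero
eigenvalue, ν is constant on level surfaces, and f is a function of one linear coordinate
(`IsMetricFunction.exists_eq_comp_inner`).

If some component C has codimension at least 2, its unit normals at a point are joined by great
circles, on which f is constant. Half a turn shows that a critical component met at w + τm is also
met at w − τm. If a normal line met C twice, iterated reflection would give infinitely many points
of C on it, all focal, hence infinitely many eigenvalues of Dν at one point. So it meets C once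
(`IsMetricFunction.notMem_normal_line`); therefore C lies in its tangent plane and, being closed, is
the whole plane, and f depends on the distance to C only.

In both cases f = h ∘ q with q a linear form or a distance. The critical set has empty interior, so
the level surfaces are exactly the fibres of q (`IsMetricFunction.levelSurface_eq_fiber`), for which
the charts are explicit. -/

/-- The unit normal field `∇f / |∇f|` (zero at the critical points). -/
noncomputable def unitNormal {n : ℕ} (f : EuclideanSpace ℝ (Fin n) → ℝ)
    (x : EuclideanSpace ℝ (Fin n)) : EuclideanSpace ℝ (Fin n) :=
  ‖gradient f x‖⁻¹ • gradient f x

/-! ### Differential calculus along the level sets at noncritical points -/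

section LocalStructure

variable {n : ℕ} {f : EuclideanSpace ℝ (Fin n) → ℝ} {x y : EuclideanSpace ℝ (Fin n)}

theorem contDiff_gradient (hf : ContDiff ℝ 2 f) : ContDiff ℝ 1 (gradient f) :=
  (InnerProductSpace.toDual ℝ (EuclideanSpace ℝ (Fin n))).symm.contDiff.comp
    (hf.fderiv_right (m := 1) (by norm_num))

theorem continuous_gradient (hf : ContDiff ℝ 2 f) : Continuous (gradient f) :=
  (contDiff_gradient hf).continuous

theorem hasFDerivAt_gradient (hf : ContDiff ℝ 2 f) (x : EuclideanSpace ℝ (Fin n)) :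
    HasFDerivAt (gradient f) (fderiv ℝ (gradient f) x) x :=
  ((contDiff_gradient hf).differentiable one_ne_zero x).hasFDerivAt

theorem hasFDerivAt_inner_gradient (hf : ContDiff ℝ 2 f) (x : EuclideanSpace ℝ (Fin n)) :
    HasFDerivAt f (innerSL ℝ (gradient f x)) x :=
  ((hf.differentiable two_ne_zero x).hasGradientAt).hasFDerivAt

theorem hasDerivAt_comp_curve (hf : ContDiff ℝ 2 f) {c : ℝ → EuclideanSpace ℝ (Fin n)}
    {v : EuclideanSpace ℝ (Fin n)} {t : ℝ} (hc : HasDerivAt c v t) :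
    HasDerivAt (fun s => f (c s)) (inner ℝ (gradient f (c t)) v) t :=
  (hasFDerivAt_inner_gradient hf (c t)).comp_hasDerivAt t hc

theorem hasDerivAt_line (x e : EuclideanSpace ℝ (Fin n)) (t : ℝ) :
    HasDerivAt (fun s : ℝ => x + s • e) e t := by
  simpa using ((hasDerivAt_id t).smul_const e).const_add x

theorem isClosed_criticalSet (hf : ContDiff ℝ 2 f) : IsClosed (criticalSet f) :=
  isClosed_eq (continuous_gradient hf) continuous_const

theorem inner_fderiv_gradient_comm (hf : ContDiff ℝ 2 f) (x v w : EuclideanSpace ℝ (Fin n)) :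
    inner ℝ (fderiv ℝ (gradient f) x v) w = inner ℝ (fderiv ℝ (gradient f) x w) v := by
  have key : ∀ v w, inner ℝ (fderiv ℝ (gradient f) x v) w = fderiv ℝ (fderiv ℝ f) x v w := by
    intro v w
    have h1 : HasFDerivAt (fun y => fderiv ℝ f y w)
        ((ContinuousLinearMap.apply ℝ ℝ w).comp (fderiv ℝ (fderiv ℝ f) x)) x :=
      (ContinuousLinearMap.apply ℝ ℝ w).hasFDerivAt.comp x
        (((hf.fderiv_right (m := 1) (by norm_num)).differentiable one_ne_zero x).hasFDerivAt)
    have h2 : HasFDerivAt (fun y => inner ℝ (gradient f y) w)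
        ((innerSL ℝ w).comp (fderiv ℝ (gradient f) x)) x := by
      have := (innerSL ℝ w).hasFDerivAt.comp x (hasFDerivAt_gradient hf x)
      refine this.congr_of_eventuallyEq (Eventually.of_forall fun y => ?_)
      exact real_inner_comm _ _
    have h3 : (fun y => inner ℝ (gradient f y) w) = fun y => fderiv ℝ f y w := by
      funext y; exact inner_gradient_left
    rw [h3] at h2
    have := congrArg (fun A => A v) (h1.unique h2)
    simpa using (real_inner_comm _ _).trans this.symm
  rw [key, key]
  exact (hf.contDiffAt.isSymmSndFDerivAt (by simp)) v w

theorem self_mem_levelSurface (f : EuclideanSpace ℝ (Fin n) → ℝ) (x : EuclideanSpace ℝ (Fin n)) :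
    x ∈ levelSurface f x :=
  mem_connectedComponentIn rfl

theorem levelSurface_subset (f : EuclideanSpace ℝ (Fin n) → ℝ) (x : EuclideanSpace ℝ (Fin n)) :
    levelSurface f x ⊆ f ⁻¹' {f x} :=
  connectedComponentIn_subset _ _

theorem isPreconnected_levelSurface (f : EuclideanSpace ℝ (Fin n) → ℝ)
    (x : EuclideanSpace ℝ (Fin n)) : IsPreconnected (levelSurface f x) :=
  isPreconnected_connectedComponentIn

theorem isClosed_levelSurface (hf : Continuous f) (x : EuclideanSpace ℝ (Fin n)) :
    IsClosed (levelSurface f x) :=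
  isClosed_of_closure_subset <|
    (isPreconnected_levelSurface f x).closure.subset_connectedComponentIn
      (subset_closure (self_mem_levelSurface f x))
      (closure_minimal (levelSurface_subset f x) (isClosed_singleton.preimage hf))

theorem eq_of_mem_levelSurface (h : y ∈ levelSurface f x) : f y = f x :=
  levelSurface_subset f x h

theorem levelSurface_eq_of_mem (h : y ∈ levelSurface f x) :
    levelSurface f y = levelSurface f x := by
  unfold levelSurface at *
  have hy : f y = f x := eq_of_mem_levelSurface h
  rw [hy]
  exact (connectedComponentIn_eq h).symm

theorem subset_levelSurface {S : Set (EuclideanSpace ℝ (Fin n))} (hS : IsPreconnected S)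
    (hx : x ∈ S) (h : ∀ y ∈ S, f y = f x) : S ⊆ levelSurface f x :=
  hS.subset_connectedComponentIn hx h

/-- Nearby points of a level set at a noncritical point are joined by differentiable paths inside
that level set. -/
theorem exists_path_in_level (hf : ContDiff ℝ 2 f) (hx : gradient f x ≠ 0)
    {N : Set (EuclideanSpace ℝ (Fin n))} (hN : N ∈ 𝓝 x) :
    (∀ᶠ y in 𝓝 x, f y = f x → ∃ c : ℝ → EuclideanSpace ℝ (Fin n), c 0 = x ∧ c 1 = y ∧
      ∀ s ∈ Icc (0 : ℝ) 1, c s ∈ N ∧ f (c s) = f x ∧ DifferentiableAt ℝ c s) ∧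
    ∀ v, inner ℝ (gradient f x) v = 0 → ∃ c : ℝ → EuclideanSpace ℝ (Fin n), c 0 = x ∧
      HasDerivAt c v 0 ∧ ∀ᶠ s in 𝓝 (0 : ℝ), f (c s) = f x := by
  set g := gradient f x with hg
  have hgn : 0 < ‖g‖ := norm_pos_iff.2 hx
  set e := ‖g‖⁻¹ • g with he
  have hee : inner ℝ e e = (1 : ℝ) := by
    rw [he, inner_smul_left, inner_smul_right, real_inner_self_eq_norm_sq]
    simp; field_simp
  have hge : g = ‖g‖ • e := by rw [he, smul_smul, mul_inv_cancel₀ hgn.ne', one_smul]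
  -- `Ψ` replaces the coordinate along `e` by `f`, so its local inverse maps segments orthogonal to
  -- `e` to paths in a level set of `f`.
  let Ψ : EuclideanSpace ℝ (Fin n) → EuclideanSpace ℝ (Fin n) :=
    fun y => y - (inner ℝ e y : ℝ) • e + f y • e
  have hΨ : ContDiff ℝ 1 Ψ := by
    have h1 : ContDiff ℝ 1 f := hf.of_le (by norm_num)
    have h2 : ContDiff ℝ 1 (fun y => (inner ℝ e y : ℝ)) := contDiff_const.inner ℝ contDiff_id
    exact (contDiff_id.sub (h2.smul contDiff_const)).add (h1.smul contDiff_const)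
  let A : EuclideanSpace ℝ (Fin n) →L[ℝ] EuclideanSpace ℝ (Fin n) :=
    ContinuousLinearMap.id ℝ _ - (innerSL ℝ e).smulRight e + (innerSL ℝ g).smulRight e
  let B : EuclideanSpace ℝ (Fin n) →L[ℝ] EuclideanSpace ℝ (Fin n) :=
    ContinuousLinearMap.id ℝ _ - (innerSL ℝ e).smulRight e + ‖g‖⁻¹ • (innerSL ℝ e).smulRight e
  have hgi : ∀ v, inner ℝ g v = ‖g‖ * inner ℝ e v := fun v => by
    conv_lhs => rw [hge]
    rw [inner_smul_left]; simp
  have hAv : ∀ v, A v = v + ((‖g‖ - 1) * inner ℝ e v) • e := fun v => by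
    simp only [A, add_apply, sub_apply,
      ContinuousLinearMap.id_apply, ContinuousLinearMap.smulRight_apply, innerSL_apply_apply, hgi]
    module
  have hBv : ∀ v, B v = v + ((‖g‖⁻¹ - 1) * inner ℝ e v) • e := fun v => by
    simp only [B, add_apply, sub_apply,
      ContinuousLinearMap.id_apply, ContinuousLinearMap.smulRight_apply, innerSL_apply_apply,
      smul_apply]
    module
  let A' : EuclideanSpace ℝ (Fin n) ≃L[ℝ] EuclideanSpace ℝ (Fin n) :=
    ContinuousLinearEquiv.equivOfInverse A B
      (fun v => by
        rw [hAv, hBv, inner_add_right, inner_smul_right, hee]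
        match_scalars <;> field_simp
        ring)
      (fun v => by
        rw [hAv, hBv, inner_add_right, inner_smul_right, hee]
        match_scalars <;> field_simp
        ring)
  have hA : HasFDerivAt Ψ (A' : _ →L[ℝ] _) x := by
    have h2 : HasFDerivAt (fun y => (inner ℝ e y : ℝ)) (innerSL ℝ e) x := (innerSL ℝ e).hasFDerivAt
    exact ((hasFDerivAt_id x).sub (h2.smul_const e)).add
      ((hasFDerivAt_inner_gradient hf x).smul_const e)
  have hΨx := hΨ.contDiffAt (x := x)
  let Φ := hΨx.toOpenPartialHomeomorph Ψ hA one_ne_zero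
  have hΦ : ∀ y, Φ y = Ψ y := fun y => rfl
  have hxs : x ∈ Φ.source := hΨx.mem_toOpenPartialHomeomorph_source hA one_ne_zero
  have hsymm : ContDiffAt ℝ 1 Φ.symm (Ψ x) := hΨx.to_localInverse hA one_ne_zero
  have hΨx' : Φ.symm (Ψ x) = x := Φ.left_inv hxs
  have hlev : ∀ y, inner ℝ e (Ψ y) = f y := fun y => by
    simp only [Ψ, inner_add_right, inner_sub_right, inner_smul_right, hee]
    ring
  have hnear : ∀ᶠ q in 𝓝 (Ψ x), q ∈ Φ.target ∧ Φ.symm q ∈ N ∧ DifferentiableAt ℝ Φ.symm q := by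
    refine Filter.Eventually.and (Φ.open_target.mem_nhds (Φ.map_source hxs)) (.and ?_ ?_)
    · exact hsymm.continuousAt.eventually_mem (by rwa [hΨx'])
    · filter_upwards [hsymm.eventually (by simp)] with q hq
      exact hq.differentiableAt one_ne_zero
  obtain ⟨r, hr, hball⟩ := Metric.eventually_nhds_iff_ball.1 hnear
  refine ⟨?_, ?_⟩
  · have h1 : ∀ᶠ y in 𝓝 x, Ψ y ∈ ball (Ψ x) r :=
      hΨ.continuous.continuousAt.eventually_mem (ball_mem_nhds _ hr)
    filter_upwards [h1, Φ.open_source.mem_nhds hxs] with y hy hys hfy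
    refine ⟨fun s => Φ.symm (Ψ x + s • (Ψ y - Ψ x)), by simpa using hΨx', ?_, ?_⟩
    · simpa [hΦ] using Φ.left_inv hys
    · intro s hs
      have hmem : Ψ x + s • (Ψ y - Ψ x) ∈ ball (Ψ x) r :=
        (convex_ball _ _).add_smul_sub_mem (mem_ball_self hr) hy hs
      obtain ⟨h1, h2, h3⟩ := hball _ hmem
      refine ⟨h2, ?_, ?_⟩
      · rw [← hlev, ← hΦ, Φ.right_inv h1, inner_add_right, inner_smul_right, inner_sub_right,
          hlev, hlev, hfy]
        simp
      · exact h3.comp s (hasDerivAt_line (Ψ x) (Ψ y - Ψ x) s).differentiableAt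
  · intro v hv
    have hv' : inner ℝ e v = (0 : ℝ) := by
      have := hgi v
      rw [hv] at this
      rcases mul_eq_zero.1 this.symm with h | h
      · exact absurd h hgn.ne'
      · exact h
    refine ⟨fun s => Φ.symm (Ψ x + s • v), by simpa using hΨx', ?_, ?_⟩
    · have h1 : HasFDerivAt Φ.symm (A'.symm : _ →L[ℝ] _) (Ψ x) := by
        apply Φ.hasFDerivAt_symm (Φ.map_source hxs)
        have : Φ.symm (Φ x) = x := hΨx'
        rw [this]; exact hA
      have h2 : HasDerivAt (fun s : ℝ => Ψ x + s • v) v 0 := hasDerivAt_line _ _ _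
      have h3 : HasFDerivAt Φ.symm (A'.symm : _ →L[ℝ] _) (Ψ x + (0 : ℝ) • v) := by simpa using h1
      have h4 : HasDerivAt (fun s : ℝ => Φ.symm (Ψ x + s • v)) (A'.symm v) 0 := by
        have h4 := h3.comp_hasDerivAt (0 : ℝ) h2
        exact h4
      -- The differential of `Ψ` at `x` only rescales `e`, so it fixes `v ⊥ e` and the lifted curve
      -- has velocity exactly `v`.
      have h5 : A'.symm v = v := by
        rw [ContinuousLinearEquiv.symm_apply_eq]
        change v = A v
        simp [A, hv', hv]
      rwa [h5] at h4
    · have h1 : Tendsto (fun s : ℝ => Ψ x + s • v) (𝓝 0) (𝓝 (Ψ x)) := by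
        have : Continuous (fun s : ℝ => Ψ x + s • v) := by fun_prop
        simpa using this.tendsto 0
      filter_upwards [h1.eventually hnear] with s hs
      rw [← hlev, ← hΦ, Φ.right_inv hs.1, inner_add_right, inner_smul_right, hv', hlev]
      simp

theorem eventually_mem_levelSurface (hf : ContDiff ℝ 2 f) (hx : gradient f x ≠ 0) :
    ∀ᶠ y in 𝓝 x, f y = f x → y ∈ levelSurface f x := by
  filter_upwards [(exists_path_in_level hf hx univ_mem).1] with y hy hfy
  obtain ⟨c, h0, h1, hc⟩ := hy hfy
  have hcont : ContinuousOn c (Icc 0 1) := fun s hs => (hc s hs).2.2.continuousAt.continuousWithinAt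
  have := subset_levelSurface (f := f) (x := x) (isPreconnected_Icc.image c hcont)
    ⟨0, by simp, h0⟩ (by rintro _ ⟨s, hs, rfl⟩; exact (hc s hs).2.1)
  exact this ⟨1, by simp, h1⟩

theorem exists_curve_levelSurface (hf : ContDiff ℝ 2 f) (hx : gradient f x ≠ 0)
    {v : EuclideanSpace ℝ (Fin n)} (hv : inner ℝ (gradient f x) v = 0) :
    ∃ c : ℝ → EuclideanSpace ℝ (Fin n), c 0 = x ∧ HasDerivAt c v 0 ∧
      ∀ᶠ s in 𝓝 (0 : ℝ), c s ∈ levelSurface f x := by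
  obtain ⟨c, h0, hc, hs⟩ := (exists_path_in_level hf hx univ_mem).2 v hv
  refine ⟨c, h0, hc, ?_⟩
  have := hc.continuousAt.tendsto
  rw [h0] at this
  filter_upwards [hs, this.eventually (eventually_mem_levelSurface hf hx)] with s h1 h2
  exact h2 h1

/-- A function whose derivative vanishes on the kernel of `df` is locally constant along the level
set of `f`. -/
theorem eventually_eq_of_fderiv_ker {F : Type*} [NormedAddCommGroup F] [NormedSpace ℝ F]
    {k : EuclideanSpace ℝ (Fin n) → F} (hf : ContDiff ℝ 2 f) (hx : gradient f x ≠ 0)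
    (hk : ∀ᶠ y in 𝓝 x, DifferentiableAt ℝ k y ∧
      ∀ v, inner ℝ (gradient f y) v = 0 → fderiv ℝ k y v = 0) :
    ∀ᶠ y in 𝓝 x, f y = f x → k y = k x := by
  filter_upwards [(exists_path_in_level hf hx hk).1] with y hy hfy
  obtain ⟨c, h0, h1, hc⟩ := hy hfy
  have hd : ∀ s ∈ Icc (0 : ℝ) 1, HasDerivAt (fun s => k (c s)) (fderiv ℝ k (c s) (deriv c s)) s :=
    fun s hs => (hc s hs).1.1.hasFDerivAt.comp_hasDerivAt s (hc s hs).2.2.hasDerivAt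
  have hcont : ContinuousOn (fun s => k (c s)) (Icc 0 1) :=
    fun s hs => (hd s hs).continuousAt.continuousWithinAt
  have hconst : ∀ s ∈ Icc (0 : ℝ) 1, ‖k (c s) - k (c 0)‖ ≤ 0 * (s - 0) := by
    have hI : ∀ s ∈ Ico (0 : ℝ) 1, HasDerivWithinAt (fun s => k (c s))
        (fderiv ℝ k (c s) (deriv c s)) (Ici s) s := fun s hs =>
      (hd s (Ico_subset_Icc_self hs)).hasDerivWithinAt
    have hz' : ∀ s ∈ Ico (0 : ℝ) 1, inner ℝ (gradient f (c s)) (deriv c s) = 0 := by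
      intro s hs
      have h2 := hasDerivAt_comp_curve hf (hc s (Ico_subset_Icc_self hs)).2.2.hasDerivAt
      -- The path is known to stay in the level set on `[0, 1]` only, which leaves one-sided
      -- derivatives.
      have h3 : HasDerivWithinAt (fun t => f (c t)) 0 (Ici s) s := by
        refine (hasDerivWithinAt_const s (Ici s) (f x)).congr_of_eventuallyEq ?_
          (hc s (Ico_subset_Icc_self hs)).2.1
        filter_upwards [Icc_mem_nhdsGE hs.2] with t ht
        exact (hc t ⟨hs.1.trans ht.1, ht.2⟩).2.1
      exact (uniqueDiffWithinAt_Ici s).eq_deriv _ h2.hasDerivWithinAt h3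
    refine norm_image_sub_le_of_norm_deriv_right_le_segment hcont hI fun s hs => ?_
    rw [(hc s (Ico_subset_Icc_self hs)).1.2 _ (hz' s hs)]
    simp
  have := hconst 1 (by simp)
  rw [h0, h1] at this
  exact sub_eq_zero.1 (norm_le_zero_iff.1 (by simpa using this))

end LocalStructure

/-! ### The unit normal field and directions aligned with the gradient -/

/-- The gradient of `f` at `x` is a multiple of `e`. -/
def IsAligned {n : ℕ} (f : EuclideanSpace ℝ (Fin n) → ℝ) (x e : EuclideanSpace ℝ (Fin n)) : Prop :=
  gradient f x = (inner ℝ (gradient f x) e : ℝ) • e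

section UnitNormal

variable {n : ℕ} {f : EuclideanSpace ℝ (Fin n) → ℝ} {x y e : EuclideanSpace ℝ (Fin n)}

theorem norm_unitNormal (hx : gradient f x ≠ 0) : ‖unitNormal f x‖ = 1 := by
  rw [unitNormal, norm_smul, norm_inv, norm_norm, inv_mul_cancel₀ (norm_ne_zero_iff.2 hx)]

theorem norm_smul_unitNormal (f : EuclideanSpace ℝ (Fin n) → ℝ) (x : EuclideanSpace ℝ (Fin n)) :
    ‖gradient f x‖ • unitNormal f x = gradient f x := by
  by_cases hx : gradient f x = 0
  · simp [hx]
  · rw [unitNormal, smul_smul, mul_inv_cancel₀ (norm_ne_zero_iff.2 hx), one_smul]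

theorem inner_gradient_eq_zero_iff (hx : gradient f x ≠ 0) {v : EuclideanSpace ℝ (Fin n)} :
    inner ℝ (gradient f x) v = 0 ↔ inner ℝ (unitNormal f x) v = 0 := by
  rw [unitNormal, inner_smul_left]
  simp [hx]

theorem isAligned_unitNormal (f : EuclideanSpace ℝ (Fin n) → ℝ) (x : EuclideanSpace ℝ (Fin n)) :
    IsAligned f x (unitNormal f x) := by
  by_cases hx : gradient f x = 0
  · simp [IsAligned, hx]
  · have : (inner ℝ (gradient f x) (unitNormal f x) : ℝ) = ‖gradient f x‖ := by
      conv_lhs => rw [← norm_smul_unitNormal f x]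
      rw [inner_smul_left, real_inner_self_eq_norm_sq, norm_unitNormal hx]
      simp
    rw [IsAligned, this, norm_smul_unitNormal]

theorem IsAligned.neg (h : IsAligned f x e) : IsAligned f x (-e) := by
  rw [IsAligned, inner_neg_right, smul_neg, neg_smul, neg_neg]
  exact h

theorem isAligned_neg_iff : IsAligned f x (-e) ↔ IsAligned f x e :=
  ⟨fun h => by simpa using h.neg, fun h => h.neg⟩

theorem IsAligned.unitNormal_eq_or (he : ‖e‖ = 1) (hx : gradient f x ≠ 0) (h : IsAligned f x e) :
    unitNormal f x = e ∨ unitNormal f x = -e := by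
  set a : ℝ := inner ℝ (gradient f x) e
  have ha : ‖gradient f x‖ = |a| := by
    rw [h, norm_smul, he, mul_one, Real.norm_eq_abs]
  have hane : |a| ≠ 0 := by rw [← ha]; exact norm_ne_zero_iff.2 hx
  have hu : unitNormal f x = (|a|⁻¹ * a) • e := by
    rw [unitNormal, ha, h, smul_smul]
  rcases abs_choice a with h' | h'
  · left; rw [hu]; rw [h'] at hane ⊢; rw [inv_mul_cancel₀ hane, one_smul]
  · right
    have : |a|⁻¹ * a = -1 := by
      have : a = -|a| := by linarith
      rw [this, abs_neg, abs_abs]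
      field_simp
    rw [hu, this]; simp

theorem isAligned_of_unitNormal (h : unitNormal f x = e ∨ unitNormal f x = -e) :
    IsAligned f x e := by
  rcases h with rfl | h
  · exact isAligned_unitNormal f x
  · rw [← isAligned_neg_iff, ← h]; exact isAligned_unitNormal f x

theorem IsAligned.gradient_eq_zero (h : IsAligned f x e) (h0 : inner ℝ (gradient f x) e = (0 : ℝ)) :
    gradient f x = 0 := by
  rw [h, h0, zero_smul]

/-- Alignment passes to limits even at critical points, where the unit normal has no continuous
extension in general. -/
theorem isClosed_setOf_isAligned (hf : ContDiff ℝ 2 f) :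
    IsClosed {p : EuclideanSpace ℝ (Fin n) × EuclideanSpace ℝ (Fin n) | IsAligned f p.1 p.2} := by
  have := continuous_gradient hf
  unfold IsAligned
  exact isClosed_eq (by fun_prop) (by fun_prop)

theorem eventually_gradient_ne_zero (hf : ContDiff ℝ 2 f) (hx : gradient f x ≠ 0) :
    ∀ᶠ y in 𝓝 x, gradient f y ≠ 0 :=
  (continuous_gradient hf).continuousAt.eventually_ne hx

theorem contDiffAt_unitNormal (hf : ContDiff ℝ 2 f) (hx : gradient f x ≠ 0) :
    ContDiffAt ℝ 1 (unitNormal f) x := by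
  have h := (contDiff_gradient hf).contDiffAt (x := x)
  exact ((h.norm ℝ hx).inv (norm_ne_zero_iff.2 hx)).smul h

theorem hasFDerivAt_unitNormal (hf : ContDiff ℝ 2 f) (hx : gradient f x ≠ 0) :
    HasFDerivAt (unitNormal f) (fderiv ℝ (unitNormal f) x) x :=
  ((contDiffAt_unitNormal hf hx).differentiableAt one_ne_zero).hasFDerivAt

theorem inner_unitNormal_fderiv (hf : ContDiff ℝ 2 f) (hx : gradient f x ≠ 0)
    (v : EuclideanSpace ℝ (Fin n)) :
    inner ℝ (unitNormal f x) (fderiv ℝ (unitNormal f) x v) = 0 := by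
  have h1 := (hasFDerivAt_unitNormal hf hx).inner ℝ (hasFDerivAt_unitNormal hf hx)
  have h2 : (fun y => (inner ℝ (unitNormal f y) (unitNormal f y) : ℝ)) =ᶠ[𝓝 x] fun _ => 1 := by
    filter_upwards [eventually_gradient_ne_zero hf hx] with y hy
    rw [real_inner_self_eq_norm_sq, norm_unitNormal hy]; norm_num
  have h3 := h1.unique ((hasFDerivAt_const (1 : ℝ) x).congr_of_eventuallyEq h2)
  have h4 := congrArg (fun A => A v) h3
  simp only [ContinuousLinearMap.comp_apply, ContinuousLinearMap.prod_apply, fderivInnerCLM_apply,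
    zero_apply] at h4
  rw [real_inner_comm (unitNormal f x)] at h4
  linarith [h4, real_inner_comm (unitNormal f x) (fderiv ℝ (unitNormal f) x v)]

/-- Differentiate ∇f = |∇f| ν. The derivative of |∇f| is the ν-component of the Hessian term,
because Dν takes values orthogonal to ν. -/
theorem norm_mul_inner_fderiv_unitNormal (hf : ContDiff ℝ 2 f) (hx : gradient f x ≠ 0)
    (v w : EuclideanSpace ℝ (Fin n)) :
    ‖gradient f x‖ * inner ℝ (fderiv ℝ (unitNormal f) x v) w =
      inner ℝ (fderiv ℝ (gradient f) x v) w -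
        inner ℝ (fderiv ℝ (gradient f) x v) (unitNormal f x) * inner ℝ (unitNormal f x) w := by
  have hN : DifferentiableAt ℝ (fun y => ‖gradient f y‖) x :=
    (((contDiff_gradient hf).contDiffAt (x := x)).norm ℝ hx).differentiableAt one_ne_zero
  have h1 := hN.hasFDerivAt.smul (hasFDerivAt_unitNormal hf hx)
  have h2 : (fun y => ‖gradient f y‖ • unitNormal f y) = gradient f := by
    funext y; exact norm_smul_unitNormal f y
  have h3 := congrArg (fun A => A v)
    (HasFDerivAt.unique (f := fun y => ‖gradient f y‖ • unitNormal f y) 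
      (by rw [h2]; exact hasFDerivAt_gradient hf x) h1)
  set b : ℝ := fderiv ℝ (fun y => ‖gradient f y‖) x v
  have h4 : fderiv ℝ (gradient f) x v =
      ‖gradient f x‖ • fderiv ℝ (unitNormal f) x v + b • unitNormal f x := by
    simpa using h3
  have h5 : inner ℝ (fderiv ℝ (gradient f) x v) (unitNormal f x) = b := by
    rw [h4, inner_add_left, inner_smul_left, inner_smul_left, real_inner_comm,
      inner_unitNormal_fderiv hf hx, real_inner_self_eq_norm_sq, norm_unitNormal hx]
    simp
  rw [h5, h4, inner_add_left, inner_smul_left, inner_smul_left]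
  simp

end UnitNormal

/-! ### Consequences of the metric condition: symmetry of Dν and straight normal lines -/

section Metric

variable {n : ℕ} {f : EuclideanSpace ℝ (Fin n) → ℝ} {x y e : EuclideanSpace ℝ (Fin n)}

/-- Differentiating |∇f|² along a curve in the level surface turns the metric condition into an
infinitesimal one: with the symmetry of the Hessian, ν is an eigenvector of it. -/
theorem IsMetricFunction.inner_fderiv_gradient_eq_zero (hf : IsMetricFunction f)
    (hx : gradient f x ≠ 0) {v : EuclideanSpace ℝ (Fin n)} (hv : inner ℝ (unitNormal f x) v = 0) :
    inner ℝ (fderiv ℝ (gradient f) x v) (unitNormal f x) = 0 := by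
  obtain ⟨c, h0, hc, hs⟩ := exists_curve_levelSurface hf.1 hx ((inner_gradient_eq_zero_iff hx).2 hv)
  subst h0
  have h1 := (hasFDerivAt_gradient hf.1 (c 0)).comp_hasDerivAt (0 : ℝ) hc
  have h2 := h1.inner ℝ h1
  have h3 : (fun t => inner ℝ ((gradient f ∘ c) t) ((gradient f ∘ c) t)) =ᶠ[𝓝 0]
      fun _ => ‖gradient f (c 0)‖ ^ 2 := by
    filter_upwards [hs] with t ht
    rw [Function.comp_apply, real_inner_self_eq_norm_sq, hf.2 _ _ ht]
  have h4 := h2.unique ((hasDerivAt_const (0 : ℝ) _).congr_of_eventuallyEq h3)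
  simp only [Function.comp_apply] at h4
  rw [real_inner_comm] at h4
  rw [real_inner_comm, ← inner_gradient_eq_zero_iff hx, real_inner_comm]
  linarith

theorem IsMetricFunction.inner_fderiv_gradient_unitNormal (hf : IsMetricFunction f)
    (hx : gradient f x ≠ 0) (v : EuclideanSpace ℝ (Fin n)) :
    inner ℝ (fderiv ℝ (gradient f) x v) (unitNormal f x) =
      inner ℝ (fderiv ℝ (gradient f) x (unitNormal f x)) (unitNormal f x) *
        inner ℝ (unitNormal f x) v := by
  set ν := unitNormal f x
  have hν : (inner ℝ ν ν : ℝ) = 1 := by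
    rw [real_inner_self_eq_norm_sq, norm_unitNormal hx]; norm_num
  have h := hf.inner_fderiv_gradient_eq_zero hx (v := v - (inner ℝ ν v : ℝ) • ν) (by
    rw [inner_sub_right, inner_smul_right]
    change (inner ℝ ν v : ℝ) - inner ℝ ν v * inner ℝ ν ν = 0
    rw [hν]; ring)
  rw [map_sub, map_smul, inner_sub_left, inner_smul_left] at h
  simp only [conj_trivial] at h
  linarith

/-- The Hessian is symmetric and its normal part is λ⟨ν, v⟩⟨ν, w⟩. Symmetry is the integrability
condition for a potential of ν, and later allows Dν to be diagonalised. -/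
theorem IsMetricFunction.inner_fderiv_unitNormal_comm (hf : IsMetricFunction f)
    (hx : gradient f x ≠ 0) (v w : EuclideanSpace ℝ (Fin n)) :
    inner ℝ (fderiv ℝ (unitNormal f) x v) w = inner ℝ (fderiv ℝ (unitNormal f) x w) v := by
  have h1 := norm_mul_inner_fderiv_unitNormal hf.1 hx v w
  have h2 := norm_mul_inner_fderiv_unitNormal hf.1 hx w v
  rw [hf.inner_fderiv_gradient_unitNormal hx] at h1 h2
  rw [inner_fderiv_gradient_comm hf.1] at h1
  refine mul_left_cancel₀ (norm_ne_zero_iff.2 hx) ?_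
  rw [h1, h2]; ring

theorem IsMetricFunction.fderiv_unitNormal_unitNormal (hf : IsMetricFunction f)
    (hx : gradient f x ≠ 0) : fderiv ℝ (unitNormal f) x (unitNormal f x) = 0 := by
  refine ext_inner_right ℝ fun w => ?_
  rw [hf.inner_fderiv_unitNormal_comm hx, real_inner_comm, inner_unitNormal_fderiv hf.1 hx,
    inner_zero_left]

/-- Away from the critical points the integral curves of the unit normal are straight. -/
theorem IsMetricFunction.unitNormal_line (hf : IsMetricFunction f) {σ t : ℝ} (hσ : σ ^ 2 = 1)
    (hU : ∀ s ∈ Icc (0 : ℝ) t, gradient f (x + s • e) ≠ 0) (h0 : unitNormal f x = σ • e) :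
    ∀ s ∈ Icc (0 : ℝ) t, unitNormal f (x + s • e) = σ • e := by
  have hD : ∀ s ∈ Icc (0 : ℝ) t, HasDerivAt (fun s : ℝ => unitNormal f (x + s • e) - σ • e)
      (fderiv ℝ (unitNormal f) (x + s • e) e) s := fun s hs =>
    ((hasFDerivAt_unitNormal hf.1 (hU s hs)).comp_hasDerivAt s (hasDerivAt_line x e s)).sub_const _
  have hcont : ContinuousOn (fun s : ℝ => ‖fderiv ℝ (unitNormal f) (x + s • e)‖) (Icc 0 t) := by
    intro s hs
    have h1 := ((contDiffAt_unitNormal hf.1 (hU s hs)).fderiv_right (m := 0) (by simp)).continuousAt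
    have h2 : ContinuousAt (fun s : ℝ => x + s • e) s := (hasDerivAt_line x e s).continuousAt
    exact (ContinuousAt.comp (f := fun s : ℝ => x + s • e) h1 h2).norm.continuousWithinAt
  obtain ⟨M, hM⟩ := isCompact_Icc.bddAbove_image hcont
  -- Grönwall: as Dν kills ν, the difference δ = ν − σe along the line satisfies δ' = −σ Dν(δ), and
  -- δ(0) = 0.
  have key := eq_zero_of_abs_deriv_le_mul_abs_self_of_eq_zero_right (K := M)
    (f := fun s : ℝ => unitNormal f (x + s • e) - σ • e)
    (f' := fun s => fderiv ℝ (unitNormal f) (x + s • e) e)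
    (fun s hs => (hD s hs).continuousAt.continuousWithinAt)
    (fun s hs => (hD s (Ico_subset_Icc_self hs)).hasDerivWithinAt) (by simp [h0]) (by
      intro s hs
      have hs' := Ico_subset_Icc_self hs
      have h1 : fderiv ℝ (unitNormal f) (x + s • e) e =
          (-σ) • fderiv ℝ (unitNormal f) (x + s • e) (unitNormal f (x + s • e) - σ • e) := by
        rw [map_sub, hf.fderiv_unitNormal_unitNormal (hU s hs'), map_smul, zero_sub, smul_neg,
          neg_smul, neg_neg, smul_smul, ← pow_two, hσ, one_smul]
      have h2 : ‖-σ‖ = 1 := by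
        rw [norm_neg, Real.norm_eq_abs, ← sq_eq_sq₀ (abs_nonneg σ) zero_le_one, sq_abs, hσ]; simp
      rw [h1, norm_smul, h2, one_mul]
      exact (ContinuousLinearMap.le_opNorm _ _).trans
        (mul_le_mul_of_nonneg_right (hM ⟨s, hs', rfl⟩) (norm_nonneg _)))
  intro s hs
  exact sub_eq_zero.1 (key s hs)

/-- The far end of the segment may be critical: it is reached by closedness of alignment. -/
theorem IsMetricFunction.isAligned_line (hf : IsMetricFunction f) {t : ℝ} (he : ‖e‖ = 1)
    (hU : ∀ s ∈ Ico (0 : ℝ) t, gradient f (x + s • e) ≠ 0) (h0 : IsAligned f x e) :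
    ∀ s ∈ Icc (0 : ℝ) t, IsAligned f (x + s • e) e := by
  intro s hs
  rcases hs.1.eq_or_lt with rfl | hs0
  · simpa using h0
  have ht : 0 < t := hs0.trans_le hs.2
  have hx : gradient f x ≠ 0 := by simpa using hU 0 ⟨le_rfl, ht⟩
  have hlt : ∀ s ∈ Ico (0 : ℝ) t, IsAligned f (x + s • e) e := by
    intro s hs
    have hU' : ∀ r ∈ Icc (0 : ℝ) s, gradient f (x + r • e) ≠ 0 :=
      fun r hr => hU r ⟨hr.1, hr.2.trans_lt hs.2⟩
    rcases h0.unitNormal_eq_or he hx with h | h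
    · have := hf.unitNormal_line (σ := 1) (by norm_num) hU' (by simpa using h) s ⟨hs.1, le_rfl⟩
      exact isAligned_of_unitNormal (Or.inl (by simpa using this))
    · have := hf.unitNormal_line (σ := -1) (by norm_num) hU' (by simpa using h) s ⟨hs.1, le_rfl⟩
      exact isAligned_of_unitNormal (Or.inr (by simpa using this))
  have hcl : IsClosed {r : ℝ | IsAligned f (x + r • e) e} :=
    (isClosed_setOf_isAligned hf.1).preimage
      (show Continuous (fun r : ℝ => (x + r • e, e)) by fun_prop)
  have : s ∈ closure (Ico (0 : ℝ) t) := by rw [closure_Ico ht.ne]; exact hs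
  exact closure_minimal hlt hcl this

end Metric

/-! ### The nearest critical point lies on the normal line -/

section Foot

variable {n : ℕ} {f : EuclideanSpace ℝ (Fin n) → ℝ} {x y z e : EuclideanSpace ℝ (Fin n)}

theorem IsMetricFunction.unitNormal_add_smul (hf : IsMetricFunction f) {t : ℝ}
    (hU : ∀ s ∈ Icc (0 : ℝ) 1, gradient f (x + (s * t) • unitNormal f x) ≠ 0) :
    unitNormal f (x + t • unitNormal f x) = unitNormal f x := by
  rcases le_total 0 t with ht | ht
  · have := hf.unitNormal_line (x := x) (e := unitNormal f x) (σ := 1) (t := t) (by norm_num)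
      (fun s hs => by
        rcases ht.eq_or_lt with rfl | ht'
        · have : s = 0 := le_antisymm hs.2 hs.1
          simpa [this] using hU 0 (by simp)
        · have := hU (s / t) ⟨by have := hs.1; positivity, (div_le_one ht').2 hs.2⟩
          rwa [div_mul_cancel₀ _ ht'.ne'] at this) (by simp) t ⟨ht, le_rfl⟩
    simpa using this
  · have := hf.unitNormal_line (x := x) (e := -unitNormal f x) (σ := -1) (t := -t) (by norm_num)
      (fun s hs => by
        rcases ht.eq_or_lt with rfl | ht'
        · have : s = 0 := le_antisymm (by simpa using hs.2) hs.1
          simpa [this] using hU 0 (by simp)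
        · have := hU (-s / t) ⟨div_nonneg_of_nonpos (by linarith [hs.1]) ht,
            (div_le_one_of_neg ht').2 (by linarith [hs.2])⟩
          rw [div_mul_cancel₀ _ ht'.ne] at this
          simpa using this) (by simp) (-t) ⟨by linarith, le_rfl⟩
    simpa using this

/-- On a ball without critical points the unit normal is the gradient of a function. -/
theorem IsMetricFunction.exists_potential (hf : IsMetricFunction f) {d : ℝ}
    (hB : ∀ a ∈ ball x d, gradient f a ≠ 0) :
    ∃ u : EuclideanSpace ℝ (Fin n) → ℝ,
      ∀ a ∈ ball x d, HasFDerivAt u (innerSL ℝ (unitNormal f a)) a := by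
  have hD : ∀ a ∈ ball x d, HasFDerivAt (fun a => innerSL ℝ (unitNormal f a))
      ((innerSL ℝ).comp (fderiv ℝ (unitNormal f) a)) a := fun a ha =>
    (innerSL ℝ (E := EuclideanSpace ℝ (Fin n))).hasFDerivAt.comp a
      (hasFDerivAt_unitNormal hf.1 (hB a ha))
  refine (convex_ball x d).exists_forall_hasFDerivAt_of_fderiv_symmetric isOpen_ball
    (fun a ha => (hD a ha).differentiableAt.differentiableWithinAt) fun a ha v w => ?_
  rw [(hD a ha).fderiv]
  exact hf.inner_fderiv_unitNormal_comm (hB a ha) v w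

/-- On a ball without critical points, the gradient length at any point is attained on the normal
line through the centre. -/
theorem IsMetricFunction.norm_gradient_eq_of_potential (hf : IsMetricFunction f) {d : ℝ}
    (hB : ∀ a ∈ ball x d, gradient f a ≠ 0) {u : EuclideanSpace ℝ (Fin n) → ℝ}
    (hu : ∀ a ∈ ball x d, HasFDerivAt u (innerSL ℝ (unitNormal f a)) a) :
    (∀ a ∈ ball x d, ∀ b ∈ ball x d, |u b - u a| ≤ ‖b - a‖) ∧
    (∀ a ∈ ball x d, ∀ t : ℝ, a + t • unitNormal f a ∈ ball x d →
      u (a + t • unitNormal f a) = u a + t) ∧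
    ∀ a ∈ ball x d, ‖gradient f a‖ = ‖gradient f (x + (u a - u x) • unitNormal f x)‖ := by
  have hlip : ∀ a ∈ ball x d, ∀ b ∈ ball x d, |u b - u a| ≤ ‖b - a‖ := by
    intro a ha b hb
    have := (convex_ball x d).norm_image_sub_le_of_norm_hasFDerivWithin_le (C := 1)
      (fun a ha => (hu a ha).hasFDerivWithinAt)
      (fun a ha => by rw [innerSL_apply_norm, norm_unitNormal (hB a ha)]) ha hb
    simpa using this
  have hseg : ∀ a ∈ ball x d, ∀ t : ℝ, a + t • unitNormal f a ∈ ball x d →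
      ∀ s ∈ Icc (0 : ℝ) 1, a + (s * t) • unitNormal f a ∈ ball x d := by
    intro a ha t hat s hs
    have := (convex_ball x d).add_smul_mem ha hat hs
    rwa [smul_smul] at this
  have hline : ∀ a ∈ ball x d, ∀ t : ℝ, a + t • unitNormal f a ∈ ball x d →
      unitNormal f (a + t • unitNormal f a) = unitNormal f a := fun a ha t hat =>
    hf.unitNormal_add_smul fun s hs => hB _ (hseg a ha t hat s hs)
  have huline : ∀ a ∈ ball x d, ∀ t : ℝ, a + t • unitNormal f a ∈ ball x d →
      u (a + t • unitNormal f a) = u a + t := by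
    intro a ha t hat
    have hd : ∀ s ∈ Icc (0 : ℝ) 1,
        HasDerivAt (fun s : ℝ => u (a + s • (t • unitNormal f a)) - s * t) 0 s := by
      intro s hs
      have hmem := hseg a ha t hat s hs
      have h1 := (hu _ hmem)
      rw [← smul_smul] at h1
      have h2 := h1.comp_hasDerivAt s (hasDerivAt_line a (t • unitNormal f a) s)
      rw [smul_smul, hline a ha (s * t) hmem] at h2
      have h3 : innerSL ℝ (unitNormal f a) (t • unitNormal f a) = t := by
        rw [innerSL_apply_apply, inner_smul_right, real_inner_self_eq_norm_sq,
          norm_unitNormal (hB a ha)]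
        norm_num
      rw [h3] at h2
      have h4 := h2.sub ((hasDerivAt_id s).mul_const t)
      rw [one_mul, sub_self] at h4
      exact h4
    have := constant_of_has_deriv_right_zero (fun s hs => (hd s hs).continuousAt.continuousWithinAt)
      (fun s hs => (hd s (Ico_subset_Icc_self hs)).hasDerivWithinAt) 1 (by simp)
    simp at this
    linarith
  refine ⟨hlip, huline, fun b hb => ?_⟩
  have hx : x ∈ ball x d := mem_ball_self (dist_nonneg.trans_lt hb)
  set a : ℝ → EuclideanSpace ℝ (Fin n) := fun s => x + s • (b - x) with ha
  -- Each point `a s` of the segment from `x` to `b` is pushed along its normal until `u` has the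
  -- value `u b`. The curve ends at `b`, starts on the normal line of `x`, and lies in a level set
  -- of `u`, hence in one of `f`.
  set c : ℝ → EuclideanSpace ℝ (Fin n) := fun s => a s + (u b - u (a s)) • unitNormal f (a s)
    with hc
  have haB : ∀ s ∈ Icc (0 : ℝ) 1, a s ∈ ball x d := fun s hs =>
    (convex_ball x d).add_smul_sub_mem hx hb hs
  have hcB : ∀ s ∈ Icc (0 : ℝ) 1, c s ∈ ball x d := by
    intro s hs
    -- Since `u` is 1-Lipschitz, the push has length at most (1 − s)‖b − x‖, so `c s` stays within
    -- ‖b − x‖ of `x`.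
    have h1 : |u b - u (a s)| ≤ (1 - s) * ‖b - x‖ := by
      refine (hlip _ (haB s hs) _ hb).trans_eq ?_
      have : b - a s = (1 - s) • (b - x) := by simp only [ha]; module
      rw [this, norm_smul, Real.norm_of_nonneg (by linarith [hs.2])]
    rw [mem_ball_iff_norm] at hb ⊢
    have h2 : c s - x = s • (b - x) + (u b - u (a s)) • unitNormal f (a s) := by
      simp only [hc, ha]; module
    rw [h2]
    refine (norm_add_le _ _).trans_lt ?_
    rw [norm_smul, norm_smul, norm_unitNormal (hB _ (haB s hs)), Real.norm_of_nonneg hs.1,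
      Real.norm_eq_abs]
    linarith
  have hcu : ∀ s ∈ Icc (0 : ℝ) 1, u (c s) = u b := by
    intro s hs
    rw [hc]
    simp only
    rw [huline _ (haB s hs) _ (hcB s hs)]; ring
  have hcd : ∀ s ∈ Icc (0 : ℝ) 1, DifferentiableAt ℝ c s := by
    intro s hs
    have h0 : DifferentiableAt ℝ a s := (hasDerivAt_line x (b - x) s).differentiableAt
    have h1 : DifferentiableAt ℝ (fun s => unitNormal f (a s)) s :=
      (hasFDerivAt_unitNormal hf.1 (hB _ (haB s hs))).differentiableAt.comp s h0
    have h2 : DifferentiableAt ℝ (fun s => u (a s)) s :=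
      (hu _ (haB s hs)).differentiableAt.comp s h0
    exact h0.add ((h2.const_sub _).smul h1)
  have hcont : ContinuousOn c (Icc 0 1) := fun s hs => (hcd s hs).continuousAt.continuousWithinAt
  have hperp : ∀ s ∈ Ico (0 : ℝ) 1, inner ℝ (unitNormal f (c s)) (deriv c s) = 0 := by
    intro s hs
    have h1 := (hu _ (hcB s (Ico_subset_Icc_self hs))).comp_hasDerivAt s
      (hcd s (Ico_subset_Icc_self hs)).hasDerivAt
    have h2 : HasDerivWithinAt (u ∘ c) 0 (Ici s) s := by
      refine (hasDerivWithinAt_const s (Ici s) (u b)).congr_of_eventuallyEq ?_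
        (hcu s (Ico_subset_Icc_self hs))
      filter_upwards [Icc_mem_nhdsGE hs.2] with t ht
      exact hcu t ⟨hs.1.trans ht.1, ht.2⟩
    exact (uniqueDiffWithinAt_Ici s).eq_deriv _ h1.hasDerivWithinAt h2
  have hfc : ∀ s ∈ Icc (0 : ℝ) 1, f (c s) = f (c 0) := by
    refine constant_of_has_deriv_right_zero (hf.1.continuous.comp_continuousOn hcont)
      fun s hs => ?_
    have hs' := Ico_subset_Icc_self hs
    have h1 := hasDerivAt_comp_curve hf.1 (hcd s hs').hasDerivAt
    rw [(inner_gradient_eq_zero_iff (hB _ (hcB s hs'))).2 (hperp s hs)] at h1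
    exact h1.hasDerivWithinAt
  have hsub := subset_levelSurface (f := f) (x := c 0) (isPreconnected_Icc.image c hcont)
    ⟨0, by simp, rfl⟩ (by rintro _ ⟨s, hs, rfl⟩; exact hfc s hs)
  have := hf.2 _ _ (hsub ⟨1, by simp, rfl⟩)
  simpa [hc, ha] using this

/-- A nearest critical point lies on the normal line. -/
theorem IsMetricFunction.nearest_critical (hf : IsMetricFunction f) {d : ℝ} (hd : 0 < d)
    (hB : ∀ a ∈ ball x d, gradient f a ≠ 0) (hz : gradient f z = 0) (hzx : ‖z - x‖ = d) :
    z = x + d • unitNormal f x ∨ z = x - d • unitNormal f x := by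
  obtain ⟨u₀, hu₀⟩ := hf.exists_potential hB
  obtain ⟨hlip, hline, hnorm⟩ := hf.norm_gradient_eq_of_potential hB hu₀
  have hL : LipschitzOnWith 1 u₀ (ball x d) := by
    refine LipschitzOnWith.of_dist_le_mul fun a ha b hb => ?_
    simpa [Real.dist_eq, dist_eq_norm] using hlip b hb a ha
  -- The potential lives on the open ball, while `z` is on its boundary; a 1-Lipschitz extension
  -- reaches it.
  obtain ⟨u, hu, heq⟩ := hL.extend_real
  have hx : x ∈ ball x d := mem_ball_self hd
  have hux : ∀ a b, |u b - u a| ≤ ‖b - a‖ := fun a b => by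
    simpa [Real.dist_eq, dist_eq_norm] using hu.dist_le_mul b a
  have hν := norm_unitNormal (hB x hx)
  have hcl : IsClosed {a | ‖gradient f a‖ =
      ‖gradient f (x + (u a - u x) • unitNormal f x)‖} := by
    have h1 := continuous_gradient hf.1
    have h2 := hu.continuous
    exact isClosed_eq (by fun_prop) (by fun_prop)
  have hz' : z ∈ closure (ball x d) := by
    rw [closure_ball x hd.ne', mem_closedBall_iff_norm, hzx]
  -- At `z` the formula for the gradient length says that `x + τν` is critical, where |τ| ≤ d. The
  -- open ball has no critical points, so |τ| = d.
  have hmem := closure_minimal (fun a ha => by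
    rw [mem_ofPred_eq, ← heq ha, ← heq hx]; exact hnorm a ha) hcl hz'
  rw [mem_ofPred_eq, hz, norm_zero] at hmem
  have hτ := norm_eq_zero.1 hmem.symm
  set τ := u z - u x with hτdef
  have hτle : |τ| ≤ d := hzx ▸ hux x z
  have hτge : d ≤ |τ| := by
    by_contra! h
    refine hB _ ?_ hτ
    rw [mem_ball_iff_norm, add_sub_cancel_left, norm_smul, hν, Real.norm_eq_abs, mul_one]
    exact h
  have hτd : |τ| = d := le_antisymm hτle hτge
  have hfin : ∀ σ : ℝ, |σ| = 1 → τ = σ * d → z = x + (σ * d) • unitNormal f x := by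
    intro σ hσ hσd
    have hσ2 : σ ^ 2 = 1 := by rw [← sq_abs, hσ]; norm_num
    -- Seen from a point d/2 behind `x` on the normal line, `u` rises by 3d/2 up to `z`, while the
    -- distance is at most 3d/2 by way of `x`. Equality in the triangle inequality puts `z` on the
    -- line.
    have hb : x + (-(σ * (d / 2))) • unitNormal f x ∈ ball x d := by
      rw [mem_ball_iff_norm, add_sub_cancel_left, norm_smul, hν, Real.norm_eq_abs, abs_neg,
        abs_mul, hσ, abs_of_pos (by positivity)]
      linarith
    have h1 := hline x hx _ hb
    rw [heq hb, heq hx] at h1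
    have h2 := hux (x + (-(σ * (d / 2))) • unitNormal f x) z
    have h3 : u z - u (x + (-(σ * (d / 2))) • unitNormal f x) = σ * (d + d / 2) := by
      rw [h1]; linarith
    rw [h3, abs_mul, hσ, one_mul, abs_of_pos (by positivity)] at h2
    have h4 : z - (x + (-(σ * (d / 2))) • unitNormal f x) =
        (z - x) + (σ * (d / 2)) • unitNormal f x := by module
    rw [h4] at h2
    have h5 := pow_le_pow_left₀ (by positivity) h2 2
    rw [norm_add_sq_real, hzx, norm_smul, hν, inner_smul_right, Real.norm_eq_abs, mul_one, sq_abs,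
      mul_pow, hσ2] at h5
    have h6 : d ≤ σ * inner ℝ (z - x) (unitNormal f x) := by nlinarith
    have h7 : ‖(z - x) - (σ * d) • unitNormal f x‖ ^ 2 ≤ 0 := by
      rw [norm_sub_sq_real, hzx, norm_smul, hν, inner_smul_right, Real.norm_eq_abs, mul_one,
        sq_abs, mul_pow, hσ2]
      nlinarith
    have h8 := norm_eq_zero.1 (pow_eq_zero_iff (two_ne_zero) |>.1 (le_antisymm h7 (sq_nonneg _)))
    rw [sub_sub, sub_eq_zero] at h8
    exact h8
  rcases abs_eq hd.le |>.1 hτd with h | h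
  · left; simpa using hfin 1 (by simp) (by simpa using h)
  · right; simpa [sub_eq_add_neg] using hfin (-1) (by simp) (by simpa using h)

end Foot

/-! ### Normal spaces of embedded surfaces -/

/-- The normal space of a set `S` at `w`: the vectors orthogonal to `S` at first order. -/
def normalSpace {n : ℕ} (S : Set (EuclideanSpace ℝ (Fin n))) (w : EuclideanSpace ℝ (Fin n)) :
    Submodule ℝ (EuclideanSpace ℝ (Fin n)) where
  carrier := {m | (fun z => (inner ℝ m (z - w) : ℝ)) =o[𝓝[S] w] fun z => z - w}
  add_mem' := fun {a b} ha hb => by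
    simp only [mem_ofPred_eq, inner_add_left] at *
    exact ha.add hb
  zero_mem' := by simp
  smul_mem' := fun c a ha => by
    simp only [mem_ofPred_eq, inner_smul_left] at *
    exact ha.const_mul_left _

section NormalSpace

variable {n : ℕ} {S : Set (EuclideanSpace ℝ (Fin n))} {w m v x : EuclideanSpace ℝ (Fin n)}

theorem mem_normalSpace_iff :
    m ∈ normalSpace S w ↔ (fun z => (inner ℝ m (z - w) : ℝ)) =o[𝓝[S] w] fun z => z - w :=
  Iff.rfl

theorem inner_eq_zero_of_curve (hm : m ∈ normalSpace S w) {c : ℝ → EuclideanSpace ℝ (Fin n)}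
    (h0 : c 0 = w) (hc : HasDerivAt c v 0) (hS : ∀ᶠ s in 𝓝 (0 : ℝ), c s ∈ S) :
    inner ℝ m v = 0 := by
  have ht : Tendsto c (𝓝 0) (𝓝[S] w) :=
    tendsto_nhdsWithin_iff.2 ⟨h0 ▸ hc.continuousAt.tendsto, hS⟩
  have h1 := (mem_normalSpace_iff.1 hm).comp_tendsto ht
  have h2 : (fun s => c s - w) =O[𝓝 0] fun s : ℝ => s - 0 := h0 ▸ hc.isBigO_sub
  have h3 : (fun s => (inner ℝ m (c s - w) : ℝ)) =o[𝓝 0] fun s : ℝ => s - 0 := h1.trans_isBigO h2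
  have h4 : HasDerivAt (fun s => (inner ℝ m (c s) : ℝ)) 0 0 := by
    rw [hasDerivAt_iff_isLittleO]
    refine h3.congr_left fun s => ?_
    rw [h0, inner_sub_right]; simp
  have h5 : HasDerivAt (fun s => (inner ℝ m (c s) : ℝ)) (inner ℝ m v) 0 :=
    (innerSL ℝ m).hasFDerivAt.comp_hasDerivAt (0 : ℝ) hc
  exact h5.unique h4

/-- The inverse of a flattening chart maps lines in `W` to curves in `S`, so normals are orthogonal
to their velocities. Conversely, for `z` in `S`, `z - w` differs by o(‖z − w‖) from the tangent
vector `B (Φ z - Φ w)`. -/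
theorem IsRegularSurface.exists_tangent {r : ℕ} (hS : IsRegularSurface 1 r S) (hw : w ∈ S) :
    ∃ T : Submodule ℝ (EuclideanSpace ℝ (Fin n)), Module.finrank ℝ T = r ∧
      normalSpace S w = Tᗮ ∧
      ∀ v ∈ T, ∃ c : ℝ → EuclideanSpace ℝ (Fin n), c 0 = w ∧ HasDerivAt c v 0 ∧
        ∀ᶠ s in 𝓝 (0 : ℝ), c s ∈ S := by
  obtain ⟨Φ, W, hws, hΦ, hΦs, hW, hmem⟩ := hS w hw
  set q := Φ w with hq
  have hqt : q ∈ Φ.target := Φ.map_source hws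
  have hqw : Φ.symm q = w := Φ.left_inv hws
  have hA : HasFDerivAt Φ (fderiv ℝ Φ w) w :=
    ((hΦ.contDiffAt (Φ.open_source.mem_nhds hws)).differentiableAt one_ne_zero).hasFDerivAt
  have hB : HasFDerivAt Φ.symm (fderiv ℝ Φ.symm q) q :=
    ((hΦs.contDiffAt (Φ.open_target.mem_nhds hqt)).differentiableAt one_ne_zero).hasFDerivAt
  set A := fderiv ℝ Φ w
  set B := fderiv ℝ Φ.symm q
  have hBA : B.comp A = ContinuousLinearMap.id ℝ _ := by
    have h1 : HasFDerivAt (Φ.symm ∘ Φ) (B.comp A) w := hB.comp w hA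
    refine h1.unique ((hasFDerivAt_id w).congr_of_eventuallyEq ?_)
    filter_upwards [Φ.open_source.mem_nhds hws] with z hz using Φ.left_inv hz
  have hAB : A.comp B = ContinuousLinearMap.id ℝ _ := by
    have hA' : HasFDerivAt Φ A (Φ.symm q) := by rwa [hqw]
    have h1 : HasFDerivAt (Φ ∘ Φ.symm) (A.comp B) q := hA'.comp q hB
    refine h1.unique ((hasFDerivAt_id q).congr_of_eventuallyEq ?_)
    filter_upwards [Φ.open_target.mem_nhds hqt] with z hz using Φ.right_inv hz
  have hBA' : ∀ v, B (A v) = v := fun v => congrArg (fun L => L v) hBA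
  have hAB' : ∀ v, A (B v) = v := fun v => congrArg (fun L => L v) hAB
  have hinj : Function.Injective B := fun a b hab => by rw [← hAB' a, ← hAB' b, hab]
  have hcurve : ∀ v ∈ W.map (B : EuclideanSpace ℝ (Fin n) →ₗ[ℝ] EuclideanSpace ℝ (Fin n)),
      ∃ c : ℝ → EuclideanSpace ℝ (Fin n), c 0 = w ∧ HasDerivAt c v 0 ∧
        ∀ᶠ s in 𝓝 (0 : ℝ), c s ∈ S := by
    rintro _ ⟨k, hk, rfl⟩
    refine ⟨fun s => Φ.symm (q + s • k), by simpa using hqw, ?_, ?_⟩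
    · have h3 : HasFDerivAt Φ.symm B (q + (0 : ℝ) • k) := by simpa using hB
      have h4 := h3.comp_hasDerivAt (0 : ℝ) (hasDerivAt_line q k 0)
      exact h4
    · have h1 : Tendsto (fun s : ℝ => q + s • k) (𝓝 0) (𝓝 q) := by
        have : Continuous (fun s : ℝ => q + s • k) := by fun_prop
        simpa using this.tendsto 0
      filter_upwards [h1.eventually (Φ.open_target.mem_nhds hqt)] with s hs
      rw [hmem _ (Φ.map_target hs), Φ.right_inv hs]
      exact W.add_mem ((hmem w hws).1 hw) (W.smul_mem s hk)
  refine ⟨W.map (B : EuclideanSpace ℝ (Fin n) →ₗ[ℝ] EuclideanSpace ℝ (Fin n)), ?_, ?_, hcurve⟩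
  · exact (LinearEquiv.finrank_eq (Submodule.equivMapOfInjective _ hinj W)).symm.trans hW
  · apply le_antisymm
    · intro m hm
      rw [Submodule.mem_orthogonal]
      intro v hv
      obtain ⟨c, h0, hc, hs⟩ := hcurve v hv
      rw [real_inner_comm]
      exact inner_eq_zero_of_curve hm h0 hc hs
    · intro m hm
      rw [mem_normalSpace_iff]
      have h1 := hA.isLittleO
      have h2 : (fun z => (inner ℝ m (B (Φ z - Φ w - A (z - w))) : ℝ)) =o[𝓝[S] w]
          fun z => z - w :=
        (((innerSL ℝ m).comp B).isBigO_comp _ _).trans_isLittleO (h1.mono nhdsWithin_le_nhds)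
      refine h2.neg_left.congr' ?_ EventuallyEq.rfl
      filter_upwards [self_mem_nhdsWithin, mem_nhdsWithin_of_mem_nhds
        (Φ.open_source.mem_nhds hws)] with z hzS hzs
      have h3 : inner ℝ m (B (Φ z - Φ w)) = (0 : ℝ) := by
        rw [real_inner_comm]
        exact (Submodule.mem_orthogonal _ _).1 hm _ (Submodule.mem_map_of_mem
          (W.sub_mem ((hmem z hzs).1 hzS) ((hmem w hws).1 hw)))
      rw [map_sub, hBA', inner_sub_right, h3]
      simp

theorem IsRegularSurface.finrank_normalSpace {r : ℕ} (hS : IsRegularSurface 1 r S) (hw : w ∈ S) :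
    r + Module.finrank ℝ (normalSpace S w) = n := by
  obtain ⟨T, hT, hN, -⟩ := hS.exists_tangent hw
  rw [hN, ← hT, Submodule.finrank_add_finrank_orthogonal]
  simp

theorem IsRegularSurface.sub_mem_normalSpace {r : ℕ} (hS : IsRegularSurface 1 r S) (hw : w ∈ S)
    (h : ∀ z ∈ S, ‖x - w‖ ≤ ‖x - z‖) : x - w ∈ normalSpace S w := by
  obtain ⟨T, hT, hN, hc⟩ := hS.exists_tangent hw
  rw [hN, Submodule.mem_orthogonal']
  intro v hv
  obtain ⟨c, h0, hc, hs⟩ := hc v hv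
  have h1 : HasDerivAt (fun s => x - c s) (-v) 0 := by simpa using hc.const_sub x
  have h2 := h1.norm_sq
  have hmin : IsLocalMin (fun s => ‖x - c s‖ ^ 2) 0 := by
    filter_upwards [hs] with s hs
    rw [h0]
    exact pow_le_pow_left₀ (norm_nonneg _) (h _ hs) 2
  have h3 := hmin.hasDerivAt_eq_zero h2
  rw [h0, inner_neg_right] at h3
  linarith

end NormalSpace

theorem IsPreconnected.eq_of_eventually_eq {X Y : Type*} [TopologicalSpace X] {S : Set X}
    (hS : IsPreconnected S) {k : X → Y} (h : ∀ x ∈ S, ∀ᶠ y in 𝓝[S] x, k y = k x) {x y : X}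
    (hx : x ∈ S) (hy : y ∈ S) : k x = k y :=
  hS.induction₂ (fun x y => k x = k y)
    (fun x hx => (h x hx).mono fun _ h => h.symm)
    (fun _ _ _ _ _ _ => Eq.trans) (fun _ _ _ _ => Eq.symm) hx hy

/-! ### Critical components and segments issuing from them -/

section CriticalComponents

variable {n : ℕ} {f : EuclideanSpace ℝ (Fin n) → ℝ} {p w x z e m : EuclideanSpace ℝ (Fin n)}

theorem mem_planeThrough {W : Submodule ℝ (EuclideanSpace ℝ (Fin n))} :
    x ∈ planeThrough p W ↔ x - p ∈ W :=
  ⟨fun ⟨w, hw, h⟩ => by simpa [h] using hw, fun h => ⟨x - p, h, by simp⟩⟩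

theorem isRegularSurface_planeThrough (p : EuclideanSpace ℝ (Fin n))
    (W : Submodule ℝ (EuclideanSpace ℝ (Fin n))) (k : WithTop ℕ∞) :
    IsRegularSurface k (Module.finrank ℝ W) (planeThrough p W) := by
  intro q _
  refine ⟨(Homeomorph.addRight (-p)).toOpenPartialHomeomorph, W, by simp,
    (contDiff_id.add contDiff_const).contDiffOn, (contDiff_id.add contDiff_const).contDiffOn,
    rfl, fun x _ => ?_⟩
  simp [mem_planeThrough, ← sub_eq_add_neg]

theorem isRegularSurface_singleton (p : EuclideanSpace ℝ (Fin n)) (k : WithTop ℕ∞) :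
    IsRegularSurface k 0 {p} := by
  have h : ({p} : Set (EuclideanSpace ℝ (Fin n))) = planeThrough p ⊥ := by
    ext x; simp [mem_planeThrough, sub_eq_zero]
  simpa [h] using isRegularSurface_planeThrough p ⊥ k

/-- Points count as surfaces of dimension 0, so that both kinds of components can be treated
together. -/
theorem HasRegularCriticalSet.exists_isRegularSurface (hn : 1 ≤ n) (hcrit : HasRegularCriticalSet f)
    (hp : gradient f p = 0) :
    ∃ r, r < n ∧ IsRegularSurface 1 r (connectedComponentIn (criticalSet f) p) := by
  rcases (hcrit p hp).1 with h | ⟨r, -, hr, h⟩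
  · exact ⟨0, hn, h ▸ isRegularSurface_singleton p 1⟩
  · exact ⟨r, hr, h⟩

theorem HasRegularCriticalSet.exists_ball (hcrit : HasRegularCriticalSet f)
    (hp : gradient f p = 0) :
    ∃ ρ > 0, ∀ z ∈ ball p ρ, gradient f z = 0 → z ∈ connectedComponentIn (criticalSet f) p := by
  obtain ⟨O, hO, hOeq⟩ := (hcrit p hp).2
  have hpO : p ∈ O := by
    have : p ∈ O ∩ criticalSet f := by rw [hOeq]; exact mem_connectedComponentIn hp
    exact this.1
  obtain ⟨ρ, hρ, hb⟩ := Metric.isOpen_iff.1 hO p hpO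
  exact ⟨ρ, hρ, fun z hz hz0 => by rw [← hOeq]; exact ⟨hb hz, hz0⟩⟩

theorem gradient_eq_zero_of_mem_component
    (hz : z ∈ connectedComponentIn (criticalSet f) p) : gradient f z = 0 :=
  connectedComponentIn_subset (criticalSet f) p hz

theorem isClosed_component (hf : ContDiff ℝ 2 f) (hp : gradient f p = 0) :
    IsClosed (connectedComponentIn (criticalSet f) p) :=
  isClosed_of_closure_subset <|
    isPreconnected_connectedComponentIn.closure.subset_connectedComponentIn
      (subset_closure (mem_connectedComponentIn hp))
      (closure_minimal (connectedComponentIn_subset _ _) (isClosed_criticalSet hf))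

/-- A C² function can vary on a connected set of critical points, so the regularity of the component
matters: its points are locally joined by differentiable paths inside it, along which the derivative
of `f` vanishes. -/
theorem HasRegularCriticalSet.eq_of_mem_component (hn : 1 ≤ n) (hf : ContDiff ℝ 2 f)
    (hcrit : HasRegularCriticalSet f) (hp : gradient f p = 0)
    (hz : z ∈ connectedComponentIn (criticalSet f) p) : f z = f p := by
  obtain ⟨r, -, hC⟩ := hcrit.exists_isRegularSurface hn hp
  refine isPreconnected_connectedComponentIn.eq_of_eventually_eq (k := f) ?_ hz
    (mem_connectedComponentIn hp)
  intro w hw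
  obtain ⟨Φ, W, hws, hΦ, hΦs, hW, hmem⟩ := hC w hw
  set q := Φ w with hq
  have hqt : q ∈ Φ.target := Φ.map_source hws
  obtain ⟨ρ, hρ, hball⟩ := Metric.isOpen_iff.1 Φ.open_target q hqt
  have hcont : ContinuousAt Φ w := Φ.continuousAt hws
  filter_upwards [self_mem_nhdsWithin, mem_nhdsWithin_of_mem_nhds (Φ.open_source.mem_nhds hws),
    mem_nhdsWithin_of_mem_nhds (hcont.preimage_mem_nhds (ball_mem_nhds _ hρ))] with y hyC hys hyb
  have ht : ∀ s ∈ Icc (0 : ℝ) 1, q + s • (Φ y - q) ∈ Φ.target := fun s hs =>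
    hball ((convex_ball q ρ).add_smul_sub_mem (mem_ball_self hρ) hyb hs)
  have hd : ∀ s ∈ Icc (0 : ℝ) 1, HasDerivAt (fun s => f (Φ.symm (q + s • (Φ y - q)))) 0 s := by
    intro s hs
    have h1 : HasFDerivAt Φ.symm (fderiv ℝ Φ.symm (q + s • (Φ y - q))) (q + s • (Φ y - q)) :=
      ((hΦs.contDiffAt (Φ.open_target.mem_nhds (ht s hs))).differentiableAt
        one_ne_zero).hasFDerivAt
    have h2 := h1.comp_hasDerivAt s (hasDerivAt_line q (Φ y - q) s)
    have h3 := hasDerivAt_comp_curve hf h2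
    have h4 : Φ.symm (q + s • (Φ y - q)) ∈ connectedComponentIn (criticalSet f) p := by
      rw [hmem _ (Φ.map_target (ht s hs)), Φ.right_inv (ht s hs)]
      exact W.add_mem ((hmem w hws).1 hw)
        (W.smul_mem s (W.sub_mem ((hmem y hys).1 hyC) ((hmem w hws).1 hw)))
    rw [Function.comp_apply, gradient_eq_zero_of_mem_component h4, inner_zero_left] at h3
    exact h3
  have := constant_of_has_deriv_right_zero (fun s hs => (hd s hs).continuousAt.continuousWithinAt)
    (fun s hs => (hd s (Ico_subset_Icc_self hs)).hasDerivWithinAt) 1 (by simp)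
  simpa [hq, Φ.left_inv hys, Φ.left_inv hws] using this

/-- If the critical points on an aligned segment all have the same value, and the end points are
critical, then the whole segment is. -/
theorem gradient_eq_zero_of_between (hf : ContDiff ℝ 2 f) {a b c : ℝ}
    (hal : ∀ s ∈ Icc a b, IsAligned f (x + s • e) e)
    (hc : ∀ s ∈ Icc a b, gradient f (x + s • e) = 0 → f (x + s • e) = c)
    (ha : gradient f (x + a • e) = 0) (hb : gradient f (x + b • e) = 0) :
    ∀ s ∈ Ioo a b, gradient f (x + s • e) = 0 := by
  intro s₀ hs₀
  have hab : a ≤ b := (hs₀.1.trans hs₀.2).le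
  have hD : ∀ s, HasDerivAt (fun s : ℝ => f (x + s • e))
      (inner ℝ (gradient f (x + s • e)) e) s := fun s =>
    hasDerivAt_comp_curve hf (hasDerivAt_line x e s)
  have hcont : ContinuousOn (fun s : ℝ => f (x + s • e)) (Icc a b) :=
    fun s _ => (hD s).continuousAt.continuousWithinAt
  -- An interior extremum along the line is critical because the gradient is aligned with it; so the
  -- maximum and the minimum both equal `c`.
  have hval : ∀ s ∈ Icc a b, (s ∈ Ioo a b → IsLocalExtr (fun s : ℝ => f (x + s • e)) s) →
      f (x + s • e) = c := by
    intro s hs hext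
    refine hc s hs ?_
    rcases hs.1.eq_or_lt with rfl | h1
    · exact ha
    rcases hs.2.eq_or_lt with rfl | h2
    · exact hb
    exact (hal s hs).gradient_eq_zero ((hext ⟨h1, h2⟩).hasDerivAt_eq_zero (hD s))
  obtain ⟨sM, hsM, hM⟩ := isCompact_Icc.exists_isMaxOn (nonempty_Icc.2 hab) hcont
  obtain ⟨sm, hsm, hm⟩ := isCompact_Icc.exists_isMinOn (nonempty_Icc.2 hab) hcont
  have hMc := hval sM hsM fun h => (hM.isLocalMax (Icc_mem_nhds h.1 h.2)).isExtr
  have hmc := hval sm hsm fun h => (hm.isLocalMin (Icc_mem_nhds h.1 h.2)).isExtr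
  have hconst : ∀ s ∈ Icc a b, f (x + s • e) = c := fun s hs =>
    le_antisymm (hMc ▸ hM hs) (hmc ▸ hm hs)
  have h0 : (fun s : ℝ => f (x + s • e)) =ᶠ[𝓝 s₀] fun _ => c := by
    filter_upwards [Icc_mem_nhds hs₀.1 hs₀.2] with s hs using hconst s hs
  exact (hal s₀ (Ioo_subset_Icc_self hs₀)).gradient_eq_zero
    ((hD s₀).unique ((hasDerivAt_const s₀ c).congr_of_eventuallyEq h0))

/-- A normal segment issuing from a critical point stays free of critical points as long as it
could only meet critical points with the same value. -/
theorem IsMetricFunction.segment_of_critical (hf : IsMetricFunction f) (he : ‖e‖ = 1)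
    (hz : gradient f z = 0) {d R : ℝ} (hd : 0 < d)
    (hU : ∀ ρ ∈ Ioc 0 d, gradient f (z + ρ • e) ≠ 0) (hal : IsAligned f (z + d • e) e)
    (hR : ∀ ρ ∈ Ico 0 R, gradient f (z + ρ • e) = 0 → f (z + ρ • e) = f z) :
    ∀ ρ ∈ Ioo 0 R, gradient f (z + ρ • e) ≠ 0 ∧ IsAligned f (z + ρ • e) e := by
  have hback : ∀ ρ ∈ Icc 0 d, IsAligned f (z + ρ • e) e := by
    intro ρ hρ
    have := hf.isAligned_line (x := z + d • e) (e := -e) (t := d) (by rwa [norm_neg])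
      (fun s hs => by
        have := hU (d - s) ⟨by linarith [hs.2], by linarith [hs.1]⟩
        rwa [show z + d • e + s • -e = z + (d - s) • e by module])
      hal.neg (d - ρ) ⟨by linarith [hρ.2], by linarith [hρ.1]⟩
    rw [isAligned_neg_iff] at this
    rwa [show z + d • e + (d - ρ) • -e = z + ρ • e by module] at this
  have hfwd : ∀ b, d ≤ b → (∀ ρ ∈ Ico d b, gradient f (z + ρ • e) ≠ 0) →
      ∀ ρ ∈ Icc 0 b, IsAligned f (z + ρ • e) e := by
    intro b hb hUb ρ hρ
    rcases le_total ρ d with h | h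
    · exact hback ρ ⟨hρ.1, h⟩
    have := hf.isAligned_line (x := z + d • e) (e := e) (t := b - d) he
      (fun s hs => by
        have := hUb (d + s) ⟨by linarith [hs.1], by linarith [hs.2]⟩
        rwa [show z + d • e + s • e = z + (d + s) • e by module])
      hal (ρ - d) ⟨by linarith, by linarith [hρ.2]⟩
    rwa [show z + d • e + (ρ - d) • e = z + ρ • e by module] at this
  intro ρ hρ
  rcases le_or_gt ρ d with h | h
  · exact ⟨hU ρ ⟨hρ.1, h⟩, hback ρ ⟨hρ.1.le, h⟩⟩
  have hfree : ∀ s ∈ Icc d ρ, gradient f (z + s • e) ≠ 0 := by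
    by_contra! hne
    obtain ⟨s, hs, hs0⟩ := hne
    -- Let `b` be the first critical parameter beyond `d`. Both ends `z` and `z + b e` are critical
    -- with the same value, which would make all points between them critical, including the one at
    -- `d`.
    set Z : Set ℝ := Icc d ρ ∩ {s | gradient f (z + s • e) = 0} with hZ
    have hZc : IsClosed Z := isClosed_Icc.inter (isClosed_eq
      ((continuous_gradient hf.1).comp (by fun_prop)) continuous_const)
    have hZb : BddBelow Z := ⟨d, fun s hs => hs.1.1⟩
    have hb := hZc.csInf_mem ⟨s, hs, hs0⟩ hZb
    set b := sInf Z
    have hdb : d < b := lt_of_le_of_ne hb.1.1 fun h => hU d ⟨hd, le_rfl⟩ (by rw [h]; exact hb.2)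
    have hal' := hfwd b hdb.le fun s hs h0 =>
      absurd (csInf_le hZb ⟨⟨hs.1, hs.2.le.trans hb.1.2⟩, h0⟩) (not_le.2 hs.2)
    exact hU d ⟨hd, le_rfl⟩ (gradient_eq_zero_of_between hf.1 hal'
      (fun s hs => hR s ⟨hs.1, hs.2.trans_lt (hb.1.2.trans_lt hρ.2)⟩) (by simpa using hz) hb.2 d
      ⟨hd, hdb⟩)
  exact ⟨hfree ρ ⟨h.le, le_rfl⟩, hfwd ρ h.le (fun s hs => hfree s ⟨hs.1, hs.2.le⟩) ρ
    ⟨hρ.1.le, le_rfl⟩⟩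

theorem IsMetricFunction.exists_nearest_critical (hf : IsMetricFunction f)
    (hK : gradient f p = 0) (hx : gradient f x ≠ 0) :
    ∃ z d, gradient f z = 0 ∧ 0 < d ∧ ‖x - z‖ = d ∧ (∀ a, gradient f a = 0 → d ≤ ‖x - a‖) ∧
      (z = x + d • unitNormal f x ∨ z = x - d • unitNormal f x) := by
  obtain ⟨z, hz, hd⟩ := (isClosed_criticalSet hf.1).exists_infDist_eq_dist ⟨p, hK⟩ x
  have hz' : gradient f z = 0 := hz
  have hne : x ≠ z := fun h => hx (h ▸ hz')
  have hmin : ∀ a, gradient f a = 0 → ‖x - z‖ ≤ ‖x - a‖ := fun a ha => by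
    rw [← dist_eq_norm, ← dist_eq_norm, ← hd]
    exact infDist_le_dist_of_mem ha
  have hpos : 0 < ‖x - z‖ := norm_pos_iff.2 (sub_ne_zero.2 hne)
  refine ⟨z, ‖x - z‖, hz', hpos, rfl, hmin, ?_⟩
  refine hf.nearest_critical hpos (fun a ha h0 => ?_) hz' (norm_sub_rev _ _)
  rw [mem_ball_iff_norm'] at ha
  exact absurd (hmin a h0) (not_le.2 ha)

end CriticalComponents

/-! ### Normal segments at a critical component -/

section NormalSegments

variable {n : ℕ} {f : EuclideanSpace ℝ (Fin n) → ℝ} {p w x z e m : EuclideanSpace ℝ (Fin n)}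

theorem eq_component (hz : z ∈ connectedComponentIn (criticalSet f) w) :
    connectedComponentIn (criticalSet f) z = connectedComponentIn (criticalSet f) w :=
  (connectedComponentIn_eq hz).symm

/-- Critical points close to a short normal vector at `w` are much closer to `w`. -/
theorem norm_sub_le_of_normal {r : ℝ} (hr : 0 < r)
    (hball : ∀ z ∈ ball w r, gradient f z = 0 → z ∈ connectedComponentIn (criticalSet f) w)
    (hm : m ∈ normalSpace (connectedComponentIn (criticalSet f) w) w) (hm1 : ‖m‖ = 1)
    {ε : ℝ} (hε : 0 < ε) :
    ∃ δ > 0, ∀ s ∈ Ioo 0 δ, ∀ z, gradient f z = 0 → ‖w + s • m - z‖ ≤ s → ‖z - w‖ ≤ ε * s := by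
  have h1 := (mem_normalSpace_iff.1 hm).bound (c := ε / 2) (by positivity)
  rw [eventually_nhdsWithin_iff, Metric.eventually_nhds_iff_ball] at h1
  obtain ⟨δ, hδ, hb⟩ := h1
  refine ⟨min δ r / 2, by positivity, fun s hs z hz hzs => ?_⟩
  have hs0 : 0 < s := hs.1
  have h2s : 2 * s < min δ r := by have := hs.2; linarith
  have hzw : ‖z - w‖ ≤ 2 * s := by
    have : z - w = s • m - (w + s • m - z) := by module
    rw [this]
    refine (norm_sub_le _ _).trans ?_
    rw [norm_smul, hm1, Real.norm_of_nonneg hs0.le]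
    linarith
  have hzr : z ∈ ball w r := by
    rw [mem_ball_iff_norm]; exact hzw.trans_lt (h2s.trans_le (min_le_right _ _))
  have hzδ : z ∈ ball w δ := by
    rw [mem_ball_iff_norm]; exact hzw.trans_lt (h2s.trans_le (min_le_left _ _))
  have h3 := hb z hzδ (hball z hzr hz)
  have h4 : inner ℝ m (z - w) ≤ ε / 2 * ‖z - w‖ := (le_abs_self _).trans h3
  -- With ‖w + sm − z‖ ≤ s this gives ‖z − w‖² ≤ 2s⟨m, z − w⟩ ≤ εs‖z − w‖.
  have h5 : ‖w + s • m - z‖ ^ 2 = s ^ 2 - 2 * s * inner ℝ m (z - w) + ‖z - w‖ ^ 2 := by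
    rw [show w + s • m - z = s • m - (z - w) by module, norm_sub_sq_real, norm_smul, hm1,
      inner_smul_left, Real.norm_of_nonneg hs0.le]
    simp; ring
  have h6 := pow_le_pow_left₀ (norm_nonneg _) hzs 2
  rw [h5] at h6
  rcases (norm_nonneg (z - w)).eq_or_lt with h0 | h0
  · rw [← h0]; positivity
  · have h7 : ‖z - w‖ * ‖z - w‖ ≤ (ε * s) * ‖z - w‖ := by nlinarith
    exact le_of_mul_le_mul_right h7 h0

/-- The normal segments issuing from a critical component meet no further critical point as long as
they stay away from the other components, and the gradient is tangent to them. -/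
theorem IsMetricFunction.normal_segment (hn : 1 ≤ n) (hf : IsMetricFunction f)
    (hcrit : HasRegularCriticalSet f) (hw : gradient f w = 0) {r : ℝ}
    (hball : ∀ z ∈ ball w r, gradient f z = 0 → z ∈ connectedComponentIn (criticalSet f) w)
    (hm : m ∈ normalSpace (connectedComponentIn (criticalSet f) w) w) (hm1 : ‖m‖ = 1) :
    ∀ ρ ∈ Ioo 0 r, gradient f (w + ρ • m) ≠ 0 ∧ IsAligned f (w + ρ • m) m := by
  intro ρ₀ hρ₀
  have hr : 0 < r := hρ₀.1.trans hρ₀.2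
  have hval : ∀ z ∈ ball w r, gradient f z = 0 → f z = f w := fun z hz h0 =>
    hcrit.eq_of_mem_component hn hf.1 hw (hball z hz h0)
  -- If `w + s m` were critical, it would be its own `z` in the estimate, at distance s > s/2 from
  -- `w`.
  have hfree : ∃ δ > (0 : ℝ), ∀ s ∈ Ioo 0 δ, gradient f (w + s • m) ≠ 0 := by
    obtain ⟨δ, hδ, h⟩ := norm_sub_le_of_normal hr hball hm hm1 (ε := 1 / 2) (by norm_num)
    refine ⟨δ, hδ, fun s hs h0 => ?_⟩
    have h1 := h s hs _ h0 (by simpa using hs.1.le)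
    rw [add_sub_cancel_left, norm_smul, hm1, Real.norm_of_nonneg hs.1.le] at h1
    linarith [hs.1]
  obtain ⟨δ₀, hδ₀, hfree⟩ := hfree
  have hal : ∀ ρ ∈ Ico 0 r, IsAligned f (w + ρ • m) m := by
    intro ρ hρ
    -- For small `s` let `z` be the critical point nearest to `y = w + s m`, and `e` the direction
    -- from `z` to `y`. Then `(z + ρ e, e)` is aligned and tends to `(w + ρ m, m)` as `s` tends to
    -- 0.
    have hcl : (w + ρ • m, m) ∈ closure {p : EuclideanSpace ℝ (Fin n) ×
        EuclideanSpace ℝ (Fin n) | IsAligned f p.1 p.2} := by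
      rw [Metric.mem_closure_iff]
      intro η hη
      -- The error is at most ‖z − w‖ + ρ‖m − e‖ ≤ ε + 4εr < η. The bound 1/2 gives s ≤ 2d, used to
      -- estimate ‖m − e‖.
      set ε : ℝ := min (1 / 2) (η / (8 * (1 + r))) with hεdef
      have hε : 0 < ε := by positivity
      have hε2 : ε ≤ 1 / 2 := min_le_left _ _
      have hεη : 8 * ε * (1 + r) ≤ η := by
        have : ε ≤ η / (8 * (1 + r)) := min_le_right _ _
        rw [le_div_iff₀ (by positivity)] at this
        linarith
      obtain ⟨δ, hδ, h⟩ := norm_sub_le_of_normal hr hball hm hm1 hε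
      obtain ⟨s, hs0, hs⟩ : ∃ s, 0 < s ∧ s < min (min δ δ₀) (min 1 (r - ρ)) :=
        exists_between (by have := hρ.2; simp [hδ, hδ₀, this])
      simp only [lt_min_iff] at hs
      obtain ⟨⟨hsδ, hsδ₀⟩, hs1, hsr⟩ := hs
      obtain ⟨z, d, hz, hd, hzd, hmin, hzν⟩ := hf.exists_nearest_critical hw (hfree s ⟨hs0, hsδ₀⟩)
      set y := w + s • m with hy
      have hds : d ≤ s := by
        have := hmin w hw
        rwa [hy, add_sub_cancel_left, norm_smul, hm1, Real.norm_of_nonneg hs0.le, mul_one] at this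
      have hzw := h s ⟨hs0, hsδ⟩ z hz (hzd.trans_le hds)
      have hsd : s - d ≤ ε * s := by
        have h1 : ‖s • m‖ ≤ ‖y - z‖ + ‖z - w‖ := by
          rw [show s • m = (y - z) + (z - w) by rw [hy]; module]; exact norm_add_le _ _
        rw [norm_smul, hm1, Real.norm_of_nonneg hs0.le, hzd] at h1
        linarith
      set e := d⁻¹ • (y - z) with he
      have he1 : ‖e‖ = 1 := by
        rw [he, norm_smul, hzd, norm_inv, Real.norm_of_nonneg hd.le, inv_mul_cancel₀ hd.ne']
      have hyz : y = z + d • e := by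
        rw [he, smul_smul, mul_inv_cancel₀ hd.ne', one_smul]; module
      have heν : unitNormal f y = e ∨ unitNormal f y = -e := by
        rcases hzν with h | h
        · right
          rw [he, h, show y - (y + d • unitNormal f y) = -(d • unitNormal f y) by module, smul_neg,
            smul_smul, inv_mul_cancel₀ hd.ne', one_smul, neg_neg]
        · left
          rw [he, h, show y - (y - d • unitNormal f y) = d • unitNormal f y by module,
            smul_smul, inv_mul_cancel₀ hd.ne', one_smul]
      have hya : IsAligned f (z + d • e) e := hyz ▸ isAligned_of_unitNormal heν
      -- This `R` keeps the segment inside `ball w r`, where all critical points belong to the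
      -- component of `w` and share its value.
      have hseg := hf.segment_of_critical he1 hz hd (R := r - ‖z - w‖)
        (fun σ hσ h0 => by
          rcases hσ.2.eq_or_lt with rfl | hlt
          · rw [← hyz] at h0; exact hfree s ⟨hs0, hsδ₀⟩ h0
          · have := hmin _ h0
            rw [hyz, show z + d • e - (z + σ • e) = (d - σ) • e by module, norm_smul, he1,
              Real.norm_of_nonneg (by linarith)] at this
            linarith [hσ.1])
        hya (fun σ hσ h0 => by
          have hb : z + σ • e ∈ ball w r := by
            rw [mem_ball_iff_norm, show z + σ • e - w = (z - w) + σ • e by module]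
            refine (norm_add_le _ _).trans_lt ?_
            rw [norm_smul, he1, Real.norm_of_nonneg hσ.1]
            linarith [hσ.2]
          have hzb : z ∈ ball w r := by
            rw [mem_ball_iff_norm]
            have := hρ.1
            nlinarith
          rw [hval _ hb h0, hval z hzb hz])
      have hem : ‖m - e‖ ≤ 4 * ε := by
        have h1 : d • (m - e) = (z - w) - (s - d) • m := by
          rw [smul_sub, ← sub_eq_zero]
          have : d • e = y - z := by rw [hyz]; module
          rw [this, hy]; module
        have h2 : d * ‖m - e‖ ≤ 2 * (ε * s) := by
          have h3 : ‖d • (m - e)‖ ≤ ‖z - w‖ + ‖(s - d) • m‖ := by rw [h1]; exact norm_sub_le _ _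
          rw [norm_smul, norm_smul, hm1, Real.norm_of_nonneg hd.le,
            Real.norm_of_nonneg (by linarith)] at h3
          linarith
        have h3 : s ≤ 2 * d := by nlinarith
        have h4 : d * ‖m - e‖ ≤ d * (4 * ε) := by nlinarith
        exact le_of_mul_le_mul_left h4 hd
      rcases hρ.1.eq_or_lt with h0 | hρ0
      · refine ⟨(w + ρ • m, m), ?_, by simpa using hη⟩
        rw [mem_ofPred_eq, IsAligned, ← h0]
        simp [hw]
      refine ⟨(z + ρ • e, e), ?_, ?_⟩
      · exact (hseg ρ ⟨hρ0, by nlinarith⟩).2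
      · have hρr := hρ.2
        rw [Prod.dist_eq, dist_eq_norm, dist_eq_norm, max_lt_iff]
        constructor
        · rw [show w + ρ • m - (z + ρ • e) = -(z - w) + ρ • (m - e) by module]
          refine (norm_add_le _ _).trans_lt ?_
          rw [norm_neg, norm_smul, Real.norm_of_nonneg hρ.1]
          nlinarith
        · change ‖m - e‖ < η
          nlinarith
    exact (isClosed_setOf_isAligned hf.1).closure_subset hcl
  refine ⟨fun h0 => ?_, hal ρ₀ ⟨hρ₀.1.le, hρ₀.2⟩⟩
  obtain ⟨s, hs0, hs⟩ : ∃ s, 0 < s ∧ s < min δ₀ ρ₀ :=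
    exists_between (by simp [hδ₀, hρ₀.1])
  rw [lt_min_iff] at hs
  refine hfree s ⟨hs0, hs.1⟩ (gradient_eq_zero_of_between hf.1 (a := 0) (b := ρ₀) (c := f w)
    (fun σ hσ => hal σ ⟨hσ.1, hσ.2.trans_lt hρ₀.2⟩) (fun σ hσ h => hval _ ?_ h)
    (by simpa using hw) h0 s ⟨hs0, hs.2⟩)
  rw [mem_ball_iff_norm, add_sub_cancel_left, norm_smul, hm1, Real.norm_of_nonneg hσ.1, mul_one]
  exact hσ.2.trans_lt hρ₀.2

/-- A critical point in the ball would make the distance d from its centre to the critical set less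
than ρ. The nearest critical point lies on the normal line, so it is w + (ρ ± d)m with 0 < ρ ± d <
2ρ < r, where the line is free of critical points. -/
theorem IsMetricFunction.normal_ball (hn : 1 ≤ n) (hf : IsMetricFunction f)
    (hcrit : HasRegularCriticalSet f) (hw : gradient f w = 0) {r : ℝ}
    (hball : ∀ z ∈ ball w r, gradient f z = 0 → z ∈ connectedComponentIn (criticalSet f) w)
    (hm : m ∈ normalSpace (connectedComponentIn (criticalSet f) w) w) (hm1 : ‖m‖ = 1)
    {ρ : ℝ} (hρ : 0 < ρ) (hρr : 2 * ρ < r) :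
    ∀ a ∈ ball (w + ρ • m) ρ, gradient f a ≠ 0 := by
  have hseg := hf.normal_segment hn hcrit hw hball hm hm1
  obtain ⟨hx, hal⟩ := hseg ρ ⟨hρ, by linarith⟩
  obtain ⟨z, d, hz, hd, hzd, hmin, hzν⟩ := hf.exists_nearest_critical hw hx
  intro a ha h0
  rw [mem_ball_iff_norm'] at ha
  have hdρ : d < ρ := (hmin a h0).trans_lt ha
  have hz' : z = w + (ρ + d) • m ∨ z = w + (ρ - d) • m := by
    rcases hal.unitNormal_eq_or hm1 hx with h | h <;> rw [h] at hzν <;>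
      rcases hzν with h | h
    · left; rw [h]; module
    · right; rw [h]; module
    · right; rw [h]; module
    · left; rw [h]; module
  rcases hz' with rfl | rfl
  · exact (hseg (ρ + d) ⟨by linarith, by linarith⟩).1 hz
  · exact (hseg (ρ - d) ⟨by linarith, by linarith⟩).1 hz

/-- The critical point nearest to the midpoint of the segment lies on the line, and not inside the
segment. So the end point is itself nearest, and the first-order condition applies there. -/
theorem IsMetricFunction.mem_normalSpace_of_hit (hn : 1 ≤ n) (hf : IsMetricFunction f)
    (hcrit : HasRegularCriticalSet f) (he : ‖e‖ = 1) {t : ℝ} (ht : 0 < t)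
    (hU : ∀ s ∈ Ico (0 : ℝ) t, gradient f (x + s • e) ≠ 0) (hx : IsAligned f x e)
    (hw : gradient f (x + t • e) = 0) :
    e ∈ normalSpace (connectedComponentIn (criticalSet f) (x + t • e)) (x + t • e) := by
  set y := x + (t / 2) • e with hy
  have hyU : gradient f y ≠ 0 := hU (t / 2) ⟨by linarith, by linarith⟩
  have hal : IsAligned f y e := hf.isAligned_line he hU hx (t / 2) ⟨by linarith, by linarith⟩
  obtain ⟨z, d, hz, hd, hzd, hmin, hzν⟩ := hf.exists_nearest_critical hw hyU
  have hyw : y - (x + t • e) = (-(t / 2)) • e := by rw [hy]; module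
  have hdt : t / 2 ≤ d := by
    by_contra! hlt
    have hz' : z = x + (t / 2 + d) • e ∨ z = x + (t / 2 - d) • e := by
      rcases hal.unitNormal_eq_or he hyU with h | h <;> rw [h] at hzν <;>
        rcases hzν with h | h
      · left; rw [h, hy]; module
      · right; rw [h, hy]; module
      · right; rw [h, hy]; module
      · left; rw [h, hy]; module
    rcases hz' with rfl | rfl
    · exact hU (t / 2 + d) ⟨by linarith, by linarith⟩ hz
    · exact hU (t / 2 - d) ⟨by linarith, by linarith⟩ hz
  obtain ⟨r, -, hC⟩ := hcrit.exists_isRegularSurface hn hw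
  have key := hC.sub_mem_normalSpace (x := y) (mem_connectedComponentIn hw) (fun a ha => by
    refine le_trans ?_ (hmin a (gradient_eq_zero_of_mem_component ha))
    rw [hyw, norm_smul, he, norm_neg, Real.norm_of_nonneg (by linarith)]
    linarith)
  rw [hyw] at key
  exact (Submodule.smul_mem_iff _ (by linarith : -(t / 2) ≠ 0)).1 key

theorem exists_unit_normal (hn : 1 ≤ n) (hcrit : HasRegularCriticalSet f)
    (hw : gradient f w = 0) :
    ∃ m ∈ normalSpace (connectedComponentIn (criticalSet f) w) w, ‖m‖ = 1 := by
  obtain ⟨r, hr, hC⟩ := hcrit.exists_isRegularSurface hn hw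
  have h := hC.finrank_normalSpace (mem_connectedComponentIn hw)
  have : Nontrivial (normalSpace (connectedComponentIn (criticalSet f) w) w) :=
    Module.finrank_pos_iff (R := ℝ).1 (by omega)
  obtain ⟨m, hm⟩ := exists_norm_eq (normalSpace (connectedComponentIn (criticalSet f) w) w)
    zero_le_one
  exact ⟨m, m.2, hm⟩

/-- Every critical point is a limit of noncritical points on a normal segment; a unit normal exists
as components have dimension less than n. -/
theorem IsMetricFunction.interior_criticalSet (hn : 1 ≤ n) (hf : IsMetricFunction f)
    (hcrit : HasRegularCriticalSet f) : interior (criticalSet f) = ∅ := by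
  rw [eq_empty_iff_forall_notMem]
  intro w hw
  have hw0 : gradient f w = 0 := (interior_subset hw : w ∈ criticalSet f)
  obtain ⟨m, hm, hm1⟩ := exists_unit_normal hn hcrit hw0
  obtain ⟨r, hr, hball⟩ := hcrit.exists_ball hw0
  have hseg := hf.normal_segment hn hcrit hw0 hball hm hm1
  have hcont : Tendsto (fun s : ℝ => w + s • m) (𝓝 0) (𝓝 w) := by
    have : Continuous (fun s : ℝ => w + s • m) := by fun_prop
    simpa using this.tendsto 0
  have h1 := hcont.eventually (isOpen_interior.mem_nhds hw)
  obtain ⟨s, hs, hsr⟩ := ((h1.filter_mono nhdsWithin_le_nhds).and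
    (Ioo_mem_nhdsGT hr)).exists
  exact (hseg s hsr).1 (interior_subset hs : _ ∈ criticalSet f)

end NormalSegments

/-! ### Normal lines continued across the critical set, and parallel surfaces -/

section GlobalLines

variable {n : ℕ} {f : EuclideanSpace ℝ (Fin n) → ℝ} {p w x y z e m : EuclideanSpace ℝ (Fin n)}

/-- The gradient at `x + t e` is a multiple of `e` and there are no critical points right before
`x + t e` on the line. -/
def IsGoodTime (f : EuclideanSpace ℝ (Fin n) → ℝ) (x e : EuclideanSpace ℝ (Fin n)) (t : ℝ) : Prop :=
  IsAligned f (x + t • e) e ∧ ∃ δ > 0, ∀ s ∈ Ioo (t - δ) t, gradient f (x + s • e) ≠ 0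

theorem exists_free_interval (hf : ContDiff ℝ 2 f) {t : ℝ} (h : gradient f (x + t • e) ≠ 0) :
    ∃ δ > 0, ∀ s ∈ Ioo (t - δ) (t + δ), gradient f (x + s • e) ≠ 0 := by
  have hc : Continuous (fun s : ℝ => gradient f (x + s • e)) :=
    (continuous_gradient hf).comp (by fun_prop)
  obtain ⟨δ, hδ, h⟩ := Metric.eventually_nhds_iff_ball.1 (hc.continuousAt.eventually_ne h)
  exact ⟨δ, hδ, fun s hs => h s (by rwa [Real.ball_eq_Ioo])⟩

/-- The closedness half of the continuation. Critical parameters cannot accumulate at t from below: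
by isolation two of them close to t carry the same value of `f`, so everything between them would be
critical, against goodness of the larger one. -/
theorem IsMetricFunction.isGoodTime_of_forall_lt (hn : 1 ≤ n) (hf : IsMetricFunction f)
    (hcrit : HasRegularCriticalSet f) (he : ‖e‖ = 1) {t : ℝ} (ht : 0 < t)
    (h : ∀ s ∈ Ico 0 t, IsGoodTime f x e s) : IsGoodTime f x e t := by
  have hcl : IsClosed {r : ℝ | IsAligned f (x + r • e) e} :=
    (isClosed_setOf_isAligned hf.1).preimage
      (show Continuous (fun r : ℝ => (x + r • e, e)) by fun_prop)
  refine ⟨closure_minimal (fun s hs => (h s hs).1) hcl (show t ∈ closure (Ico 0 t) by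
    rw [closure_Ico ht.ne]; exact ⟨ht.le, le_rfl⟩), ?_⟩
  by_cases hw : gradient f (x + t • e) = 0
  · obtain ⟨ρ, hρ, hball⟩ := hcrit.exists_ball hw
    have hval : ∀ s ∈ Ioo (t - min ρ t) t, gradient f (x + s • e) = 0 →
        f (x + s • e) = f (x + t • e) := fun s hs h0 =>
      hcrit.eq_of_mem_component hn hf.1 hw (hball _ (by
        rw [mem_ball_iff_norm, show x + s • e - (x + t • e) = (-(t - s)) • e by module, norm_smul,
          he, norm_neg, Real.norm_of_nonneg (by linarith [hs.2])]
        linarith [hs.1, min_le_left ρ t]) h0)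
    by_cases hex : ∃ s₁ ∈ Ioo (t - min ρ t) t, gradient f (x + s₁ • e) = 0
    · obtain ⟨s₁, hs₁, h1⟩ := hex
      refine ⟨t - s₁, by linarith [hs₁.2], fun s₂ hs₂ h2 => ?_⟩
      rw [sub_sub_cancel] at hs₂
      have hs₁0 : 0 < s₁ := by linarith [hs₁.1, min_le_right ρ t]
      have hbetween := gradient_eq_zero_of_between hf.1 (x := x) (e := e) (a := s₁) (b := s₂)
        (c := f (x + t • e)) (fun s hs => (h s ⟨hs₁0.le.trans hs.1, hs.2.trans_lt hs₂.2⟩).1)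
        (fun s hs => hval s ⟨hs₁.1.trans_le hs.1, hs.2.trans_lt hs₂.2⟩) h1 h2
      obtain ⟨δ, hδ, hfree⟩ := (h s₂ ⟨(hs₁0.trans hs₂.1).le, hs₂.2⟩).2
      obtain ⟨s, hs, hs'⟩ : ∃ s, max s₁ (s₂ - δ) < s ∧ s < s₂ :=
        exists_between (max_lt hs₂.1 (by linarith))
      rw [max_lt_iff] at hs
      exact hfree s ⟨hs.2, hs'⟩ (hbetween s ⟨hs.1, hs'⟩)
    · push Not at hex
      exact ⟨min ρ t, lt_min hρ ht, hex⟩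
  · obtain ⟨δ, hδ, h⟩ := exists_free_interval hf.1 hw
    exact ⟨δ, hδ, fun s hs => h s ⟨hs.1, by linarith [hs.2]⟩⟩

theorem IsMetricFunction.mem_normalSpace_of_good (hn : 1 ≤ n) (hf : IsMetricFunction f)
    (hcrit : HasRegularCriticalSet f) (he : ‖e‖ = 1) {t : ℝ} (ht : 0 < t)
    (h : ∀ s ∈ Icc 0 t, IsGoodTime f x e s) (hw : gradient f (x + t • e) = 0) :
    e ∈ normalSpace (connectedComponentIn (criticalSet f) (x + t • e)) (x + t • e) := by
  obtain ⟨δ, hδ, hfree⟩ := (h t ⟨ht.le, le_rfl⟩).2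
  obtain ⟨a, ha, hat⟩ : ∃ a, max 0 (t - δ) < a ∧ a < t := exists_between (max_lt ht (by linarith))
  rw [max_lt_iff] at ha
  have hw' : gradient f (x + a • e + (t - a) • e) = 0 := by
    rwa [show x + a • e + (t - a) • e = x + t • e by module]
  have := hf.mem_normalSpace_of_hit hn hcrit (x := x + a • e) he (t := t - a) (by linarith)
    (fun s hs => by
      rw [show x + a • e + s • e = x + (a + s) • e by module]
      exact hfree _ ⟨by linarith [hs.1, ha.2], by linarith [hs.2]⟩)
    (h a ⟨ha.1.le, hat.le⟩).1 hw'
  rwa [show x + a • e + (t - a) • e = x + t • e by module] at this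

/-- The openness half. A line arriving at a critical point is normal to its component, so the normal
segment on the other side continues it. -/
theorem IsMetricFunction.exists_good_right (hn : 1 ≤ n) (hf : IsMetricFunction f)
    (hcrit : HasRegularCriticalSet f) (he : ‖e‖ = 1) (hx : gradient f x ≠ 0) {t : ℝ} (ht : 0 ≤ t)
    (h : ∀ s ∈ Icc 0 t, IsGoodTime f x e s) :
    ∃ ε > 0, ∀ s ∈ Ioo t (t + ε), IsGoodTime f x e s := by
  by_cases hw : gradient f (x + t • e) = 0
  · have ht0 : 0 < t := by
      refine lt_of_le_of_ne ht fun h0 => hx ?_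
      rw [← h0] at hw; simpa using hw
    obtain ⟨ρ, hρ, hball⟩ := hcrit.exists_ball hw
    have hseg := hf.normal_segment hn hcrit hw hball
      (hf.mem_normalSpace_of_good hn hcrit he ht0 h hw) he
    refine ⟨ρ, hρ, fun s hs => ⟨?_, s - t, by linarith [hs.1], fun r hr => ?_⟩⟩
    · have := (hseg (s - t) ⟨by linarith [hs.1], by linarith [hs.2]⟩).2
      rwa [show x + t • e + (s - t) • e = x + s • e by module] at this
    · have := (hseg (r - t) ⟨by linarith [hr.1], by linarith [hs.2, hr.2]⟩).1
      rwa [show x + t • e + (r - t) • e = x + r • e by module] at this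
  · obtain ⟨δ, hδ, hfree⟩ := exists_free_interval hf.1 hw
    refine ⟨δ, hδ, fun s hs => ⟨?_, s - t, by linarith [hs.1], fun r hr => ?_⟩⟩
    · have := hf.isAligned_line (x := x + t • e) (e := e) (t := s - t) he (fun r hr => by
        rw [show x + t • e + r • e = x + (t + r) • e by module]
        exact hfree _ ⟨by linarith [hr.1], by linarith [hr.2, hs.2]⟩) (h t ⟨ht, le_rfl⟩).1
        (s - t) ⟨by linarith [hs.1], le_rfl⟩
      rwa [show x + t • e + (s - t) • e = x + s • e by module] at this
    · exact hfree r ⟨by linarith [hr.1], by linarith [hr.2, hs.2]⟩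

theorem IsMetricFunction.isGoodTime (hn : 1 ≤ n) (hf : IsMetricFunction f)
    (hcrit : HasRegularCriticalSet f) (he : ‖e‖ = 1) (hx : gradient f x ≠ 0)
    (hal : IsAligned f x e) {t : ℝ} (ht : 0 ≤ t) : IsGoodTime f x e t := by
  by_contra hbad
  -- Continuous induction at the first bad parameter `b`: it is good itself, and so are the
  -- parameters right after it.
  set B : Set ℝ := {t | 0 ≤ t ∧ ¬ IsGoodTime f x e t} with hB
  have hBne : B.Nonempty := ⟨t, ht, hbad⟩
  have hBb : BddBelow B := ⟨0, fun s hs => hs.1⟩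
  set b := sInf B with hb
  have hb0 : 0 ≤ b := le_csInf hBne fun s hs => hs.1
  have hlt : ∀ s ∈ Ico 0 b, IsGoodTime f x e s := fun s hs => by
    by_contra h
    exact absurd (csInf_le hBb ⟨hs.1, h⟩) (not_le.2 hs.2)
  have hgb : IsGoodTime f x e b := by
    rcases hb0.eq_or_lt with h0 | h0
    · rw [← h0]
      refine ⟨by simpa using hal, ?_⟩
      obtain ⟨δ, hδ, h⟩ := exists_free_interval hf.1 (x := x) (e := e) (t := 0) (by simpa using hx)
      exact ⟨δ, hδ, fun s hs => h s ⟨hs.1, by linarith [hs.2]⟩⟩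
    · exact hf.isGoodTime_of_forall_lt hn hcrit he h0 hlt
  have hle : ∀ s ∈ Icc 0 b, IsGoodTime f x e s := fun s hs => by
    rcases hs.2.eq_or_lt with h | h
    · rw [h]; exact hgb
    · exact hlt s ⟨hs.1, h⟩
  obtain ⟨ε, hε, hright⟩ := hf.exists_good_right hn hcrit he hx hb0 hle
  obtain ⟨s, hs, hsb⟩ := exists_lt_of_csInf_lt hBne (show sInf B < b + ε by linarith)
  refine hs.2 ?_
  rcases le_or_gt s b with h | h
  · exact hle s ⟨hs.1, h⟩
  · exact hright s ⟨h, hsb⟩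

/-- The gradient is tangent to every normal line, all the way. -/
theorem IsMetricFunction.isAligned_global (hn : 1 ≤ n) (hf : IsMetricFunction f)
    (hcrit : HasRegularCriticalSet f) (he : ‖e‖ = 1) (hx : gradient f x ≠ 0)
    (hal : IsAligned f x e) (t : ℝ) : IsAligned f (x + t • e) e := by
  rcases le_total 0 t with ht | ht
  · exact (hf.isGoodTime hn hcrit he hx hal ht).1
  · have := (hf.isGoodTime hn hcrit (e := -e) (by rwa [norm_neg]) hx hal.neg
      (neg_nonneg.2 ht)).1
    rw [isAligned_neg_iff] at this
    simpa using this

theorem IsMetricFunction.mem_normalSpace_global (hn : 1 ≤ n) (hf : IsMetricFunction f)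
    (hcrit : HasRegularCriticalSet f) (he : ‖e‖ = 1) (hx : gradient f x ≠ 0)
    (hal : IsAligned f x e) {t : ℝ} (hw : gradient f (x + t • e) = 0) :
    e ∈ normalSpace (connectedComponentIn (criticalSet f) (x + t • e)) (x + t • e) := by
  rcases lt_trichotomy 0 t with ht | rfl | ht
  · exact hf.mem_normalSpace_of_good hn hcrit he ht
      (fun s hs => hf.isGoodTime hn hcrit he hx hal hs.1) hw
  · simp [hx] at hw
  · have := hf.mem_normalSpace_of_good hn hcrit (x := x) (e := -e) (t := -t) (by rwa [norm_neg])
      (neg_pos.2 ht)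
      (fun s hs => hf.isGoodTime hn hcrit (by rwa [norm_neg]) hx hal.neg hs.1) (by simpa using hw)
    simpa using this

theorem IsMetricFunction.exists_gt_gradient_ne_zero (hn : 1 ≤ n) (hf : IsMetricFunction f)
    (hcrit : HasRegularCriticalSet f) (he : ‖e‖ = 1) (hx : gradient f x ≠ 0)
    (hal : IsAligned f x e) {t : ℝ} (ht : 0 ≤ t) : ∃ s > t, gradient f (x + s • e) ≠ 0 := by
  obtain ⟨δ, hδ, h⟩ := (hf.isGoodTime hn hcrit he hx hal (t := t + 1) (by linarith)).2
  obtain ⟨s, hs, hs'⟩ : ∃ s, max t (t + 1 - δ) < s ∧ s < t + 1 :=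
    exists_between (max_lt (by linarith) (by linarith))
  rw [max_lt_iff] at hs
  exact ⟨s, hs.1, h s ⟨hs.2, hs'⟩⟩

theorem IsMetricFunction.gradient_ne_zero_of_mem (hf : IsMetricFunction f)
    (hx : gradient f x ≠ 0) (hy : y ∈ levelSurface f x) : gradient f y ≠ 0 := by
  rw [← norm_ne_zero_iff, hf.2 x y hy]
  exact norm_ne_zero_iff.2 hx

theorem hasFDerivAt_normalMap (hf : ContDiff ℝ 2 f) (hx : gradient f x ≠ 0) (t : ℝ) :
    HasFDerivAt (fun y => y + t • unitNormal f y)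
      (ContinuousLinearMap.id ℝ _ + t • fderiv ℝ (unitNormal f) x) x :=
  (hasFDerivAt_id x).add ((hasFDerivAt_unitNormal hf hx).const_smul t)

/-- A function constant to first order along the level sets is constant on each noncritical level
surface. -/
theorem IsMetricFunction.eq_on_levelSurface {F : Type*} [NormedAddCommGroup F] [NormedSpace ℝ F]
    (hf : IsMetricFunction f) (hx : gradient f x ≠ 0) {k : EuclideanSpace ℝ (Fin n) → F}
    (hk : ∀ y, gradient f y ≠ 0 → DifferentiableAt ℝ k y ∧
      ∀ v, inner ℝ (unitNormal f y) v = 0 → fderiv ℝ k y v = 0)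
    (hy : y ∈ levelSurface f x) : k y = k x := by
  refine (isPreconnected_levelSurface f x).eq_of_eventually_eq ?_ hy (self_mem_levelSurface f x)
  intro a ha
  have ha0 := hf.gradient_ne_zero_of_mem hx ha
  have h := eventually_eq_of_fderiv_ker hf.1 ha0 (k := k) (by
    filter_upwards [eventually_gradient_ne_zero hf.1 ha0] with b hb
    exact ⟨(hk b hb).1, fun v hv => (hk b hb).2 v ((inner_gradient_eq_zero_iff hb).1 hv)⟩)
  filter_upwards [self_mem_nhdsWithin, mem_nhdsWithin_of_mem_nhds h] with b hb hb'
  exact hb' ((eq_of_mem_levelSurface hb).trans (eq_of_mem_levelSurface ha).symm)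

/-- The derivative in a tangent direction v is ⟨∇f(a + tν), v + t Dν v⟩. By global alignment the
gradient there is still a multiple of ν(a), to which v and Dν v are orthogonal. -/
theorem IsMetricFunction.value_parallel (hn : 1 ≤ n) (hf : IsMetricFunction f)
    (hcrit : HasRegularCriticalSet f) (hx : gradient f x ≠ 0) (hy : y ∈ levelSurface f x) (t : ℝ) :
    f (y + t • unitNormal f y) = f (x + t • unitNormal f x) := by
  refine hf.eq_on_levelSurface hx (k := fun y => f (y + t • unitNormal f y)) (fun a ha => ?_) hy
  have h1 : HasFDerivAt (fun y => f (y + t • unitNormal f y)) _ a :=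
    (hasFDerivAt_inner_gradient hf.1 (a + t • unitNormal f a)).comp a
      (hasFDerivAt_normalMap hf.1 ha t)
  refine ⟨h1.differentiableAt, fun v hv => ?_⟩
  rw [h1.fderiv]
  have h2 := hf.isAligned_global hn hcrit (norm_unitNormal ha) ha (isAligned_unitNormal f a) t
  simp only [ContinuousLinearMap.comp_apply, add_apply, smul_apply,
    ContinuousLinearMap.id_apply, innerSL_apply_apply]
  rw [h2, inner_smul_left, inner_add_right, inner_smul_right, inner_unitNormal_fderiv hf.1 ha, hv]
  simp

/-- The t-derivative of `value_parallel`. With alignment it shows that all normal lines of a level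
surface meet critical points at the same parameters. -/
theorem IsMetricFunction.slope_parallel (hn : 1 ≤ n) (hf : IsMetricFunction f)
    (hcrit : HasRegularCriticalSet f) (hx : gradient f x ≠ 0) (hy : y ∈ levelSurface f x) (t : ℝ) :
    inner ℝ (gradient f (y + t • unitNormal f y)) (unitNormal f y) =
      inner ℝ (gradient f (x + t • unitNormal f x)) (unitNormal f x) := by
  have h1 := hasDerivAt_comp_curve hf.1 (hasDerivAt_line y (unitNormal f y) t)
  have h2 := hasDerivAt_comp_curve hf.1 (hasDerivAt_line x (unitNormal f x) t)
  have h3 : (fun s : ℝ => f (y + s • unitNormal f y)) = fun s => f (x + s • unitNormal f x) := by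
    funext s; exact hf.value_parallel hn hcrit hx hy s
  rw [h3] at h1
  exact h1.unique h2

/-- Moving a noncritical level surface along its normals to a critical point, one stays in a single
critical component. -/
theorem IsMetricFunction.mem_component_parallel (hn : 1 ≤ n) (hf : IsMetricFunction f)
    (hcrit : HasRegularCriticalSet f) (hx : gradient f x ≠ 0) (hy : y ∈ levelSurface f x) {t : ℝ}
    (hw : gradient f (x + t • unitNormal f x) = 0) :
    y + t • unitNormal f y ∈ connectedComponentIn (criticalSet f) (x + t • unitNormal f x) := by
  have hcont : ContinuousOn (fun y => y + t • unitNormal f y) (levelSurface f x) := fun a ha =>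
    (hasFDerivAt_normalMap hf.1
      (hf.gradient_ne_zero_of_mem hx ha) t).continuousAt.continuousWithinAt
  refine ((isPreconnected_levelSurface f x).image _ hcont).subset_connectedComponentIn
    ⟨x, self_mem_levelSurface f x, rfl⟩ ?_ ⟨y, hy, rfl⟩
  rintro _ ⟨a, ha, rfl⟩
  have ha0 := hf.gradient_ne_zero_of_mem hx ha
  refine (hf.isAligned_global hn hcrit (norm_unitNormal ha0) ha0
    (isAligned_unitNormal f a) t).gradient_eq_zero ?_
  rw [hf.slope_parallel hn hcrit hx ha t, hw, inner_zero_left]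

theorem IsMetricFunction.sub_eq_smul_of_nearest (hf : IsMetricFunction f)
    (hy : gradient f y ≠ 0) (h : ∀ z ∈ levelSurface f y, ‖x - y‖ ≤ ‖x - z‖) :
    x - y = (inner ℝ (unitNormal f y) (x - y) : ℝ) • unitNormal f y := by
  set ν := unitNormal f y
  have hν : (inner ℝ ν ν : ℝ) = 1 := by
    rw [real_inner_self_eq_norm_sq, norm_unitNormal hy]; norm_num
  have hperp : ∀ v, inner ℝ ν v = (0 : ℝ) → inner ℝ (x - y) v = (0 : ℝ) := by
    intro v hv
    obtain ⟨c, h0, hc, hs⟩ := exists_curve_levelSurface hf.1 hy ((inner_gradient_eq_zero_iff hy).2 hv)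
    have h1 : HasDerivAt (fun s => x - c s) (-v) 0 := by simpa using hc.const_sub x
    have h2 := h1.norm_sq
    have hmin : IsLocalMin (fun s => ‖x - c s‖ ^ 2) 0 := by
      filter_upwards [hs] with s hs
      rw [h0]
      exact pow_le_pow_left₀ (norm_nonneg _) (h _ hs) 2
    have h3 := hmin.hasDerivAt_eq_zero h2
    rw [h0, inner_neg_right] at h3
    linarith
  have hv : inner ℝ ν (x - y - (inner ℝ ν (x - y) : ℝ) • ν) = (0 : ℝ) := by
    rw [inner_sub_right, inner_smul_right, hν]; ring
  have h1 := hperp _ hv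
  rw [← sub_eq_zero, ← inner_self_eq_zero (𝕜 := ℝ), inner_sub_left, h1, inner_smul_left, hv]
  simp

end GlobalLines

/-! ### Two-sided tangent balls at a critical hypersurface -/

section Hypersurfaces

variable {n : ℕ} {f : EuclideanSpace ℝ (Fin n) → ℝ} {p w x y z e m v : EuclideanSpace ℝ (Fin n)}

theorem IsPreconnected.pos_of_ne_zero {X : Type*} [TopologicalSpace X] {S : Set X}
    (hS : IsPreconnected S) {h : X → ℝ} (hc : ContinuousOn h S) (h0 : ∀ a ∈ S, h a ≠ 0)
    {a b : X} (ha : a ∈ S) (hb : b ∈ S) (hpos : 0 < h a) : 0 < h b := by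
  by_contra! hle
  obtain ⟨c, hc, hc0⟩ := hS.intermediate_value hb ha hc ⟨hle, hpos.le⟩
  exact h0 c hc hc0

/-- A local defining function of a regular hypersurface. -/
theorem IsRegularSurface.exists_defining {S : Set (EuclideanSpace ℝ (Fin n))} {r : ℕ}
    (hr : r + 1 = n) (hS : IsRegularSurface 1 r S) (hw : w ∈ S) (he : e ∈ normalSpace S w)
    (he0 : e ≠ 0) :
    ∃ (h : EuclideanSpace ℝ (Fin n) → ℝ) (a R : ℝ), 0 < R ∧ 0 < a ∧ ContinuousOn h (ball w R) ∧
      (∀ z ∈ ball w R, z ∈ S ↔ h z = 0) ∧ HasDerivAt (fun s : ℝ => h (w + s • e)) a 0 := by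
  obtain ⟨Φ, W, hws, hΦ, hΦs, hW, hmem⟩ := hS w hw
  set q := Φ w with hq
  have hqt : q ∈ Φ.target := Φ.map_source hws
  have hA : HasFDerivAt Φ (fderiv ℝ Φ w) w :=
    ((hΦ.contDiffAt (Φ.open_source.mem_nhds hws)).differentiableAt one_ne_zero).hasFDerivAt
  have hB : HasFDerivAt Φ.symm (fderiv ℝ Φ.symm q) q :=
    ((hΦs.contDiffAt (Φ.open_target.mem_nhds hqt)).differentiableAt one_ne_zero).hasFDerivAt
  set A := fderiv ℝ Φ w
  set B := fderiv ℝ Φ.symm q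
  have hBA : B.comp A = ContinuousLinearMap.id ℝ _ := by
    have h1 : HasFDerivAt (Φ.symm ∘ Φ) (B.comp A) w := hB.comp w hA
    refine h1.unique ((hasFDerivAt_id w).congr_of_eventuallyEq ?_)
    filter_upwards [Φ.open_source.mem_nhds hws] with z hz using Φ.left_inv hz
  have hBA' : ∀ v, B (A v) = v := fun v => congrArg (fun L => L v) hBA
  -- Otherwise `e` would be tangent as well as normal to `S`, hence orthogonal to itself.
  have hAe : A e ∉ W := by
    intro hk
    have h3 : HasFDerivAt Φ.symm B (q + (0 : ℝ) • A e) := by simpa using hB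
    have h4 := h3.comp_hasDerivAt (0 : ℝ) (hasDerivAt_line q (A e) 0)
    have h1 : Tendsto (fun s : ℝ => q + s • A e) (𝓝 0) (𝓝 q) := by
      have : Continuous (fun s : ℝ => q + s • A e) := by fun_prop
      simpa using this.tendsto 0
    rw [hBA'] at h4
    have := inner_eq_zero_of_curve he (by simp [hq, Φ.left_inv hws]) h4 (by
      filter_upwards [h1.eventually (Φ.open_target.mem_nhds hqt)] with s hs
      rw [Function.comp_apply, hmem _ (Φ.map_target hs), Φ.right_inv hs]
      exact W.add_mem ((hmem w hws).1 hw) (W.smul_mem s hk))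
    exact he0 (inner_self_eq_zero.1 this)
  have hWo : Module.finrank ℝ Wᗮ = 1 := by
    have := Submodule.finrank_add_finrank_orthogonal W
    simp only [finrank_euclideanSpace, Fintype.card_fin] at this
    omega
  obtain ⟨m, hm0, hm⟩ := finrank_eq_one_iff'.1 hWo
  have hker : ∀ k, k ∈ W ↔ inner ℝ (m : EuclideanSpace ℝ (Fin n)) k = (0 : ℝ) := by
    intro k
    constructor
    · exact fun hk => (Submodule.mem_orthogonal' _ _).1 m.2 k hk
    · intro hk
      rw [← Submodule.orthogonal_orthogonal W, Submodule.mem_orthogonal]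
      intro u hu
      obtain ⟨c, hc⟩ := hm ⟨u, hu⟩
      have : u = c • (m : EuclideanSpace ℝ (Fin n)) := by
        rw [← Submodule.coe_smul, hc]
      rw [this, inner_smul_left, hk, mul_zero]
  set b : ℝ := inner ℝ (m : EuclideanSpace ℝ (Fin n)) (A e) with hb
  have hb0 : b ≠ 0 := fun h => hAe ((hker _).2 h)
  obtain ⟨R, hR, hRs⟩ := Metric.isOpen_iff.1 Φ.open_source w hws
  -- The factor `b` fixes the sign, so that the function increases in the direction `e`, at rate b².
  refine ⟨fun z => b * inner ℝ (m : EuclideanSpace ℝ (Fin n)) (Φ z), b * b, R, hR,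
    mul_self_pos.2 hb0, ?_, ?_, ?_⟩
  · have : ContinuousOn Φ (ball w R) := Φ.continuousOn.mono hRs
    fun_prop
  · intro z hz
    rw [hmem z (hRs hz), hker]
    simp [hb0]
  · have h3 : HasFDerivAt Φ A (w + (0 : ℝ) • e) := by simpa using hA
    have h4 := h3.comp_hasDerivAt (0 : ℝ) (hasDerivAt_line w e 0)
    exact ((innerSL ℝ (m : EuclideanSpace ℝ (Fin n))).hasFDerivAt.comp_hasDerivAt (0 : ℝ)
      h4).const_mul b

/-- The assumptions say that the centres x + ρa and y − ρb, and likewise y + ρb and x − ρa, are at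
least 2ρ apart. Add them by the parallelogram law and use ‖a + b‖² = 4 − ‖b − a‖². -/
theorem norm_sub_le_of_two_balls {a b : EuclideanSpace ℝ (Fin n)} {ρ : ℝ} (hρ : 0 < ρ)
    (ha : ‖a‖ = 1) (hb : ‖b‖ = 1) (h1 : 2 * ρ ≤ ‖(x - y) + ρ • (a + b)‖)
    (h2 : 2 * ρ ≤ ‖(y - x) + ρ • (a + b)‖) : ρ * ‖b - a‖ ≤ ‖y - x‖ := by
  have h3 := parallelogram_law_with_norm ℝ (ρ • (a + b)) (x - y)
  rw [add_comm, show ρ • (a + b) - (x - y) = (y - x) + ρ • (a + b) by module] at h3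
  rw [show ρ • (a + b) + (x - y) = (x - y) + ρ • (a + b) by module] at h3
  have h4 := parallelogram_law_with_norm ℝ a b
  rw [norm_smul, Real.norm_of_nonneg hρ.le, norm_sub_rev x y] at h3
  rw [ha, hb, norm_sub_rev a b] at h4
  have h5 : (ρ * ‖b - a‖) ^ 2 ≤ ‖y - x‖ ^ 2 := by
    have h6 := pow_le_pow_left₀ (by positivity) h1 2
    have h7 := pow_le_pow_left₀ (by positivity) h2 2
    have h8 : (ρ * ‖a + b‖) ^ 2 = ρ ^ 2 * (4 - ‖b - a‖ ^ 2) := by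
      rw [mul_pow]; linear_combination ρ ^ 2 * h4
    rw [h8] at h3
    linarith
  exact (sq_le_sq₀ (by positivity) (norm_nonneg _)).1 h5

/-- When a level surface is moved along its normals onto a critical hypersurface, the normal field
is controlled by the displacement. -/
theorem IsMetricFunction.eventually_norm_unitNormal_sub_le (hn : 1 ≤ n) (hf : IsMetricFunction f)
    (hcrit : HasRegularCriticalSet f) (hy : gradient f y ≠ 0) {t : ℝ}
    (hw : gradient f (y + t • unitNormal f y) = 0) {r : ℕ} (hr : r + 1 = n)
    (hC : IsRegularSurface 1 r
      (connectedComponentIn (criticalSet f) (y + t • unitNormal f y))) :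
    ∃ ρ > 0, ∀ᶠ y' in 𝓝[levelSurface f y] y, ρ * ‖unitNormal f y' - unitNormal f y‖ ≤
      ‖(y' + t • unitNormal f y') - (y + t • unitNormal f y)‖ := by
  set e := unitNormal f y with he
  set w := y + t • e with hwdef
  set C := connectedComponentIn (criticalSet f) w with hCdef
  have he1 : ‖e‖ = 1 := norm_unitNormal hy
  have heN : e ∈ normalSpace C w := hf.mem_normalSpace_global hn hcrit he1 hy
    (isAligned_unitNormal f y) hw
  have hwC : w ∈ C := mem_connectedComponentIn hw
  obtain ⟨h, a, R, hR, ha, hcont, hS, hder⟩ := hC.exists_defining hr hwC heN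
    (by rw [← norm_ne_zero_iff, he1]; exact one_ne_zero)
  obtain ⟨r₀, hr₀, hball⟩ := hcrit.exists_ball hw
  -- Small enough that tangent balls of radius ρ at points near `w` stay in the domain of `h` (3ρ <
  -- R) and avoid critical points (2ρ < r₀ − ρ/2).
  set ρ : ℝ := min R r₀ / 6 with hρdef
  have hρ : 0 < ρ := by positivity
  have hρR : 3 * ρ < R := by have := min_le_left R r₀; linarith
  have hρr : 3 * ρ < r₀ := by have := min_le_right R r₀; linarith
  have hsub : ∀ w' e' : EuclideanSpace ℝ (Fin n), ‖w' - w‖ < ρ → ‖e'‖ = 1 →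
      ball (w' + ρ • e') ρ ⊆ ball w R := by
    intro w' e' hw' he' b hb
    rw [mem_ball_iff_norm] at hb ⊢
    rw [show b - w = (b - (w' + ρ • e')) + ((w' - w) + ρ • e') by module]
    have h1 := norm_add_le (b - (w' + ρ • e')) ((w' - w) + ρ • e')
    have h2 := norm_add_le (w' - w) (ρ • e')
    rw [norm_smul, he', Real.norm_of_nonneg hρ.le] at h2
    linarith
  have hne : ∀ w' e' : EuclideanSpace ℝ (Fin n), w' ∈ C → ‖w' - w‖ < ρ / 2 → ‖e'‖ = 1 →
      e' ∈ normalSpace C w' → ∀ b ∈ ball (w' + ρ • e') ρ, h b ≠ 0 := by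
    intro w' e' hw'C hw' he' heN' b hb h0
    have hCeq : connectedComponentIn (criticalSet f) w' = C := eq_component hw'C
    have hfree := hf.normal_ball hn hcrit (w := w') (m := e') (r := r₀ - ρ / 2)
      (gradient_eq_zero_of_mem_component hw'C) (fun z hz hz0 => by
        rw [hCeq]
        refine hball z ?_ hz0
        rw [mem_ball_iff_norm] at hz ⊢
        rw [show z - w = (z - w') + (w' - w) by module]
        refine (norm_add_le _ _).trans_lt ?_
        linarith) (by rwa [hCeq]) he' hρ (by linarith)
    have hbC := (hS b (hsub w' e' (by linarith) he' hb)).2 h0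
    exact hfree b hb (gradient_eq_zero_of_mem_component hbC)
  have hsign : ∀ w' e' : EuclideanSpace ℝ (Fin n), w' ∈ C → ‖w' - w‖ < ρ / 2 → ‖e'‖ = 1 →
      e' ∈ normalSpace C w' → ContinuousOn h (ball (w' + ρ • e') ρ) := fun w' e' _ hw' he' _ =>
    hcont.mono (hsub w' e' (by linarith) he')
  -- At `w` the sign of `h` on the tangent ball on the side σe is that of σ: it is so near `w` by
  -- the derivative, and `h` has no zero in the ball.
  have hside : ∀ σ : ℝ, |σ| = 1 → 0 < σ * h (w + ρ • (σ • e)) := by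
    intro σ hσ
    have hσ2 : σ * σ = 1 := by rw [← abs_mul_abs_self, hσ, one_mul]
    have hσe : ‖σ • e‖ = 1 := by rw [norm_smul, he1, Real.norm_eq_abs, hσ, one_mul]
    have hσN : σ • e ∈ normalSpace C w := Submodule.smul_mem _ _ heN
    have h00 : h (w + (0 : ℝ) • e) = 0 := by
      rw [zero_smul, add_zero]; exact (hS w (mem_ball_self hR)).1 hwC
    have hder' : HasDerivAt (fun s : ℝ => σ * h (w + s • (σ • e))) a 0 := by
      have h1 : HasDerivAt (fun s : ℝ => s * σ) σ 0 := by
        simpa using (hasDerivAt_id (0 : ℝ)).mul_const σ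
      have h2 : HasDerivAt (fun s : ℝ => h (w + s • e)) a ((0 : ℝ) * σ) := by simpa using hder
      have h3 := (h2.comp (0 : ℝ) h1).const_mul σ
      have h4 : σ * (a * σ) = a := by linear_combination a * hσ2
      rw [h4] at h3
      refine h3.congr_of_eventuallyEq (Eventually.of_forall fun s => ?_)
      simp [smul_smul]
    have hev : ∀ᶠ s in 𝓝[>] (0 : ℝ), 0 < σ * h (w + s • (σ • e)) := by
      have h1 := (hasDerivAt_iff_tendsto_slope.1 hder').eventually (lt_mem_nhds ha)
      have h2 := h1.filter_mono (nhdsWithin_mono 0 (fun s (hs : 0 < s) => hs.ne'))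
      filter_upwards [h2, self_mem_nhdsWithin] with s hs hs0
      rw [slope_def_field, zero_smul, add_zero] at hs
      rw [zero_smul, add_zero] at h00
      rw [h00, mul_zero, sub_zero, sub_zero] at hs
      exact (div_pos_iff_of_pos_right hs0).1 hs
    obtain ⟨s, hs, hsρ⟩ := (hev.and (Ioo_mem_nhdsGT hρ)).exists
    have hmem : w + s • (σ • e) ∈ ball (w + ρ • (σ • e)) ρ := by
      rw [mem_ball_iff_norm', show w + ρ • σ • e - (w + s • σ • e) = (ρ - s) • (σ • e) by module,
        norm_smul, hσe, Real.norm_of_nonneg (by linarith [hsρ.2])]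
      linarith [hsρ.1]
    have hσ0 : σ ≠ 0 := by rintro rfl; simp at hσ
    exact (convex_ball _ _).isPreconnected.pos_of_ne_zero
      (continuousOn_const.mul (hsign w (σ • e) hwC (by simpa using hρ) hσe hσN))
      (fun b hb => mul_ne_zero hσ0 (hne w (σ • e) hwC (by simpa using hρ) hσe hσN b hb)) hmem
      (mem_ball_self hρ) hs
  have hball_sign : ∀ σ : ℝ, |σ| = 1 → ∀ w' e' : EuclideanSpace ℝ (Fin n), w' ∈ C →
      ‖w' - w‖ < ρ / 2 → ‖e'‖ = 1 → e' ∈ normalSpace C w' → 0 < σ * h (w' + ρ • (σ • e')) →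
      ∀ b ∈ ball (w' + ρ • (σ • e')) ρ, 0 < σ * h b := by
    intro σ hσ w' e' hw'C hw' he' heN' hpos b hb
    have hσe : ‖σ • e'‖ = 1 := by rw [norm_smul, he', Real.norm_eq_abs, hσ, one_mul]
    have hσN : σ • e' ∈ normalSpace C w' := Submodule.smul_mem _ _ heN'
    have hσ0 : σ ≠ 0 := by rintro rfl; simp at hσ
    exact (convex_ball _ _).isPreconnected.pos_of_ne_zero
      (continuousOn_const.mul (hsign w' (σ • e') hw'C hw' hσe hσN))
      (fun b hb => mul_ne_zero hσ0 (hne w' (σ • e') hw'C hw' hσe hσN b hb))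
      (mem_ball_self hρ) hb hpos
  have hνc : ContinuousAt (unitNormal f) y := (hasFDerivAt_unitNormal hf.1 hy).continuousAt
  have hφc : ContinuousAt (fun y' => y' + t • unitNormal f y') y := by fun_prop
  -- By continuity of ν the sign at the centre of the ball is the same for nearby `y'`, so that the
  -- two sides are labelled consistently.
  have hnear : ∀ σ : ℝ, |σ| = 1 → ∀ᶠ y' in 𝓝 y,
      0 < σ * h ((y' + t • unitNormal f y') + ρ • (σ • unitNormal f y')) := by
    intro σ hσ
    have hσe : ‖σ • e‖ = 1 := by rw [norm_smul, he1, Real.norm_eq_abs, hσ, one_mul]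
    have h1 : ContinuousAt (fun y' => (y' + t • unitNormal f y') + ρ • (σ • unitNormal f y')) y := by
      fun_prop
    have hmem : w + ρ • (σ • e) ∈ ball w R :=
      hsub w (σ • e) (by simpa using hρ) hσe (mem_ball_self hρ)
    have h2 : ContinuousAt h (w + ρ • (σ • e)) := hcont.continuousAt (isOpen_ball.mem_nhds hmem)
    have h3 : ContinuousAt
        (fun y' => σ * h ((y' + t • unitNormal f y') + ρ • (σ • unitNormal f y'))) y :=
      continuousAt_const.mul (ContinuousAt.comp (g := h) h2 h1)
    exact h3.eventually (lt_mem_nhds (hside σ hσ))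
  refine ⟨ρ, hρ, ?_⟩
  filter_upwards [self_mem_nhdsWithin, mem_nhdsWithin_of_mem_nhds (hnear 1 (by simp)),
    mem_nhdsWithin_of_mem_nhds (hnear (-1) (by simp)),
    mem_nhdsWithin_of_mem_nhds (hφc.preimage_mem_nhds (ball_mem_nhds _ (half_pos hρ)))]
    with y' hy' hp hm hyb
  have hy'0 := hf.gradient_ne_zero_of_mem hy hy'
  set e' := unitNormal f y' with he'
  have he'1 : ‖e'‖ = 1 := norm_unitNormal hy'0
  set w' := y' + t • e' with hw'
  have hw'C : w' ∈ C := hf.mem_component_parallel hn hcrit hy hy' hw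
  have hw'w : ‖w' - w‖ < ρ / 2 := by
    have : w' ∈ ball w (ρ / 2) := hyb
    rwa [mem_ball_iff_norm] at this
  have heN' : e' ∈ normalSpace C w' := by
    have := hf.mem_normalSpace_global hn hcrit he'1 hy'0 (isAligned_unitNormal f y')
      (t := t) (gradient_eq_zero_of_mem_component hw'C)
    have hCeq : connectedComponentIn (criticalSet f) w' = C := eq_component hw'C
    rwa [← hCeq]
  have hww : ‖w - w‖ < ρ / 2 := by simpa using hρ
  -- Balls on which `h` has opposite signs are disjoint.
  have hdisj : ∀ w₁ e₁ w₂ e₂ : EuclideanSpace ℝ (Fin n),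
      (∀ b ∈ ball (w₁ + ρ • ((1 : ℝ) • e₁)) ρ, 0 < 1 * h b) →
      (∀ b ∈ ball (w₂ + ρ • ((-1 : ℝ) • e₂)) ρ, 0 < -1 * h b) →
      2 * ρ ≤ ‖(w₁ - w₂) + ρ • (e₁ + e₂)‖ := by
    intro w₁ e₁ w₂ e₂ h1 h2
    have hd : Disjoint (ball (w₁ + ρ • ((1 : ℝ) • e₁)) ρ) (ball (w₂ + ρ • ((-1 : ℝ) • e₂)) ρ) :=
      Set.disjoint_left.2 fun b hb1 hb2 => by
        have := h1 b hb1
        have := h2 b hb2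
        linarith
    rw [disjoint_ball_ball_iff hρ hρ, dist_eq_norm] at hd
    rw [show w₁ - w₂ + ρ • (e₁ + e₂) = w₁ + ρ • (1 : ℝ) • e₁ - (w₂ + ρ • (-1 : ℝ) • e₂) by module]
    linarith
  refine norm_sub_le_of_two_balls hρ he1 he'1 ?_ ?_
  · exact hdisj w e w' e' (hball_sign 1 (by simp) w e hwC hww he1 heN (hside 1 (by simp)))
      (hball_sign (-1) (by simp) w' e' hw'C hw'w he'1 heN' hm)
  · rw [add_comm e e']
    exact hdisj w' e' w e (hball_sign 1 (by simp) w' e' hw'C hw'w he'1 heN' hp)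
      (hball_sign (-1) (by simp) w e hwC hww he1 heN (hside (-1) (by simp)))

end Hypersurfaces

/-! ### All critical components are hypersurfaces: no focal points, hence hyperplanes -/

section Hyperplanes

variable {n : ℕ} {f : EuclideanSpace ℝ (Fin n) → ℝ} {p w x y z e m v : EuclideanSpace ℝ (Fin n)}

/-- There are no focal points on a normal line outside critical components of codimension at
least two. -/
theorem IsMetricFunction.eq_zero_of_focal (hn : 1 ≤ n) (hf : IsMetricFunction f)
    (hcrit : HasRegularCriticalSet f)
    (hA : ∀ p, gradient f p = 0 → ∃ r, r + 1 = n ∧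
      IsRegularSurface 1 r (connectedComponentIn (criticalSet f) p))
    (hy : gradient f y ≠ 0) {t : ℝ} (hv : v + t • fderiv ℝ (unitNormal f) y v = 0) : v = 0 := by
  suffices hD : fderiv ℝ (unitNormal f) y v = 0 by simpa [hD] using hv
  have he1 := norm_unitNormal hy
  by_cases hw : gradient f (y + t • unitNormal f y) = 0
  · have hperp : inner ℝ (unitNormal f y) v = (0 : ℝ) := by
      have := congrArg (fun u => (inner ℝ (unitNormal f y) u : ℝ)) hv
      simpa [inner_add_right, inner_smul_right, inner_unitNormal_fderiv hf.1 hy] using this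
    obtain ⟨r, hr, hC⟩ := hA _ hw
    obtain ⟨ρ, hρ, hev⟩ := hf.eventually_norm_unitNormal_sub_le hn hcrit hy hw hr hC
    obtain ⟨c, h0, hc, hs⟩ :=
      exists_curve_levelSurface hf.1 hy ((inner_gradient_eq_zero_iff hy).2 hperp)
    subst h0
    have ht : Tendsto c (𝓝 0) (𝓝[levelSurface f (c 0)] (c 0)) :=
      tendsto_nhdsWithin_iff.2 ⟨hc.continuousAt.tendsto, hs⟩
    have hν : HasDerivAt (fun s => unitNormal f (c s)) (fderiv ℝ (unitNormal f) (c 0) v) 0 := by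
      have := (hasFDerivAt_unitNormal hf.1 hy).comp_hasDerivAt (0 : ℝ) hc
      exact this
    have hφ : HasDerivAt (fun s => c s + t • unitNormal f (c s)) 0 0 := by
      rw [← hv]; exact hc.add (hν.const_smul t)
    have hφo := hasDerivAt_iff_isLittleO.1 hφ
    simp only [smul_zero, sub_zero] at hφo
    -- The displacement has zero derivative, as `v` is focal; since it controls the variation of the
    -- normal, that has zero derivative as well.
    have hbig : (fun s => unitNormal f (c s) - unitNormal f (c 0)) =O[𝓝 0] fun s =>
        c s + t • unitNormal f (c s) - (c 0 + t • unitNormal f (c 0)) := by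
      refine IsBigO.of_bound ρ⁻¹ ?_
      filter_upwards [ht.eventually hev] with s hs
      rw [inv_mul_eq_div, le_div_iff₀' hρ]
      exact hs
    refine hν.unique (hasDerivAt_iff_isLittleO.2 ?_)
    simpa using hbig.trans_isLittleO hφo
  -- At a noncritical end point, ν(y' + tν(y')) = σν(y') near `y` with a fixed sign σ.
  -- Differentiating along the focal vector `v` gives 0 = σ Dν v.
  · obtain ⟨σ, hσ⟩ : ∃ σ : ℝ, (fun y' => unitNormal f (y' + t • unitNormal f y')) =ᶠ[𝓝 y]
        fun y' => σ • unitNormal f y' := by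
      have hφc : ContinuousAt (fun y' => y' + t • unitNormal f y') y :=
        (hasFDerivAt_normalMap hf.1 hy t).continuousAt
      have hνc := (hasFDerivAt_unitNormal hf.1 hy).continuousAt
      have hνc' : ContinuousAt (fun y' => unitNormal f (y' + t • unitNormal f y')) y :=
        ContinuousAt.comp (g := unitNormal f) (hasFDerivAt_unitNormal hf.1 hw).continuousAt hφc
      have hor : ∀ᶠ y' in 𝓝 y, unitNormal f (y' + t • unitNormal f y') = unitNormal f y' ∨
          unitNormal f (y' + t • unitNormal f y') = -unitNormal f y' := by
        filter_upwards [eventually_gradient_ne_zero hf.1 hy,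
          hφc.eventually (eventually_gradient_ne_zero hf.1 hw)] with a ha hwa
        exact (hf.isAligned_global hn hcrit (norm_unitNormal ha) ha (isAligned_unitNormal f a)
          t).unitNormal_eq_or (norm_unitNormal ha) hwa
      have hin : ContinuousAt (fun y' => (inner ℝ (unitNormal f (y' + t • unitNormal f y'))
          (unitNormal f y') : ℝ)) y := hνc'.inner hνc
      have hunit : ∀ᶠ y' in 𝓝 y, (inner ℝ (unitNormal f y') (unitNormal f y') : ℝ) = 1 := by
        filter_upwards [eventually_gradient_ne_zero hf.1 hy] with a ha
        rw [real_inner_self_eq_norm_sq, norm_unitNormal ha]; norm_num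
      rcases hor.self_of_nhds with h | h
      · refine ⟨1, ?_⟩
        have hpos : ∀ᶠ y' in 𝓝 y, (0 : ℝ) < inner ℝ (unitNormal f (y' + t • unitNormal f y'))
            (unitNormal f y') := hin.eventually (lt_mem_nhds (by
              beta_reduce; rw [h, hunit.self_of_nhds]; norm_num))
        filter_upwards [hor, hpos, hunit] with a ha hp hu
        rcases ha with ha | ha
        · rw [ha, one_smul]
        · rw [ha, inner_neg_left, hu] at hp; norm_num at hp
      · refine ⟨-1, ?_⟩
        have hneg : ∀ᶠ y' in 𝓝 y, inner ℝ (unitNormal f (y' + t • unitNormal f y'))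
            (unitNormal f y') < (0 : ℝ) := hin.eventually (gt_mem_nhds (by
              beta_reduce; rw [h, inner_neg_left, hunit.self_of_nhds]; norm_num))
        filter_upwards [hor, hneg, hunit] with a ha hp hu
        rcases ha with ha | ha
        · rw [ha, hu] at hp; norm_num at hp
        · rw [ha, neg_one_smul]
    have h1 : HasFDerivAt (fun y' => unitNormal f (y' + t • unitNormal f y'))
        ((fderiv ℝ (unitNormal f) (y + t • unitNormal f y)).comp
          (ContinuousLinearMap.id ℝ _ + t • fderiv ℝ (unitNormal f) y)) y :=
      HasFDerivAt.comp (g := unitNormal f) y (hasFDerivAt_unitNormal hf.1 hw)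
        (hasFDerivAt_normalMap hf.1 hy t)
    have h2 := h1.unique (((hasFDerivAt_unitNormal hf.1 hy).const_smul σ).congr_of_eventuallyEq hσ)
    have h3 := congrArg (fun L => L v) h2
    simp only [ContinuousLinearMap.comp_apply, add_apply, smul_apply,
      ContinuousLinearMap.id_apply, hv, map_zero] at h3
    have hσ0 : σ ≠ 0 := by
      rintro rfl
      have hσy : unitNormal f (y + t • unitNormal f y) = (0 : ℝ) • unitNormal f y :=
        hσ.self_of_nhds
      have h4 := norm_unitNormal hw
      rw [hσy] at h4
      simp at h4
    exact (smul_eq_zero.1 h3.symm).resolve_left hσ0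

/-- An eigenvector of the symmetric operator Dν with eigenvalue μ ≠ 0 would be focal at t = −1/μ. -/
theorem IsMetricFunction.fderiv_unitNormal_eq_zero (hn : 1 ≤ n) (hf : IsMetricFunction f)
    (hcrit : HasRegularCriticalSet f)
    (hA : ∀ p, gradient f p = 0 → ∃ r, r + 1 = n ∧
      IsRegularSurface 1 r (connectedComponentIn (criticalSet f) p))
    (hy : gradient f y ≠ 0) : fderiv ℝ (unitNormal f) y = 0 := by
  set T : EuclideanSpace ℝ (Fin n) →ₗ[ℝ] EuclideanSpace ℝ (Fin n) :=
    (fderiv ℝ (unitNormal f) y).toLinearMap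
  have hT : T.IsSymmetric := fun v w =>
    (hf.inner_fderiv_unitNormal_comm hy v w).trans (real_inner_comm _ _)
  have hfr : Module.finrank ℝ (EuclideanSpace ℝ (Fin n)) = n := by simp
  have hzero : ∀ i, T (hT.eigenvectorBasis hfr i) = 0 := by
    intro i
    have h1 := hT.apply_eigenvectorBasis hfr i
    set μ : ℝ := hT.eigenvalues hfr i
    set b := hT.eigenvectorBasis hfr i with hb
    by_contra hne
    have hμ : μ ≠ 0 := by
      intro h0
      rw [h1, h0] at hne
      simp at hne
    have h2 : b + (-μ⁻¹) • fderiv ℝ (unitNormal f) y b = 0 := by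
      have : fderiv ℝ (unitNormal f) y b = μ • b := h1
      rw [this, smul_smul, neg_mul, inv_mul_cancel₀ hμ]; simp
    have h3 := hf.eq_zero_of_focal hn hcrit hA hy h2
    have h4 : ‖b‖ = 1 := (hT.eigenvectorBasis hfr).norm_eq_one i
    rw [h3] at h4
    simp at h4
  have hT0 : T = 0 := (hT.eigenvectorBasis hfr).toBasis.ext fun i => by
    simpa using hzero i
  ext1 v
  exact congrArg (fun L => L v) hT0

/-- If all critical components are hypersurfaces, the function depends on one linear coordinate
only. -/
theorem IsMetricFunction.exists_eq_comp_inner (hn : 1 ≤ n) (hf : IsMetricFunction f)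
    (hcrit : HasRegularCriticalSet f)
    (hA : ∀ p, gradient f p = 0 → ∃ r, r + 1 = n ∧
      IsRegularSurface 1 r (connectedComponentIn (criticalSet f) p)) :
    ∃ (e : EuclideanSpace ℝ (Fin n)) (h : ℝ → ℝ), e ≠ 0 ∧ ∀ x, f x = h (inner ℝ e x) := by
  obtain ⟨x₀, hx₀⟩ : ∃ x, gradient f x ≠ 0 := by
    by_contra! hall
    have h1 : criticalSet f = univ := eq_univ_of_forall hall
    have := hf.interior_criticalSet hn hcrit
    rw [h1, interior_univ] at this
    exact empty_ne_univ this.symm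
  set e := unitNormal f x₀ with he
  have he1 : ‖e‖ = 1 := norm_unitNormal hx₀
  have hee : (inner ℝ e e : ℝ) = 1 := by rw [real_inner_self_eq_norm_sq, he1]; norm_num
  have hν : ∀ y ∈ levelSurface f x₀, unitNormal f y = e := fun y hy =>
    hf.eq_on_levelSurface hx₀ (k := unitNormal f) (fun a ha =>
      ⟨(hasFDerivAt_unitNormal hf.1 ha).differentiableAt, fun v _ => by
        rw [hf.fderiv_unitNormal_eq_zero hn hcrit hA ha]; rfl⟩) hy
  have hin : ∀ y ∈ levelSurface f x₀, (inner ℝ e y : ℝ) = inner ℝ e x₀ := by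
    intro y hy
    have key := hf.eq_on_levelSurface hx₀ (k := fun y => (inner ℝ (unitNormal f y) y : ℝ))
      (fun a ha => by
        have h1 : HasFDerivAt (fun y => (inner ℝ (unitNormal f y) y : ℝ)) _ a :=
          (hasFDerivAt_unitNormal hf.1 ha).inner ℝ (hasFDerivAt_id a)
        refine ⟨h1.differentiableAt, fun v hv => ?_⟩
        rw [h1.fderiv]
        simp [hf.fderiv_unitNormal_eq_zero hn hcrit hA ha, hv]) hy
    simp only [hν y hy] at key
    exact key
  -- The level surface is closed and lies in the hyperplane. From a point of the hyperplane the
  -- vector to a nearest point of the surface is both parallel and orthogonal to `e`, so it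
  -- vanishes.
  have hplane : ∀ x, (inner ℝ e x : ℝ) = inner ℝ e x₀ → x ∈ levelSurface f x₀ := by
    intro x hx
    obtain ⟨y, hy, hd⟩ := (isClosed_levelSurface hf.1.continuous x₀).exists_infDist_eq_dist
      ⟨x₀, self_mem_levelSurface f x₀⟩ x
    have h1 := hf.sub_eq_smul_of_nearest (x := x) (hf.gradient_ne_zero_of_mem hx₀ hy) (fun z hz => by
      rw [levelSurface_eq_of_mem hy] at hz
      rw [← dist_eq_norm, ← dist_eq_norm, ← hd]
      exact infDist_le_dist_of_mem hz)
    rw [hν y hy, inner_sub_right, hx, hin y hy, sub_self, zero_smul, sub_eq_zero] at h1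
    rwa [h1]
  refine ⟨e, fun c => f (x₀ + (c - inner ℝ e x₀) • e), ?_, fun x => ?_⟩
  · rw [← norm_ne_zero_iff, he1]; exact one_ne_zero
  · set c : ℝ := inner ℝ e x - inner ℝ e x₀ with hc
    have hmem : x - c • e ∈ levelSurface f x₀ := hplane _ (by
      rw [inner_sub_right, inner_smul_right, hee]; linarith)
    have := hf.value_parallel hn hcrit hx₀ hmem c
    rw [hν _ hmem, sub_add_cancel] at this
    exact this

end Hyperplanes

/-! ### A critical component of codimension at least two: affine planes and distance functions -/

section Focal

variable {n : ℕ} {f : EuclideanSpace ℝ (Fin n) → ℝ} {p w x y z e m v : EuclideanSpace ℝ (Fin n)}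

theorem exists_unit_orthogonal {N : Submodule ℝ (EuclideanSpace ℝ (Fin n))}
    (hN : 2 ≤ Module.finrank ℝ N) (hm : m ∈ N) (hm1 : ‖m‖ = 1) :
    ∃ b ∈ N, ‖b‖ = 1 ∧ inner ℝ m b = (0 : ℝ) := by
  have hmm : (inner ℝ m m : ℝ) = 1 := by rw [real_inner_self_eq_norm_sq, hm1]; norm_num
  obtain ⟨v, hv, hvs⟩ : ∃ v ∈ N, v ∉ Submodule.span ℝ {m} := by
    by_contra! hle
    have h1 := Submodule.finrank_mono (show N ≤ Submodule.span ℝ {m} from hle)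
    have h2 := finrank_span_singleton (K := ℝ) (show m ≠ 0 by
      rw [← norm_ne_zero_iff, hm1]; exact one_ne_zero)
    omega
  set u := v - (inner ℝ m v : ℝ) • m with hu
  have hu0 : u ≠ 0 := fun h => hvs (Submodule.mem_span_singleton.2 ⟨_, (sub_eq_zero.1 h).symm⟩)
  refine ⟨‖u‖⁻¹ • u, N.smul_mem _ (N.sub_mem hv (N.smul_mem _ hm)), ?_, ?_⟩
  · rw [norm_smul, norm_inv, norm_norm, inv_mul_cancel₀ (norm_ne_zero_iff.2 hu0)]
  · rw [inner_smul_right, hu, inner_sub_right, inner_smul_right, hmm]; simp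

theorem exists_great_circle {N : Submodule ℝ (EuclideanSpace ℝ (Fin n))}
    (hN : 2 ≤ Module.finrank ℝ N) (hm : m ∈ N) (hm1 : ‖m‖ = 1) (he : e ∈ N) (he1 : ‖e‖ = 1) :
    ∃ b ∈ N, ‖b‖ = 1 ∧ inner ℝ m b = (0 : ℝ) ∧ ∃ θ : ℝ, e = Real.cos θ • m + Real.sin θ • b := by
  have hmm : (inner ℝ m m : ℝ) = 1 := by rw [real_inner_self_eq_norm_sq, hm1]; norm_num
  set c : ℝ := inner ℝ m e with hc
  set u := e - c • m with hu
  have hcb : |c| ≤ 1 := by simpa [hm1, he1] using abs_real_inner_le_norm m e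
  have hmu : inner ℝ m u = (0 : ℝ) := by
    rw [hu, inner_sub_right, inner_smul_right, hmm]; simp [hc]
  have hnu : ‖u‖ = √(1 - c ^ 2) := by
    rw [← Real.sqrt_sq (norm_nonneg u), hu, norm_sub_sq_real, inner_smul_right, norm_smul, hm1, he1,
      real_inner_comm, ← hc, Real.norm_eq_abs, mul_one, sq_abs]
    congr 1; ring
  obtain ⟨b, hb, hb1, hmb, hub⟩ : ∃ b ∈ N, ‖b‖ = 1 ∧ inner ℝ m b = (0 : ℝ) ∧ u = ‖u‖ • b := by
    by_cases hu0 : u = 0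
    · obtain ⟨b, hb, hb1, hmb⟩ := exists_unit_orthogonal hN hm hm1
      exact ⟨b, hb, hb1, hmb, by simp [hu0]⟩
    · have hn0 := norm_ne_zero_iff.2 hu0
      refine ⟨‖u‖⁻¹ • u, N.smul_mem _ (N.sub_mem he (N.smul_mem _ hm)), ?_, ?_, ?_⟩
      · rw [norm_smul, norm_inv, norm_norm, inv_mul_cancel₀ hn0]
      · rw [inner_smul_right, hmu, mul_zero]
      · rw [smul_smul, mul_inv_cancel₀ hn0, one_smul]
  refine ⟨b, hb, hb1, hmb, Real.arccos c, ?_⟩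
  rw [Real.cos_arccos (abs_le.1 hcb).1 (abs_le.1 hcb).2, Real.sin_arccos, ← hnu, ← hub, hu]
  module

theorem IsMetricFunction.isAligned_normal_line (hn : 1 ≤ n) (hf : IsMetricFunction f)
    (hcrit : HasRegularCriticalSet f) (hw : gradient f w = 0)
    (hm : m ∈ normalSpace (connectedComponentIn (criticalSet f) w) w) (hm1 : ‖m‖ = 1) :
    (∀ t : ℝ, IsAligned f (w + t • m) m) ∧
    (∀ t : ℝ, gradient f (w + t • m) = 0 →
      m ∈ normalSpace (connectedComponentIn (criticalSet f) (w + t • m)) (w + t • m)) ∧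
    ∀ t : ℝ, ∃ s > t, gradient f (w + s • m) ≠ 0 := by
  obtain ⟨r, hr, hball⟩ := hcrit.exists_ball hw
  obtain ⟨h1, h2⟩ := hf.normal_segment hn hcrit hw hball hm hm1 (r / 2) ⟨by linarith, by linarith⟩
  have hsh : ∀ t : ℝ, w + (r / 2) • m + (t - r / 2) • m = w + t • m := fun t => by module
  refine ⟨fun t => ?_, fun t h0 => ?_, fun t => ?_⟩
  · rw [← hsh t]
    exact hf.isAligned_global hn hcrit hm1 h1 h2 _
  · rw [← hsh t] at h0 ⊢
    exact hf.mem_normalSpace_global hn hcrit hm1 h1 h2 h0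
  · obtain ⟨s, hs, hs0⟩ := hf.exists_gt_gradient_ne_zero hn hcrit hm1 h1 h2 (le_max_left 0 t)
    refine ⟨s + r / 2, by linarith [le_max_right 0 t], ?_⟩
    rwa [← hsh, add_sub_cancel_right]

/-- Every radius in the normal space is a normal line, so the gradient is radial and orthogonal to
the circle. -/
theorem IsMetricFunction.eq_on_great_circle (hn : 1 ≤ n) (hf : IsMetricFunction f)
    (hcrit : HasRegularCriticalSet f) (hw : gradient f w = 0)
    (hm : m ∈ normalSpace (connectedComponentIn (criticalSet f) w) w) (hm1 : ‖m‖ = 1)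
    (he : e ∈ normalSpace (connectedComponentIn (criticalSet f) w) w) (he1 : ‖e‖ = 1)
    (hme : inner ℝ m e = (0 : ℝ)) (s θ : ℝ) :
    IsAligned f (w + s • (Real.cos θ • m + Real.sin θ • e)) (Real.cos θ • m + Real.sin θ • e) ∧
      f (w + s • (Real.cos θ • m + Real.sin θ • e)) = f (w + s • m) := by
  have hal : ∀ θ : ℝ, IsAligned f (w + s • (Real.cos θ • m + Real.sin θ • e))
      (Real.cos θ • m + Real.sin θ • e) := by
    intro θ
    have hunit : ‖Real.cos θ • m + Real.sin θ • e‖ = 1 := by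
      have h1 : ‖Real.cos θ • m + Real.sin θ • e‖ ^ 2 = 1 := by
        rw [norm_add_sq_real, inner_smul_left, inner_smul_right, hme, norm_smul, norm_smul, hm1,
          he1, Real.norm_eq_abs, Real.norm_eq_abs, mul_one, mul_one, sq_abs, sq_abs]
        simp
      rw [← Real.sqrt_sq (norm_nonneg (Real.cos θ • m + Real.sin θ • e)), h1, Real.sqrt_one]
    exact (hf.isAligned_normal_line hn hcrit hw
      (Submodule.add_mem _ (Submodule.smul_mem _ _ hm) (Submodule.smul_mem _ _ he)) hunit).1 s
  refine ⟨hal θ, ?_⟩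
  have hD : ∀ θ : ℝ, HasDerivAt
      (fun θ : ℝ => f (w + s • (Real.cos θ • m + Real.sin θ • e))) 0 θ := by
    intro θ
    have hc : HasDerivAt (fun θ : ℝ => w + s • (Real.cos θ • m + Real.sin θ • e))
        (s • (-Real.sin θ • m + Real.cos θ • e)) θ :=
      ((((Real.hasDerivAt_cos θ).smul_const m).add
        ((Real.hasDerivAt_sin θ).smul_const e)).const_smul s).const_add w
    have h1 := hasDerivAt_comp_curve hf.1 hc
    have h2 : (inner ℝ (Real.cos θ • m + Real.sin θ • e)
        (s • (-Real.sin θ • m + Real.cos θ • e)) : ℝ) = 0 := by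
      simp only [inner_smul_right, inner_add_left, inner_add_right, inner_smul_left, hme,
        real_inner_comm m e, real_inner_self_eq_norm_sq, hm1, he1, conj_trivial]
      ring
    have h3 : inner ℝ (gradient f (w + s • (Real.cos θ • m + Real.sin θ • e)))
        (s • (-Real.sin θ • m + Real.cos θ • e)) = (0 : ℝ) := by
      rw [hal θ, inner_smul_left, h2, mul_zero]
    rwa [h3] at h1
  have := is_const_of_deriv_eq_zero (fun θ => (hD θ).differentiableAt) (fun θ => (hD θ).deriv) θ 0
  simpa using this

/-- A critical component of codimension at least two is symmetric along its normal lines. -/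
theorem IsMetricFunction.reflection_mem (hn : 1 ≤ n) (hf : IsMetricFunction f)
    (hcrit : HasRegularCriticalSet f) (hw : gradient f w = 0)
    (hN : 2 ≤ Module.finrank ℝ (normalSpace (connectedComponentIn (criticalSet f) w) w))
    (hm : m ∈ normalSpace (connectedComponentIn (criticalSet f) w) w) (hm1 : ‖m‖ = 1) {τ : ℝ}
    (hτ : gradient f (w + τ • m) = 0) :
    w - τ • m ∈ connectedComponentIn (criticalSet f) (w + τ • m) := by
  obtain ⟨b, hb, hb1, hmb⟩ := exists_unit_orthogonal hN hm hm1
  obtain ⟨r, hr, hball⟩ := hcrit.exists_ball hw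
  set s := r / 2 with hs
  have hy : gradient f (w + s • m) ≠ 0 :=
    (hf.normal_segment hn hcrit hw hball hm hm1 s ⟨by linarith, by linarith⟩).1
  set u : ℝ → EuclideanSpace ℝ (Fin n) := fun θ => Real.cos θ • m + Real.sin θ • b with hu
  have huc : Continuous u := by fun_prop
  have hcirc := fun θ => hf.eq_on_great_circle hn hcrit hw hm hm1 hb hb1 hmb s θ
  -- A small circle in the normal space joins `w + s m` to `w - s m` inside one noncritical level
  -- surface.
  have hsub := subset_levelSurface (f := f) (x := w + s • m)
    (isPreconnected_univ.image (fun θ => w + s • u θ) (by fun_prop))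
    ⟨0, mem_univ _, by simp [hu]⟩ (by rintro _ ⟨θ, -, rfl⟩; exact (hcirc θ).2)
  have hmem : ∀ θ, w + s • u θ ∈ levelSurface f (w + s • m) := fun θ => hsub ⟨θ, mem_univ _, rfl⟩
  have hy' : w + s • u Real.pi ∈ levelSurface f (w + s • m) := hmem _
  set g : ℝ → ℝ := fun θ => inner ℝ (gradient f (w + s • u θ)) (u θ) with hg
  have hgc : Continuous g := by
    have := continuous_gradient hf.1
    fun_prop
  have hg0 : ∀ θ, g θ ≠ 0 := fun θ h0 =>
    hf.gradient_ne_zero_of_mem hy (hmem θ) ((hcirc θ).1.gradient_eq_zero h0)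
  have hX : ∀ θ, gradient f (w + s • u θ) = g θ • u θ := fun θ => (hcirc θ).1
  have hu0 : u 0 = m := by simp [hu]
  have huπ : u Real.pi = -m := by simp [hu]
  -- The radial slope has constant modulus and no zero on the circle, so by connectedness it keeps
  -- its sign; hence ν is reversed between the two ends of the diameter.
  have hgπ : g Real.pi = g 0 := by
    have habs : |g Real.pi| = |g 0| := by
      have h1 := hf.2 _ _ hy'
      have h2 : gradient f (w + s • m) = g 0 • m := by have := hX 0; rwa [hu0] at this
      rw [hX, h2, norm_smul, norm_smul, huπ, norm_neg, hm1] at h1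
      simpa using h1
    rcases abs_eq_abs.1 habs with h | h
    · exact h
    · exfalso
      rcases lt_or_gt_of_ne (hg0 0) with h0 | h0
      · have := isPreconnected_univ.pos_of_ne_zero hgc.continuousOn (fun θ _ => hg0 θ)
          (mem_univ Real.pi) (mem_univ 0) (by linarith)
        linarith
      · have := isPreconnected_univ.pos_of_ne_zero hgc.continuousOn (fun θ _ => hg0 θ)
          (mem_univ 0) (mem_univ Real.pi) h0
        linarith
  have hgrad : gradient f (w + s • u Real.pi) = -gradient f (w + s • m) := by
    have h2 : gradient f (w + s • m) = g 0 • m := by have := hX 0; rwa [hu0] at this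
    rw [hX, h2, hgπ, huπ, smul_neg]
  have hν : unitNormal f (w + s • u Real.pi) = -unitNormal f (w + s • m) := by
    rw [unitNormal, hgrad, norm_neg, smul_neg, unitNormal]
  have hal : IsAligned f (w + s • m) m := (hf.isAligned_normal_line hn hcrit hw hm hm1).1 s
  obtain ⟨σ, hσ, hσν⟩ : ∃ σ : ℝ, σ * σ = 1 ∧ unitNormal f (w + s • m) = σ • m := by
    rcases hal.unitNormal_eq_or hm1 hy with h | h
    · exact ⟨1, by norm_num, by simpa using h⟩
    · exact ⟨-1, by norm_num, by simpa using h⟩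
  have h1 : w + s • m + (σ * (τ - s)) • unitNormal f (w + s • m) = w + τ • m := by
    rw [hσν, smul_smul, show σ * (τ - s) * σ = τ - s by linear_combination (τ - s) * hσ]
    module
  have h2 : w + s • u Real.pi + (σ * (τ - s)) • unitNormal f (w + s • u Real.pi) = w - τ • m := by
    rw [hν, hσν, huπ, smul_neg, smul_neg, smul_smul,
      show σ * (τ - s) * σ = τ - s by linear_combination (τ - s) * hσ]
    module
  -- Pushing both ends by the same parameter along ν reaches `w + τ m` and `w - τ m`.
  have := hf.mem_component_parallel hn hcrit hy hy' (t := σ * (τ - s)) (by rwa [h1])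
  rwa [h1, h2] at this

/-- Normal vectors at a critical point on a normal line are focal directions. -/
theorem IsMetricFunction.focal_of_mem_normalSpace (hn : 1 ≤ n) (hf : IsMetricFunction f)
    (hcrit : HasRegularCriticalSet f) (hy : gradient f y ≠ 0) {t : ℝ}
    (hw : gradient f (y + t • unitNormal f y) = 0)
    (hm : m ∈ normalSpace (connectedComponentIn (criticalSet f) (y + t • unitNormal f y))
      (y + t • unitNormal f y)) (hym : inner ℝ (unitNormal f y) m = (0 : ℝ)) :
    m + t • fderiv ℝ (unitNormal f) y m = 0 := by
  set ν := unitNormal f y with hνdef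
  have hνν : (inner ℝ ν ν : ℝ) = 1 := by
    rw [real_inner_self_eq_norm_sq, norm_unitNormal hy]; norm_num
  have hperp : ∀ v, inner ℝ ν v = (0 : ℝ) →
      inner ℝ (m + t • fderiv ℝ (unitNormal f) y m) v = (0 : ℝ) := by
    intro v hv
    obtain ⟨c, h0, hc, hs⟩ := exists_curve_levelSurface hf.1 hy ((inner_gradient_eq_zero_iff hy).2 hv)
    have hd : HasFDerivAt (fun y => y + t • unitNormal f y)
        (ContinuousLinearMap.id ℝ _ + t • fderiv ℝ (unitNormal f) y) (c 0) := by
      rw [h0]; exact hasFDerivAt_normalMap hf.1 hy t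
    -- The parallel map sends the level surface into the critical component, so (1 + t Dν)v is
    -- orthogonal to `m` for tangent `v`; symmetry of Dν moves the operator onto `m`.
    have h1 := inner_eq_zero_of_curve hm (by simp only [Function.comp_apply, h0]; rfl)
      (hd.comp_hasDerivAt (0 : ℝ) hc) (by
        filter_upwards [hs] with s hs
        exact hf.mem_component_parallel hn hcrit hy hs hw)
    simp only [add_apply, ContinuousLinearMap.id_apply, smul_apply, inner_add_right,
      inner_smul_right] at h1
    rw [inner_add_left, inner_smul_left, hf.inner_fderiv_unitNormal_comm hy,
      real_inner_comm m (fderiv ℝ (unitNormal f) y v)]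
    simpa using h1
  have hν0 : inner ℝ (m + t • fderiv ℝ (unitNormal f) y m) ν = (0 : ℝ) := by
    rw [real_inner_comm, inner_add_right, hym, inner_smul_right, inner_unitNormal_fderiv hf.1 hy]
    simp
  refine ext_inner_right ℝ fun v => ?_
  have h1 := hperp (v - (inner ℝ ν v : ℝ) • ν) (by
    rw [inner_sub_right, inner_smul_right, hνν]; ring)
  rw [inner_sub_right, inner_smul_right, hν0] at h1
  rw [inner_zero_left]
  linarith

/-- A normal line to a critical component of codimension at least two meets it only once. -/
theorem IsMetricFunction.notMem_normal_line (hn : 1 ≤ n) (hf : IsMetricFunction f)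
    (hcrit : HasRegularCriticalSet f) {r : ℕ} (hr : r + 2 ≤ n)
    (hC : IsRegularSurface 1 r (connectedComponentIn (criticalSet f) p))
    (hw : w ∈ connectedComponentIn (criticalSet f) p)
    (hm : m ∈ normalSpace (connectedComponentIn (criticalSet f) p) w) (hm1 : ‖m‖ = 1) {τ : ℝ}
    (hτ : τ ≠ 0) : w + τ • m ∉ connectedComponentIn (criticalSet f) p := by
  intro hmem
  set C := connectedComponentIn (criticalSet f) p with hCdef
  have hCeq : ∀ z ∈ C, connectedComponentIn (criticalSet f) z = C := fun z hz => eq_component hz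
  have hK : ∀ z ∈ C, gradient f z = 0 := fun z hz => gradient_eq_zero_of_mem_component hz
  have hfr : ∀ z ∈ C, 2 ≤ Module.finrank ℝ (normalSpace C z) := fun z hz => by
    have := hC.finrank_normalSpace hz
    omega
  have hline := hf.isAligned_normal_line hn hcrit (hK w hw) (by rwa [hCeq w hw]) hm1
  have hNm : ∀ t : ℝ, w + t • m ∈ C → m ∈ normalSpace C (w + t • m) := fun t ht => by
    have := hline.2.1 t (hK _ ht)
    rwa [hCeq _ ht] at this
  -- Reflecting w + kτm in w + (k + 1)τm yields w + (k + 2)τm, so all these points belong to `C`.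
  have hall : ∀ k : ℕ, w + ((k : ℝ) * τ) • m ∈ C ∧ w + (((k : ℝ) + 1) * τ) • m ∈ C := by
    intro k
    induction k with
    | zero => simpa using ⟨hw, hmem⟩
    | succ k ih =>
      refine ⟨by simpa using ih.2, ?_⟩
      have h1 : w + (((k : ℝ) + 1) * τ) • m + (-τ) • m = w + ((k : ℝ) * τ) • m := by module
      have h2 := hf.reflection_mem hn hcrit (w := w + (((k : ℝ) + 1) * τ) • m) (m := m) (τ := -τ)
        (hK _ ih.2) (by rw [hCeq _ ih.2]; exact hfr _ ih.2)
        (by rw [hCeq _ ih.2]; exact hNm _ ih.2) hm1 (by rw [h1]; exact hK _ ih.1)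
      rw [h1, hCeq _ ih.1] at h2
      convert h2 using 1
      push_cast
      module
  obtain ⟨s, -, hy⟩ := hline.2.2 0
  have hal := hline.1 s
  obtain ⟨σ, hσ, hσν⟩ : ∃ σ : ℝ, σ * σ = 1 ∧ unitNormal f (w + s • m) = σ • m := by
    rcases hal.unitNormal_eq_or hm1 hy with h | h
    · exact ⟨1, by norm_num, by simpa using h⟩
    · exact ⟨-1, by norm_num, by simpa using h⟩
  have hσ0 : σ ≠ 0 := by rintro rfl; simp at hσ
  set T : Module.End ℝ (EuclideanSpace ℝ (Fin n)) :=
    (fderiv ℝ (unitNormal f) (w + s • m)).toLinearMap with hT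
  -- Codimension at least 2 leaves a normal `b` orthogonal to `m`, a focal direction for the k-th
  -- point: an eigenvector of Dν at the one point `w + s m`. The eigenvalues are distinct for
  -- distinct k, too many for a finite dimension.
  have heig : ∀ k : ℕ, T.HasEigenvalue (-(σ * ((k : ℝ) * τ - s))⁻¹) ∧ (k : ℝ) * τ - s ≠ 0 := by
    intro k
    have hkC := (hall k).1
    have hks : (k : ℝ) * τ - s ≠ 0 := fun h => hy (by
      rw [← sub_eq_zero.1 h]; exact hK _ hkC)
    refine ⟨?_, hks⟩
    obtain ⟨b, hb, hb1, hmb⟩ := exists_unit_orthogonal (hfr _ hkC) (hNm _ hkC) hm1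
    have h1 : w + s • m + (σ * ((k : ℝ) * τ - s)) • unitNormal f (w + s • m) =
        w + ((k : ℝ) * τ) • m := by
      rw [hσν, smul_smul, show σ * ((k : ℝ) * τ - s) * σ = (k : ℝ) * τ - s by
        linear_combination ((k : ℝ) * τ - s) * hσ]
      module
    have h2 := hf.focal_of_mem_normalSpace hn hcrit hy (m := b) (t := σ * ((k : ℝ) * τ - s))
      (by rw [h1]; exact hK _ hkC) (by rw [h1, hCeq _ hkC]; exact hb)
      (by rw [hσν, inner_smul_left, hmb, mul_zero])
    refine Module.End.hasEigenvalue_of_hasEigenvector (x := b) ⟨?_, ?_⟩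
    · rw [Module.End.mem_eigenspace_iff]
      have h3 : (σ * ((k : ℝ) * τ - s)) • fderiv ℝ (unitNormal f) (w + s • m) b = -b :=
        eq_neg_of_add_eq_zero_right h2
      have h4 : σ * ((k : ℝ) * τ - s) ≠ 0 := mul_ne_zero hσ0 hks
      change fderiv ℝ (unitNormal f) (w + s • m) b = _
      rw [neg_smul, ← smul_neg, ← h3, smul_smul, inv_mul_cancel₀ h4, one_smul]
    · rw [← norm_ne_zero_iff, hb1]; exact one_ne_zero
  have hinj : Function.Injective fun k : ℕ => -(σ * ((k : ℝ) * τ - s))⁻¹ := by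
    intro k l hkl
    have h1 := inv_injective (neg_injective hkl)
    have h2 := mul_left_cancel₀ hσ0 h1
    have h3 : (k : ℝ) * τ = (l : ℝ) * τ := by linarith
    exact_mod_cast mul_right_cancel₀ hτ h3
  exact (Set.infinite_range_of_injective hinj)
    (T.finite_hasEigenvalue.subset (by rintro _ ⟨k, rfl⟩; exact (heig k).1))

/-- If z were ahead of w in the direction m, a point x far along the ray would be nearer to z than
to w. The segment from x to its nearest point q of C is normal to C, so it lies on the same line,
and q ≠ w would be a second meeting point. -/
theorem IsMetricFunction.inner_nonpos_of_mem (hn : 1 ≤ n) (hf : IsMetricFunction f)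
    (hcrit : HasRegularCriticalSet f) (hp : gradient f p = 0) {r : ℕ} (hr : r + 2 ≤ n)
    (hC : IsRegularSurface 1 r (connectedComponentIn (criticalSet f) p))
    (hw : w ∈ connectedComponentIn (criticalSet f) p)
    (hz : z ∈ connectedComponentIn (criticalSet f) p)
    (hm : m ∈ normalSpace (connectedComponentIn (criticalSet f) p) w) (hm1 : ‖m‖ = 1) :
    inner ℝ m (z - w) ≤ (0 : ℝ) := by
  by_contra! hpos
  set C := connectedComponentIn (criticalSet f) p with hCdef
  have hCeq : ∀ z ∈ C, connectedComponentIn (criticalSet f) z = C := fun z hz => eq_component hz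
  have hK : ∀ z ∈ C, gradient f z = 0 := fun z hz => gradient_eq_zero_of_mem_component hz
  have hline := hf.isAligned_normal_line hn hcrit (hK w hw) (by rwa [hCeq w hw]) hm1
  -- Beyond this bound ‖x − z‖² = s² − 2s⟨m, z − w⟩ + ‖z − w‖² is less than s².
  obtain ⟨s, hs, hx⟩ := hline.2.2 (‖z - w‖ ^ 2 / (2 * inner ℝ m (z - w)))
  have hs0 : 0 < s := lt_of_le_of_lt (by positivity) hs
  rw [gt_iff_lt, div_lt_iff₀ (by positivity)] at hs
  set x := w + s • m with hxdef
  have hxz : ‖x - z‖ < s := by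
    have h1 : ‖x - z‖ ^ 2 < s ^ 2 := by
      rw [show x - z = s • m - (z - w) by rw [hxdef]; module, norm_sub_sq_real, norm_smul, hm1,
        inner_smul_left, Real.norm_of_nonneg hs0.le]
      simp only [conj_trivial]
      nlinarith
    exact lt_of_pow_lt_pow_left₀ 2 hs0.le h1
  obtain ⟨q, hq, hqd⟩ := (isClosed_component hf.1 hp).exists_infDist_eq_dist ⟨w, hw⟩ x
  have hmin : ∀ a ∈ C, ‖x - q‖ ≤ ‖x - a‖ := fun a ha => by
    rw [← dist_eq_norm, ← dist_eq_norm, ← hqd]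
    exact infDist_le_dist_of_mem ha
  have hd0 : 0 < ‖x - q‖ := norm_pos_iff.2 (sub_ne_zero.2 fun h => hx (h ▸ hK q hq))
  set d := ‖x - q‖ with hd
  have hds : d < s := (hmin z hz).trans_lt hxz
  set e := d⁻¹ • (x - q) with he
  have heN : e ∈ normalSpace C q := Submodule.smul_mem _ _ (hC.sub_mem_normalSpace hq hmin)
  have he1 : ‖e‖ = 1 := by
    rw [he, norm_smul, norm_inv, hd, norm_norm, inv_mul_cancel₀ hd0.ne']
  have hxq : x = q + d • e := by
    rw [he, smul_smul, mul_inv_cancel₀ hd0.ne', one_smul]; module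
  have hal1 : IsAligned f x m := hline.1 s
  have hal2 : IsAligned f x e := by
    have := (hf.isAligned_normal_line hn hcrit (hK q hq) (by rwa [hCeq q hq]) he1).1 d
    rwa [← hxq] at this
  have hnot := fun {τ : ℝ} (hτ : τ ≠ 0) =>
    hf.notMem_normal_line hn hcrit hr hC hw hm hm1 (τ := τ) hτ
  have hem : e = m ∨ e = -m := by
    rcases hal1.unitNormal_eq_or hm1 hx with h1 | h1 <;>
      rcases hal2.unitNormal_eq_or he1 hx with h2 | h2
    · left; rw [← h1, h2]
    · right; rw [← h1, h2, neg_neg]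
    · right; rw [← h2, h1]
    · left; rw [← neg_inj, ← h2, h1]
  rcases hem with h | h
  · refine hnot (τ := s - d) (by linarith) ?_
    rwa [show w + (s - d) • m = q by
      have h1 : w + s • m = q + d • m := hxq.trans (by rw [h])
      rw [sub_smul, ← add_sub_assoc, h1]; module]
  · refine hnot (τ := s + d) (by linarith) ?_
    rwa [show w + (s + d) • m = q by
      have h1 : w + s • m = q + d • (-m) := hxq.trans (by rw [h])
      rw [add_smul, ← add_assoc, h1]; module]

/-- A critical component of codimension at least two is an affine subspace. -/
theorem IsMetricFunction.exists_eq_planeThrough (hn : 1 ≤ n) (hf : IsMetricFunction f)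
    (hcrit : HasRegularCriticalSet f) (hp : gradient f p = 0) {r : ℕ} (hr : r + 2 ≤ n)
    (hC : IsRegularSurface 1 r (connectedComponentIn (criticalSet f) p)) :
    ∃ W : Submodule ℝ (EuclideanSpace ℝ (Fin n)), Module.finrank ℝ W = r ∧
      connectedComponentIn (criticalSet f) p = planeThrough p W ∧
      ∀ w ∈ connectedComponentIn (criticalSet f) p,
        normalSpace (connectedComponentIn (criticalSet f) p) w = Wᗮ := by
  set C := connectedComponentIn (criticalSet f) p with hCdef
  have hpC : p ∈ C := mem_connectedComponentIn hp
  -- The inequality holds for `m` and `-m`, so `C` lies in its tangent plane at each of its points.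
  have hzero : ∀ w ∈ C, ∀ z ∈ C, ∀ m ∈ normalSpace C w, inner ℝ m (z - w) = (0 : ℝ) := by
    intro w hw z hz m hm
    by_cases hm0 : m = 0
    · simp [hm0]
    have hn0 := norm_ne_zero_iff.2 hm0
    have hu : ‖‖m‖⁻¹ • m‖ = 1 := by rw [norm_smul, norm_inv, norm_norm, inv_mul_cancel₀ hn0]
    have h1 := hf.inner_nonpos_of_mem hn hcrit hp hr hC hw hz (Submodule.smul_mem _ ‖m‖⁻¹ hm) hu
    have h2 := hf.inner_nonpos_of_mem hn hcrit hp hr hC hw hz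
      (Submodule.neg_mem _ (Submodule.smul_mem _ ‖m‖⁻¹ hm)) (by rwa [norm_neg])
    rw [inner_neg_left] at h2
    have h3 : inner ℝ (‖m‖⁻¹ • m) (z - w) = (0 : ℝ) := le_antisymm h1 (by linarith)
    rw [inner_smul_left] at h3
    simpa [hm0] using h3
  have hNeq : ∀ w ∈ C, normalSpace C w = normalSpace C p := by
    intro w hw
    symm
    refine Submodule.eq_of_le_of_finrank_eq (fun m hm => ?_) ?_
    · rw [mem_normalSpace_iff]
      refine (isLittleO_zero _ _).congr' ?_ EventuallyEq.rfl
      filter_upwards [self_mem_nhdsWithin] with z hz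
      have h1 := hzero p hpC z hz m hm
      have h2 := hzero p hpC w hw m hm
      rw [show z - w = (z - p) - (w - p) by module, inner_sub_right, h1, h2, sub_zero]
    · have h1 := hC.finrank_normalSpace hpC
      have h2 := hC.finrank_normalSpace hw
      omega
  refine ⟨(normalSpace C p)ᗮ, ?_, ?_, fun w hw => ?_⟩
  · have h1 := hC.finrank_normalSpace hpC
    have h2 := Submodule.finrank_add_finrank_orthogonal (normalSpace C p)
    simp only [finrank_euclideanSpace, Fintype.card_fin] at h2
    omega
  · ext x
    rw [mem_planeThrough]
    constructor
    · intro hx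
      rw [Submodule.mem_orthogonal]
      exact fun m hm => hzero p hpC x hx m hm
    · intro hx
      -- For `x` in the plane, `x - q` is normal to `C` at the nearest point `q` and also tangent,
      -- hence zero.
      obtain ⟨q, hq, hqd⟩ := (isClosed_component hf.1 hp).exists_infDist_eq_dist ⟨p, hpC⟩ x
      have h1 := hC.sub_mem_normalSpace (x := x) hq (fun a ha => by
        rw [← dist_eq_norm, ← dist_eq_norm, ← hqd]
        exact infDist_le_dist_of_mem ha)
      rw [hNeq q hq] at h1
      have h2 : x - q ∈ (normalSpace C p)ᗮ := by
        rw [show x - q = (x - p) - (q - p) by module]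
        refine Submodule.sub_mem _ hx ?_
        rw [Submodule.mem_orthogonal]
        exact fun m hm => hzero p hpC q hq m hm
      have h3 : inner ℝ (x - q) (x - q) = (0 : ℝ) := (Submodule.mem_orthogonal _ _).1 h2 _ h1
      rw [sub_eq_zero.1 (inner_self_eq_zero.1 h3)]
      exact hq
  · rw [Submodule.orthogonal_orthogonal, hNeq w hw]

/-- In the presence of a critical plane of codimension at least two, the function depends on the
distance to it only. -/
theorem IsMetricFunction.exists_eq_comp_dist (hn : 1 ≤ n) (hf : IsMetricFunction f)
    (hcrit : HasRegularCriticalSet f)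
    {W : Submodule ℝ (EuclideanSpace ℝ (Fin n))} (hW : Module.finrank ℝ W + 2 ≤ n)
    (hC : connectedComponentIn (criticalSet f) p = planeThrough p W)
    (hN : ∀ w ∈ connectedComponentIn (criticalSet f) p,
      normalSpace (connectedComponentIn (criticalSet f) p) w = Wᗮ) :
    ∃ h : ℝ → ℝ, ∀ w ∈ W, ∀ v ∈ Wᗮ, f (p + v + w) = h ‖v‖ := by
  have hfr : 2 ≤ Module.finrank ℝ Wᗮ := by
    have := Submodule.finrank_add_finrank_orthogonal W
    simp only [finrank_euclideanSpace, Fintype.card_fin] at this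
    omega
  have : Nontrivial Wᗮ := Module.finrank_pos_iff (R := ℝ).1 (by omega)
  obtain ⟨⟨b, hb⟩, hb1⟩ := exists_norm_eq Wᗮ zero_le_one
  replace hb1 : ‖b‖ = 1 := hb1
  have hmemC : ∀ w ∈ W, p + w ∈ connectedComponentIn (criticalSet f) p := fun w hw => by
    rw [hC, mem_planeThrough]; simpa using hw
  have hNw : ∀ w ∈ W, normalSpace (connectedComponentIn (criticalSet f) (p + w)) (p + w) = Wᗮ :=
    fun w hw => by rw [eq_component (hmemC w hw), hN _ (hmemC w hw)]
  have hK : ∀ w ∈ W, gradient f (p + w) = 0 := fun w hw =>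
    gradient_eq_zero_of_mem_component (hmemC w hw)
  refine ⟨fun s => f (p + s • b), fun w hw v hv => ?_⟩
  have h1 : f (p + v + w) = f (p + w + ‖v‖ • b) := by
    by_cases hv0 : v = 0
    · simp [hv0]
    have hn0 := norm_ne_zero_iff.2 hv0
    have hu : ‖‖v‖⁻¹ • v‖ = 1 := by rw [norm_smul, norm_inv, norm_norm, inv_mul_cancel₀ hn0]
    obtain ⟨a, ha, ha1, hba, θ, hθ⟩ := exists_great_circle hfr hb hb1
      (Submodule.smul_mem _ ‖v‖⁻¹ hv) hu
    have h2 := (hf.eq_on_great_circle hn hcrit (hK w hw) (by rwa [hNw w hw]) hb1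
      (by rwa [hNw w hw]) ha1 hba ‖v‖ θ).2
    rw [← hθ, smul_smul, mul_inv_cancel₀ hn0, one_smul] at h2
    rw [← h2]
    congr 1; module
  rw [h1]
  -- Invariance along `W`: the gradient is a multiple of the normal direction `b` at all these
  -- points.
  have hD : ∀ s : ℝ, HasDerivAt (fun s : ℝ => f (p + ‖v‖ • b + s • w)) 0 s := by
    intro s
    have h2 := hasDerivAt_comp_curve hf.1 (hasDerivAt_line (p + ‖v‖ • b) w s)
    have h3 := (hf.isAligned_normal_line hn hcrit (hK _ (W.smul_mem s hw))
      (by rwa [hNw _ (W.smul_mem s hw)]) hb1).1 ‖v‖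
    rw [show p + s • w + ‖v‖ • b = p + ‖v‖ • b + s • w by module] at h3
    rw [h3, inner_smul_left, (Submodule.mem_orthogonal' _ _).1 hb w hw, mul_zero] at h2
    exact h2
  have := is_const_of_deriv_eq_zero (fun s => (hD s).differentiableAt) (fun s => (hD s).deriv) 1 0
  simp only [one_smul, zero_smul, add_zero] at this
  change _ = f (p + ‖v‖ • b)
  rw [← this]
  congr 1; module

end Focal

/-! ### Smooth charts adapted to the fibres of a function -/

section Charts

variable {n : ℕ}

/-- The source is cut down to the open set where the derivative is invertible, so that the inverse
is smooth on the whole target and not only at one point. -/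
theorem exists_openPartialHomeomorph_of_hasFDerivAt
    {Φ : EuclideanSpace ℝ (Fin n) → EuclideanSpace ℝ (Fin n)} (hΦ : ContDiff ℝ ∞ Φ)
    {x : EuclideanSpace ℝ (Fin n)}
    {A : EuclideanSpace ℝ (Fin n) ≃L[ℝ] EuclideanSpace ℝ (Fin n)}
    (hA : HasFDerivAt Φ (A : EuclideanSpace ℝ (Fin n) →L[ℝ] EuclideanSpace ℝ (Fin n)) x) :
    ∃ T : OpenPartialHomeomorph (EuclideanSpace ℝ (Fin n)) (EuclideanSpace ℝ (Fin n)),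
      x ∈ T.source ∧ ⇑T = Φ ∧ ContDiffOn ℝ ∞ T.symm T.target := by
  have h0 : (∞ : WithTop ℕ∞) ≠ 0 := by simp
  let T₀ := hΦ.contDiffAt.toOpenPartialHomeomorph Φ hA h0
  have hcoe : ⇑T₀ = Φ := hΦ.contDiffAt.toOpenPartialHomeomorph_coe hA h0
  let U : Set (EuclideanSpace ℝ (Fin n)) := fderiv ℝ Φ ⁻¹' range ((↑) : (EuclideanSpace ℝ (Fin n)
    ≃L[ℝ] EuclideanSpace ℝ (Fin n)) → EuclideanSpace ℝ (Fin n) →L[ℝ] EuclideanSpace ℝ (Fin n))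
  have hU : IsOpen U :=
    (ContinuousLinearEquiv.isOpen (𝕜 := ℝ)).preimage (hΦ.continuous_fderiv (by simp))
  refine ⟨T₀.restrOpen U hU, ⟨hΦ.contDiffAt.mem_toOpenPartialHomeomorph_source hA h0,
    A, hA.fderiv.symm⟩, hcoe, fun b hb => ContDiffAt.contDiffWithinAt ?_⟩
  obtain ⟨B, hB⟩ := ((T₀.restrOpen U hU).map_target hb).2
  refine (T₀.restrOpen U hU).contDiffAt_symm (f₀' := B) hb ?_ ?_
  · rw [hB]
    change HasFDerivAt ⇑T₀ _ _
    rw [hcoe]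
    exact (hΦ.differentiable (by simp) _).hasFDerivAt
  · change ContDiffAt ℝ ∞ ⇑T₀ _
    rw [hcoe]
    exact hΦ.contDiffAt

/-- Near a regular point a smooth function is a linear function of suitable coordinates. -/
theorem exists_straightening {H : EuclideanSpace ℝ (Fin n) → ℝ} (hH : ContDiff ℝ ∞ H)
    {x a : EuclideanSpace ℝ (Fin n)} (ha : a ≠ 0) (hHa : HasFDerivAt H (innerSL ℝ a) x) :
    ∃ T : OpenPartialHomeomorph (EuclideanSpace ℝ (Fin n)) (EuclideanSpace ℝ (Fin n)),
      x ∈ T.source ∧ ContDiffOn ℝ ∞ T T.source ∧ ContDiffOn ℝ ∞ T.symm T.target ∧ T x = 0 ∧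
        ∀ y, inner ℝ a (T y) = H y - H x := by
  -- This is `y - x` with its component along `a` adjusted so that its inner product with `a` is `H
  -- y - H x`. Its derivative at `x` is the identity.
  let Φ : EuclideanSpace ℝ (Fin n) → EuclideanSpace ℝ (Fin n) := fun y =>
    (y - x) + ((H y - H x) - inner ℝ a (y - x)) • ((‖a‖ ^ 2)⁻¹ • a)
  have hΦ : ContDiff ℝ ∞ Φ :=
    have h1 : ContDiff ℝ ∞ fun y => y - x := contDiff_id.sub contDiff_const
    h1.add (((hH.sub contDiff_const).sub (contDiff_const.inner ℝ h1)).smul contDiff_const)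
  have hd : HasFDerivAt Φ ((ContinuousLinearEquiv.refl ℝ (EuclideanSpace ℝ (Fin n)) :
      EuclideanSpace ℝ (Fin n) ≃L[ℝ] EuclideanSpace ℝ (Fin n)) :
      EuclideanSpace ℝ (Fin n) →L[ℝ] EuclideanSpace ℝ (Fin n)) x := by
    have h1 : HasFDerivAt (fun y => y - x) (ContinuousLinearMap.id ℝ _) x :=
      (hasFDerivAt_id x).sub_const x
    have h2 : HasFDerivAt (fun y => (inner ℝ a (y - x) : ℝ)) (innerSL ℝ a) x := by
      have := (innerSL ℝ a).hasFDerivAt.comp x h1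
      exact this
    have h3 := h1.add (((hHa.sub_const (H x)).sub h2).smul_const ((‖a‖ ^ 2)⁻¹ • a))
    refine h3.congr_fderiv ?_
    ext v
    simp
  obtain ⟨T, hx, hT, hs⟩ := exists_openPartialHomeomorph_of_hasFDerivAt hΦ hd
  have ha2 : ‖a‖ ^ 2 ≠ 0 := pow_ne_zero 2 (norm_ne_zero_iff.2 ha)
  refine ⟨T, hx, by rw [hT]; exact hΦ.contDiffOn, hs, by simp [hT, Φ], fun y => ?_⟩
  rw [hT]
  simp only [Φ]
  rw [inner_add_right, inner_smul_right, inner_smul_right, real_inner_self_eq_norm_sq,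
    inv_mul_cancel₀ ha2]
  ring

theorem exists_equiv_prod (K : Submodule ℝ (EuclideanSpace ℝ (Fin n))) {k : ℕ}
    (hk : Module.finrank ℝ K = k) :
    ∃ A : EuclideanSpace ℝ (Fin n) ≃L[ℝ]
        (EuclideanSpace ℝ (Fin k) × EuclideanSpace ℝ (Fin (n - k))),
      ∀ u, A.symm (u, 0) ∈ K := by
  have hK := K.finrank_add_finrank_orthogonal
  rw [finrank_euclideanSpace_fin] at hK
  let B₁ : EuclideanSpace ℝ (Fin k) ≃ₗ[ℝ] K :=
    LinearEquiv.ofFinrankEq _ _ (by rw [finrank_euclideanSpace_fin, hk])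
  let B₂ : EuclideanSpace ℝ (Fin (n - k)) ≃ₗ[ℝ] Kᗮ :=
    LinearEquiv.ofFinrankEq _ _ (by rw [finrank_euclideanSpace_fin]; omega)
  let B := (B₁.prodCongr B₂).trans (Submodule.prodEquivOfIsCompl K Kᗮ K.isCompl_orthogonal)
  refine ⟨B.symm.toContinuousLinearEquiv, fun u => ?_⟩
  change B (u, 0) ∈ K
  simp [B]

/-- A coordinate system in which `q` is constant along `K` yields a product chart adapted to the
fibres of `q`. -/
theorem exists_product_chart {q : EuclideanSpace ℝ (Fin n) → ℝ} {x : EuclideanSpace ℝ (Fin n)}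
    (K : Submodule ℝ (EuclideanSpace ℝ (Fin n))) {k : ℕ} (hk : Module.finrank ℝ K = k)
    (T : OpenPartialHomeomorph (EuclideanSpace ℝ (Fin n)) (EuclideanSpace ℝ (Fin n)))
    (hx : x ∈ T.source) (hT : ContDiffOn ℝ ∞ T T.source) (hTs : ContDiffOn ℝ ∞ T.symm T.target)
    (hTx : T x = 0) (hq : ∀ y ∈ T.source, ∀ z ∈ T.source, T y - T z ∈ K → q y = q z) :
    ∃ (ψ : OpenPartialHomeomorph (EuclideanSpace ℝ (Fin n))
        (EuclideanSpace ℝ (Fin k) × EuclideanSpace ℝ (Fin (n - k))))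
      (V₁ : Set (EuclideanSpace ℝ (Fin k))) (V₂ : Set (EuclideanSpace ℝ (Fin (n - k)))),
      x ∈ ψ.source ∧ ContDiffOn ℝ ∞ ψ ψ.source ∧ ContDiffOn ℝ ∞ ψ.symm ψ.target ∧
        ψ.target = V₁ ×ˢ V₂ ∧ ψ x = (0, 0) ∧ ∀ c : ℝ,
          q ⁻¹' {c} ∩ ψ.source =
            ψ.symm '' (V₁ ×ˢ {v | v ∈ V₂ ∧ ψ.symm (0, v) ∈ q ⁻¹' {c}}) := by
  obtain ⟨A, hA⟩ := exists_equiv_prod K hk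
  let ψ₀ := T.trans A.toHomeomorph.toOpenPartialHomeomorph
  have hψ₀ : ∀ y, ψ₀ y = A (T y) := fun y => rfl
  have hψ₀s : ∀ b, ψ₀.symm b = T.symm (A.symm b) := fun b => rfl
  have hx₀ : x ∈ ψ₀.source := by simpa [ψ₀] using hx
  have hx0 : ψ₀ x = (0, 0) := by rw [hψ₀, hTx, map_zero]; rfl
  obtain ⟨ε, hε, hball⟩ := Metric.isOpen_iff.1 ψ₀.open_target _ (ψ₀.map_source hx₀)
  rw [hx0, ← ball_prod_same] at hball
  let V₁ : Set (EuclideanSpace ℝ (Fin k)) := ball 0 ε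
  let V₂ : Set (EuclideanSpace ℝ (Fin (n - k))) := ball 0 ε
  have hV : IsOpen (V₁ ×ˢ V₂) := isOpen_ball.prod isOpen_ball
  let ψ := (ψ₀.symm.restrOpen (V₁ ×ˢ V₂) hV).symm
  have htar : ψ.target = V₁ ×ˢ V₂ := inter_eq_right.2 hball
  have hψs : ∀ b, ψ.symm b = T.symm (A.symm b) := fun b => rfl
  have hAT : ∀ b ∈ V₁ ×ˢ V₂, A.symm b ∈ T.target := fun b hb => by
    simpa [ψ₀] using hball hb
  have hTψ : ∀ b ∈ V₁ ×ˢ V₂, ψ.symm b ∈ T.source ∧ T (ψ.symm b) = A.symm b := fun b hb =>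
    ⟨T.map_target (hAT b hb), T.right_inv (hAT b hb)⟩
  have hsrc : ψ.source ⊆ T.source := fun y hy => by
    rw [← ψ.left_inv hy]
    exact (hTψ _ (htar ▸ ψ.map_source hy)).1
  have h00 : ((0, 0) : EuclideanSpace ℝ (Fin k) × EuclideanSpace ℝ (Fin (n - k))) ∈ V₁ ×ˢ V₂ :=
    ⟨mem_ball_self hε, mem_ball_self hε⟩
  -- In the chart `T`, the points with coordinates (u, v) and (0, v) differ by an element of `K`.
  have hconst : ∀ u ∈ V₁, ∀ v ∈ V₂, q (ψ.symm (u, v)) = q (ψ.symm (0, v)) := by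
    intro u hu v hv
    have h1 := hTψ (u, v) ⟨hu, hv⟩
    have h2 := hTψ (0, v) ⟨h00.1, hv⟩
    refine hq _ h1.1 _ h2.1 ?_
    rw [h1.2, h2.2, ← map_sub]
    simpa using hA u
  refine ⟨ψ, V₁, V₂, ?_, ?_, ?_, htar, hx0, fun c => ?_⟩
  · have h1 : ψ.symm (0, 0) = x := by
      rw [hψs, ← hx0, hψ₀, A.symm_apply_apply, T.left_inv hx]
    rw [← h1]
    exact ψ.map_target (htar ▸ h00)
  · exact A.contDiff.comp_contDiffOn (hT.mono hsrc)
  · exact hTs.comp A.symm.contDiff.contDiffOn fun b hb => hAT b (htar ▸ hb)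
  · ext y
    constructor
    · rintro ⟨hyc, hy⟩
      have hb : ψ y ∈ V₁ ×ˢ V₂ := htar ▸ ψ.map_source hy
      refine ⟨ψ y, ⟨hb.1, hb.2, ?_⟩, ψ.left_inv hy⟩
      change q _ = c
      rw [← hconst _ hb.1 _ hb.2]
      exact (congrArg q (ψ.left_inv hy)).trans hyc
    · rintro ⟨⟨u, v⟩, ⟨hu, hv, hc⟩, rfl⟩
      exact ⟨(hconst u hu v hv).trans hc, ψ.map_target (htar ▸ ⟨hu, hv⟩)⟩

/-- The fibres of a function with connected fibres which locally has adapted coordinates form a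
foliation with singularities. -/
theorem isSingularFoliation_range_fiber {q : EuclideanSpace ℝ (Fin n) → ℝ}
    (hconn : ∀ x, IsPreconnected (q ⁻¹' {q x}))
    (hloc : ∀ x₀, ∃ k ≤ n, IsRegularSurface ∞ k (q ⁻¹' {q x₀}) ∧ ∀ x, q x = q x₀ →
      ∃ (K : Submodule ℝ (EuclideanSpace ℝ (Fin n)))
        (T : OpenPartialHomeomorph (EuclideanSpace ℝ (Fin n)) (EuclideanSpace ℝ (Fin n))),
        Module.finrank ℝ K = k ∧ x ∈ T.source ∧ ContDiffOn ℝ ∞ T T.source ∧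
          ContDiffOn ℝ ∞ T.symm T.target ∧ T x = 0 ∧
          ∀ y ∈ T.source, ∀ z ∈ T.source, T y - T z ∈ K → q y = q z) :
    IsSingularFoliation ∞ (range fun x => q ⁻¹' {q x}) where
  isPartition := by
    refine ⟨?_, fun x => ⟨q ⁻¹' {q x}, ⟨⟨x, rfl⟩, rfl⟩, ?_⟩⟩
    · rintro ⟨x, hx⟩
      exact (hx ▸ (rfl : q x = q x) : x ∈ (∅ : Set _))
    · rintro _ ⟨⟨y, rfl⟩, hy⟩
      have hy' : q x = q y := hy
      simp only [hy']
  isConnected := by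
    rintro _ ⟨x, rfl⟩
    exact ⟨⟨x, rfl⟩, hconn x⟩
  exists_chart := by
    rintro _ ⟨x₀, rfl⟩
    obtain ⟨k, hkn, hreg, h⟩ := hloc x₀
    refine ⟨k, hkn, hreg, fun x hx => ?_⟩
    obtain ⟨K, T, hK, hxT, hT, hTs, hTx, hq⟩ := h x hx
    obtain ⟨ψ, V₁, V₂, h1, h2, h3, h4, h5, h6⟩ := exists_product_chart K hK T hxT hT hTs hTx hq
    refine ⟨ψ, V₁, V₂, h1, h2, h3, h4, h5, ?_⟩
    rintro _ ⟨y, rfl⟩ -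
    exact h6 (q y)

/-- Adapted coordinates by translation, where `q` is invariant under `K`. -/
theorem exists_translation_coordinates {q : EuclideanSpace ℝ (Fin n) → ℝ}
    (K : Submodule ℝ (EuclideanSpace ℝ (Fin n))) (hq : ∀ y z, y - z ∈ K → q y = q z)
    (x : EuclideanSpace ℝ (Fin n)) :
    ∃ T : OpenPartialHomeomorph (EuclideanSpace ℝ (Fin n)) (EuclideanSpace ℝ (Fin n)),
      x ∈ T.source ∧ ContDiffOn ℝ ∞ T T.source ∧ ContDiffOn ℝ ∞ T.symm T.target ∧ T x = 0 ∧
        ∀ y ∈ T.source, ∀ z ∈ T.source, T y - T z ∈ K → q y = q z := by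
  refine ⟨(Homeomorph.addRight (-x)).toOpenPartialHomeomorph, mem_univ _, ?_, ?_, ?_, ?_⟩
  · exact (contDiff_id.add contDiff_const).contDiffOn
  · exact (contDiff_id.add contDiff_const).contDiffOn
  · exact add_neg_cancel x
  · intro y _ z _ h
    refine hq y z ?_
    simpa using h

/-- Adapted coordinates at the points of a regular level set. -/
theorem exists_regular_coordinates {q H : EuclideanSpace ℝ (Fin n) → ℝ} (hH : ContDiff ℝ ∞ H)
    (hqH : ∀ y z, q y = q z ↔ H y = H z) {a : EuclideanSpace ℝ (Fin n) → EuclideanSpace ℝ (Fin n)}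
    (hHa : ∀ x, HasFDerivAt H (innerSL ℝ (a x)) x) {x₀ : EuclideanSpace ℝ (Fin n)}
    (ha : ∀ x, q x = q x₀ → a x ≠ 0) :
    IsRegularSurface ∞ (n - 1) (q ⁻¹' {q x₀}) ∧ ∀ x, q x = q x₀ →
      ∃ (K : Submodule ℝ (EuclideanSpace ℝ (Fin n)))
        (T : OpenPartialHomeomorph (EuclideanSpace ℝ (Fin n)) (EuclideanSpace ℝ (Fin n))),
        Module.finrank ℝ K = n - 1 ∧ x ∈ T.source ∧ ContDiffOn ℝ ∞ T T.source ∧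
          ContDiffOn ℝ ∞ T.symm T.target ∧ T x = 0 ∧
          ∀ y ∈ T.source, ∀ z ∈ T.source, T y - T z ∈ K → q y = q z := by
  have hfr : ∀ b : EuclideanSpace ℝ (Fin n), b ≠ 0 → Module.finrank ℝ (ℝ ∙ b)ᗮ = n - 1 := by
    intro b hb
    have h1 := (ℝ ∙ b).finrank_add_finrank_orthogonal
    rw [finrank_euclideanSpace_fin, finrank_span_singleton hb] at h1
    omega
  constructor
  · intro x hx
    obtain ⟨T, h1, h2, h3, -, h5⟩ := exists_straightening hH (ha x hx) (hHa x)
    refine ⟨T, (ℝ ∙ a x)ᗮ, h1, h2, h3, hfr _ (ha x hx), fun y _ => ?_⟩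
    rw [Submodule.mem_orthogonal_singleton_iff_inner_right, h5, sub_eq_zero, ← hqH]
    change q y = q x₀ ↔ _
    rw [show q x = q x₀ from hx]
  · intro x hx
    obtain ⟨T, h1, h2, h3, h4, h5⟩ := exists_straightening hH (ha x hx) (hHa x)
    refine ⟨(ℝ ∙ a x)ᗮ, T, hfr _ (ha x hx), h1, h2, h3, h4, fun y _ z _ h => ?_⟩
    rw [Submodule.mem_orthogonal_singleton_iff_inner_right, inner_sub_right, h5, h5] at h
    rw [hqH]
    linarith

end Charts

/-! ### Level surfaces as fibres of a linear form or of a distance -/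

section Classification

variable {n : ℕ} {f : EuclideanSpace ℝ (Fin n) → ℝ}

/-- A connected fibre lies in one level surface. If a level surface met two fibres, it would meet
all those between them, so `f` would be constant on a nonempty open set of critical points. -/
theorem IsMetricFunction.levelSurface_eq_fiber (hn : 1 ≤ n) (hf : IsMetricFunction f)
    (hcrit : HasRegularCriticalSet f) {q : EuclideanSpace ℝ (Fin n) → ℝ} (hq : Continuous q)
    {h : ℝ → ℝ} (hfq : ∀ x, f x = h (q x)) (hconn : ∀ x, IsPreconnected (q ⁻¹' {q x}))
    (x : EuclideanSpace ℝ (Fin n)) : levelSurface f x = q ⁻¹' {q x} := by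
  refine Subset.antisymm (fun y hy => ?_) (subset_levelSurface (hconn x) rfl fun y hy => by
    rw [hfq, hfq, show q y = q x from hy])
  by_contra hne
  have himg : uIcc (q x) (q y) ⊆ q '' levelSurface f x :=
    ((isPreconnected_levelSurface f x).image q hq.continuousOn).ordConnected.uIcc_subset
      ⟨x, self_mem_levelSurface f x, rfl⟩ ⟨y, hy, rfl⟩
  let U := q ⁻¹' Ioo (min (q x) (q y)) (max (q x) (q y))
  have hU : IsOpen U := isOpen_Ioo.preimage hq
  have hUf : ∀ z ∈ U, f z = f x := by
    intro z hz
    obtain ⟨z', hz', hqz⟩ := himg (Ioo_subset_Icc_self hz)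
    rw [hfq z, ← hqz, ← hfq]
    exact eq_of_mem_levelSurface hz'
  have hUK : U ⊆ criticalSet f := by
    intro z hz
    have h1 : f =ᶠ[𝓝 z] fun _ => f x := by
      filter_upwards [hU.mem_nhds hz] with w hw using hUf w hw
    change gradient f z = 0
    rw [h1.gradient_eq]
    simp
  obtain ⟨c, hc⟩ : (Ioo (min (q x) (q y)) (max (q x) (q y))).Nonempty :=
    nonempty_Ioo.2 (min_lt_max.2 fun h' => hne h'.symm)
  obtain ⟨z, -, hz⟩ := himg (Ioo_subset_Icc_self hc)
  have : z ∈ interior (criticalSet f) := interior_maximal hUK hU (show q z ∈ _ from hz ▸ hc)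
  rw [hf.interior_criticalSet hn hcrit] at this
  exact this

theorem isSingularFoliation_hyperplanes {e : EuclideanSpace ℝ (Fin n)} (he : e ≠ 0) :
    IsSingularFoliation ∞
      (range fun x => (fun y => (inner ℝ e y : ℝ)) ⁻¹' {(inner ℝ e x : ℝ)}) := by
  refine isSingularFoliation_range_fiber (fun x => ?_) fun x₀ => ?_
  · exact ((convex_singleton _).linear_preimage (innerSL ℝ e).toLinearMap).isPreconnected
  · obtain ⟨h1, h2⟩ := exists_regular_coordinates (q := fun y => (inner ℝ e y : ℝ))
      (H := fun y => (inner ℝ e y : ℝ)) (a := fun _ => e) (x₀ := x₀)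
      (contDiff_const.inner ℝ contDiff_id) (fun _ _ => Iff.rfl)
      (fun x => (innerSL ℝ e).hasFDerivAt) (fun _ _ => he)
    exact ⟨n - 1, Nat.sub_le _ _, h1, h2⟩

/-- The distance to the affine plane `p + W`. -/
noncomputable def distPlane (p : EuclideanSpace ℝ (Fin n))
    (W : Submodule ℝ (EuclideanSpace ℝ (Fin n))) (x : EuclideanSpace ℝ (Fin n)) : ℝ :=
  ‖Wᗮ.starProjection (x - p)‖

variable {p : EuclideanSpace ℝ (Fin n)} {W : Submodule ℝ (EuclideanSpace ℝ (Fin n))}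

theorem continuous_distPlane : Continuous (distPlane p W) := by
  unfold distPlane
  fun_prop

theorem distPlane_nonneg (x : EuclideanSpace ℝ (Fin n)) : 0 ≤ distPlane p W x := norm_nonneg _

theorem exists_decomposition (p : EuclideanSpace ℝ (Fin n))
    (W : Submodule ℝ (EuclideanSpace ℝ (Fin n))) (x : EuclideanSpace ℝ (Fin n)) :
    ∃ v ∈ Wᗮ, ∃ w ∈ W, x = p + v + w ∧ distPlane p W x = ‖v‖ := by
  refine ⟨_, Wᗮ.starProjection_apply_mem (x - p), _, W.starProjection_apply_mem (x - p), ?_, rfl⟩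
  have h := W.starProjection_add_starProjection_orthogonal (x - p)
  rw [add_assoc, add_comm (Wᗮ.starProjection _), h]
  module

theorem distPlane_add {v w : EuclideanSpace ℝ (Fin n)} (hv : v ∈ Wᗮ) (hw : w ∈ W) :
    distPlane p W (p + v + w) = ‖v‖ := by
  rw [distPlane, show p + v + w - p = v + w by module, map_add,
    Submodule.starProjection_eq_self_iff.2 hv, (Submodule.starProjection_apply_eq_zero_iff _).2
      (W.le_orthogonal_orthogonal hw), add_zero]

theorem roundCylinder_eq_preimage (p : EuclideanSpace ℝ (Fin n))
    (W : Submodule ℝ (EuclideanSpace ℝ (Fin n))) (r : ℝ) :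
    roundCylinder p W r = distPlane p W ⁻¹' {r} := by
  ext x
  constructor
  · rintro ⟨v, hv, w, hw, rfl, rfl⟩
    exact distPlane_add hv hw
  · rintro rfl
    obtain ⟨v, hv, w, hw, h1, h2⟩ := exists_decomposition p W x
    exact ⟨v, hv, w, hw, h2.symm, h1⟩

theorem planeThrough_eq_preimage (p : EuclideanSpace ℝ (Fin n))
    (W : Submodule ℝ (EuclideanSpace ℝ (Fin n))) :
    planeThrough p W = distPlane p W ⁻¹' {0} := by
  rw [← roundCylinder_eq_preimage]
  ext x
  constructor
  · rintro ⟨w, hw, rfl⟩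
    exact ⟨0, Wᗮ.zero_mem, w, hw, norm_zero, by simp⟩
  · rintro ⟨v, hv, w, hw, h, rfl⟩
    exact ⟨w, hw, by simp [norm_eq_zero.1 h]⟩

theorem isPreconnected_roundCylinder (hW : Module.finrank ℝ W + 2 ≤ n) (r : ℝ) :
    IsPreconnected (roundCylinder p W r) := by
  have hfr := W.finrank_add_finrank_orthogonal
  rw [finrank_euclideanSpace_fin] at hfr
  have h1 : 1 < Module.rank ℝ Wᗮ := by
    rw [← Module.finrank_eq_rank]
    exact_mod_cast (by omega : 1 < Module.finrank ℝ Wᗮ)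
  have h2 := (isPreconnected_sphere h1 (0 : Wᗮ) r).prod (isPreconnected_univ (α := W))
  have h3 := h2.image (fun z => p + (z.1 : EuclideanSpace ℝ (Fin n)) + z.2)
    (Continuous.continuousOn (by fun_prop))
  convert h3
  ext x
  constructor
  · rintro ⟨v, hv, w, hw, h, rfl⟩
    exact ⟨(⟨v, hv⟩, ⟨w, hw⟩), ⟨by simpa using h, mem_univ _⟩, rfl⟩
  · rintro ⟨⟨v, w⟩, ⟨h, -⟩, rfl⟩
    exact ⟨v, v.2, w, w.2, by simpa using h, rfl⟩

theorem hasFDerivAt_distPlane_sq (x : EuclideanSpace ℝ (Fin n)) :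
    HasFDerivAt (fun y => distPlane p W y ^ 2)
      (innerSL ℝ ((2 : ℝ) • Wᗮ.starProjection (x - p))) x := by
  have h1 : HasFDerivAt (fun y => Wᗮ.starProjection (y - p)) Wᗮ.starProjection x := by
    have := (Wᗮ.starProjection).hasFDerivAt.comp x ((hasFDerivAt_id x).sub_const p)
    exact this
  refine h1.norm_sq.congr_fderiv ?_
  ext v
  have h2 : (inner ℝ (Wᗮ.starProjection (x - p)) (Wᗮ.starProjection v) : ℝ) =
      inner ℝ (Wᗮ.starProjection (x - p)) v := by
    rw [← Submodule.inner_starProjection_left_eq_right,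
      Submodule.starProjection_eq_self_iff.2 (Wᗮ.starProjection_apply_mem _)]
  change (2 : ℕ) • (inner ℝ (Wᗮ.starProjection (x - p)) (Wᗮ.starProjection v) : ℝ) =
    inner ℝ ((2 : ℝ) • Wᗮ.starProjection (x - p)) v
  rw [h2, inner_smul_left, nsmul_eq_mul]
  simp

theorem isSingularFoliation_cylinders (hW : Module.finrank ℝ W + 2 ≤ n) :
    IsSingularFoliation ∞ (range fun x => distPlane p W ⁻¹' {distPlane p W x}) := by
  refine isSingularFoliation_range_fiber (fun x => ?_) fun x₀ => ?_
  · rw [← roundCylinder_eq_preimage]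
    exact isPreconnected_roundCylinder hW _
  by_cases h0 : distPlane p W x₀ = 0
  · refine ⟨Module.finrank ℝ W, by omega, ?_, fun x _ => ?_⟩
    · rw [h0, ← planeThrough_eq_preimage]
      exact isRegularSurface_planeThrough p W ∞
    · obtain ⟨T, hT⟩ := exists_translation_coordinates (q := distPlane p W) W (fun y z h => by
        have h1 : Wᗮ.starProjection (y - z) = 0 :=
          (Submodule.starProjection_apply_eq_zero_iff _).2 (W.le_orthogonal_orthogonal h)
        rw [distPlane, show y - p = (y - z) + (z - p) by module, map_add, h1, zero_add, distPlane])
        x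
      exact ⟨W, T, rfl, hT⟩
  · obtain ⟨h1, h2⟩ := exists_regular_coordinates (q := distPlane p W)
      -- The square has the same fibres as the distance and is smooth everywhere.
      (H := fun y => distPlane p W y ^ 2) (x₀ := x₀)
      (a := fun x => (2 : ℝ) • Wᗮ.starProjection (x - p))
      (ContDiff.norm_sq ℝ (by fun_prop))
      (fun y z => (sq_eq_sq₀ (distPlane_nonneg y) (distPlane_nonneg z)).symm)
      hasFDerivAt_distPlane_sq
      (fun x hx => smul_ne_zero two_ne_zero (norm_ne_zero_iff.1 (show distPlane p W x ≠ 0 by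
        rwa [hx])))
    exact ⟨n - 1, Nat.sub_le _ _, h1, h2⟩

theorem range_fiber_distPlane (hW : Module.finrank ℝ W + 2 ≤ n) :
    (range fun x => distPlane p W ⁻¹' {distPlane p W x}) =
      {L | ∃ r : ℝ, 0 < r ∧ L = roundCylinder p W r} ∪ {planeThrough p W} := by
  ext L
  constructor
  · rintro ⟨x, rfl⟩
    rcases (distPlane_nonneg (p := p) (W := W) x).eq_or_lt with h | h
    · right
      simp only [← h, ← planeThrough_eq_preimage, mem_singleton_iff]
    · exact Or.inl ⟨_, h, (roundCylinder_eq_preimage _ _ _).symm⟩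
  · rintro (⟨r, hr, rfl⟩ | rfl)
    · have hfr := W.finrank_add_finrank_orthogonal
      rw [finrank_euclideanSpace_fin] at hfr
      have : Nontrivial Wᗮ := Module.nontrivial_of_finrank_pos (R := ℝ) (by omega)
      obtain ⟨v, hv⟩ := exists_norm_eq Wᗮ hr.le
      refine ⟨p + v + 0, ?_⟩
      simp only [distPlane_add v.2 W.zero_mem, roundCylinder_eq_preimage]
      rw [← hv]; rfl
    · refine ⟨p + 0 + 0, ?_⟩
      simp only [distPlane_add Wᗮ.zero_mem W.zero_mem, planeThrough_eq_preimage, norm_zero]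

theorem planeThrough_bot (p : EuclideanSpace ℝ (Fin n)) : planeThrough p ⊥ = {p} := by
  ext x; simp [planeThrough]

theorem roundCylinder_bot (p : EuclideanSpace ℝ (Fin n)) (r : ℝ) :
    roundCylinder p ⊥ r = sphere p r := by
  ext x
  rw [mem_sphere_iff_norm]
  constructor
  · rintro ⟨v, -, w, hw, h, rfl⟩
    rw [(Submodule.mem_bot ℝ).1 hw]
    simpa using h
  · intro h
    exact ⟨x - p, by simp, 0, by simp, h, by module⟩

/-- A surface containing a translate of `W` has dimension at least that of `W`. -/
theorem IsRegularSurface.finrank_le {r : ℕ} {S : Set (EuclideanSpace ℝ (Fin n))}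
    (hS : IsRegularSurface 1 r S) {x : EuclideanSpace ℝ (Fin n)} (hx : x ∈ S)
    (hW : ∀ w ∈ W, x + w ∈ S) : Module.finrank ℝ W ≤ r := by
  have h1 := hS.finrank_normalSpace hx
  have h2 : normalSpace S x ≤ Wᗮ := by
    intro m hm
    rw [Submodule.mem_orthogonal']
    intro w hw
    exact inner_eq_zero_of_curve hm (by simp) (hasDerivAt_line x w 0)
      (.of_forall fun s => hW _ (W.smul_mem s hw))
  have h3 := Submodule.finrank_mono h2
  have h4 := W.finrank_add_finrank_orthogonal
  rw [finrank_euclideanSpace_fin] at h4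
  omega

end Classification

/-! ### The classification -/

theorem mainTheorem1 {n : ℕ} (hn : 1 ≤ n) (f : EuclideanSpace ℝ (Fin n) → ℝ)
    (hf : IsMetricFunction f) (hcrit : HasRegularCriticalSet f) :
    IsSingularFoliation ∞ (levelSurfaces f) ∧
      (IsParallelHyperplanes (levelSurfaces f) ∨
        IsConcentricSpheres (levelSurfaces f) ∨
        ∃ k : ℕ, 1 ≤ k ∧ k + 2 ≤ n ∧ IsLeast (criticalDimensions f) k ∧
          IsConcentricCylinders k (levelSurfaces f)) := by
  -- The first case includes functions without critical points and, since points then have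
  -- codimension one, the case n = 1.
  by_cases hA : ∀ p, gradient f p = 0 →
      ∃ r, r + 1 = n ∧ IsRegularSurface 1 r (connectedComponentIn (criticalSet f) p)
  · obtain ⟨e, h, he, hfe⟩ := hf.exists_eq_comp_inner hn hcrit hA
    have hF : levelSurfaces f =
        range fun x => (fun y => (inner ℝ e y : ℝ)) ⁻¹' {(inner ℝ e x : ℝ)} :=
      congrArg range (funext (hf.levelSurface_eq_fiber hn hcrit
        (q := fun y => (inner ℝ e y : ℝ)) (by fun_prop) hfe
        fun x => ((convex_singleton _).linear_preimage (innerSL ℝ e).toLinearMap).isPreconnected))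
    rw [hF]
    refine ⟨isSingularFoliation_hyperplanes he, Or.inl ⟨e, he, ?_⟩⟩
    ext L
    constructor
    · rintro ⟨x, rfl⟩
      exact ⟨_, rfl⟩
    · rintro ⟨c, rfl⟩
      refine ⟨(c / ‖e‖ ^ 2) • e, ?_⟩
      have : (inner ℝ e ((c / ‖e‖ ^ 2) • e) : ℝ) = c := by
        rw [inner_smul_right, real_inner_self_eq_norm_sq,
          div_mul_cancel₀ _ (pow_ne_zero 2 (norm_ne_zero_iff.2 he))]
      simp only [this]
      rfl
  · push Not at hA
    obtain ⟨p, hp, hpr⟩ := hA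
    obtain ⟨r, hrn, hC⟩ := hcrit.exists_isRegularSurface hn hp
    have hr : r + 2 ≤ n := by
      have : r + 1 ≠ n := fun h => hpr r h hC
      omega
    obtain ⟨W, rfl, hCW, hN⟩ := hf.exists_eq_planeThrough hn hcrit hp hr hC
    obtain ⟨h, hfh⟩ := hf.exists_eq_comp_dist hn hcrit hr hCW hN
    have hF : levelSurfaces f = range fun x => distPlane p W ⁻¹' {distPlane p W x} :=
      congrArg range (funext (hf.levelSurface_eq_fiber hn hcrit continuous_distPlane (h := h)
        (fun x => by
          obtain ⟨v, hv, w, hw, h1, h2⟩ := exists_decomposition p W x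
          rw [h2, ← hfh w hw v hv, ← h1])
        (fun x => by
          rw [← roundCylinder_eq_preimage]
          exact isPreconnected_roundCylinder hr _)))
    refine ⟨hF ▸ isSingularFoliation_cylinders hr, Or.inr ?_⟩
    rw [range_fiber_distPlane hr] at hF
    rcases Nat.eq_zero_or_pos (Module.finrank ℝ W) with h0 | h0
    · left
      rw [Submodule.finrank_eq_zero] at h0
      subst h0
      simp only [roundCylinder_bot, planeThrough_bot] at hF
      exact ⟨p, hF⟩
    · right
      refine ⟨Module.finrank ℝ W, h0, hr, ⟨⟨planeThrough p W, hF ▸ Or.inr rfl, ?_, ?_⟩, ?_⟩,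
        p, W, rfl, hF⟩
      · rw [← hCW]
        exact connectedComponentIn_subset _ _
      · exact isRegularSurface_planeThrough p W 1
      -- Every leaf is invariant under translation by `W`, so none has smaller dimension.
      · rintro r' ⟨L, hL, -, hreg⟩
        rw [hF, ← range_fiber_distPlane hr] at hL
        obtain ⟨x, rfl⟩ := hL
        refine hreg.finrank_le (x := x) rfl fun w hw => ?_
        obtain ⟨v, hv, w', hw', h1, h2⟩ := exists_decomposition p W x
        change distPlane p W (x + w) = _
        rw [h2, h1, add_assoc, distPlane_add hv (W.add_mem hw' hw)]
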